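/- Let $L_-,L_+>0$, $I=(-L_-,L_+)$, and let $q\in C^2(\overline I;\mathbb R)$ satisfy $q(0)=0$, $q'(0)>0$ and $q(x)\neq 0$ for all $x\in\overline I\setminus\{0\}$. For $x\in I$ put $\delta(x)=\int_0^x q(s)\,ds$. For $\nu\in\mathbb C$ with $\operatorname{Re}\nu>0$ let $P_\nu$ be the unbounded operator $-\partial_x^2+\nu^2q(x)^2$ on $L^2(I)$ (complex valued) with domain $H^2(I)\cap H^1_0(I)$. For $\theta_0\in[0,\pi/2)$ put $\Sigma_{\theta_0}=\{\nu\in\mathbb C:\ |\nu|\ge 1,\ |\arg\nu|\le\theta_0\}$. Fix $\theta_0\in[0,\pi/2)$. Call $\nu_{\theta_0}\ge 0$ a threshold if for every $\nu\in\Sigma_{\theta_0}$ with $|\nu|\ge\nu_{\theta_0}$ the operator $P_\nu$ has exactly one eigenvalue $\lambda_\nu$ with $|\lambda_\nu-q'(0)\nu|\le q'(0)|\nu|$, and $\lambda_\nu$ is algebraically simple. For such $\nu$ let $$\Pi_\nu=\frac1{2\pi i}\oint_{|z-\lambda_\nu|=r}(z-P_\nu)^{-1}\,dz\qquad(r>0\text{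 small})$$ be the spectral projection of $P_\nu$ at $\lambda_\nu$, and let $$\tilde\varphi_\nu(x)=\nu^{1/4}e^{-q'(0)\nu x^2/2}\ (x\in I),\qquad \varphi_\nu=\Pi_\nu\tilde\varphi_\nu\in L^2(I),$$ with the principal branch of $\nu^{1/4}$. Then a threshold exists. Moreover, for every threshold $\nu_{\theta_0}$ and every $\varepsilon\in(0,1)$ there is $C>0$ such that for every $\nu\in\Sigma_{\theta_0}$ with $|\nu|\ge\nu_{\theta_0}$, $$\int_I\big|\varphi_\nu(x)e^{\nu(1-\varepsilon)\delta(x)}\big|^2\,dx\le C|\nu|,\qquad \big\|\varphi_\nu e^{\nu(1-\varepsilon)\delta}\big\|_{L^\infty(I)}\le C|\nu|.$$ -/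

import Mathlib

open MeasureTheory Set
open scoped ENNReal ContDiff

noncomputable section

namespace Grushin

/-! ### Function spaces on the interval `I = (-Lneg, Lpos)` -/

/-- Lebesgue measure on the open interval `I = (-Lneg, Lpos)`. -/
abbrev volI (Lneg Lpos : ℝ) : Measure ℝ := volume.restrict (Ioo (-Lneg) Lpos)

/-- The complex Hilbert space `L²(I)`. -/
abbrev L2I (Lneg Lpos : ℝ) : Type := Lp ℂ 2 (volI Lneg Lpos)

/-- `φ ∈ C_c^∞(I; ℂ)`. -/
structure IsTest (Lneg Lpos : ℝ) (φ : ℝ → ℂ) : Prop where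
  smooth : ContDiff ℝ ∞ φ
  compact : HasCompactSupport φ
  supp : tsupport φ ⊆ Ioo (-Lneg) Lpos

/-- `v` is the weak derivative of `u` on `I`: `∫_I u φ' = - ∫_I v φ` for every test function. -/
def HasWeakDeriv {Lneg Lpos : ℝ} (u v : L2I Lneg Lpos) : Prop :=
  ∀ φ : ℝ → ℂ, IsTest Lneg Lpos φ →
    ∫ x in Ioo (-Lneg) Lpos, u x * deriv φ x = - ∫ x in Ioo (-Lneg) Lpos, v x * φ x

theorem integrable_mul_test {Lneg Lpos : ℝ} (u : L2I Lneg Lpos) {g : ℝ → ℂ} (hg : Continuous g)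
    (hc : HasCompactSupport g) : Integrable (fun x => u x * g x) (volI Lneg Lpos) := by
  have h1 : Integrable (u : ℝ → ℂ) (volI Lneg Lpos) := (Lp.memLp u).integrable (by norm_num)
  obtain ⟨C, hC⟩ := hc.exists_bound_of_continuous hg
  exact h1.mul_bdd (c := C) hg.aestronglyMeasurable (Filter.Eventually.of_forall hC)

theorem IsTest.continuous_deriv {Lneg Lpos : ℝ} {φ : ℝ → ℂ} (h : IsTest Lneg Lpos φ) :
    Continuous (deriv φ) :=
  h.smooth.continuous_deriv (by simp)

theorem IsTest.differentiable {Lneg Lpos : ℝ} {φ : ℝ → ℂ} (h : IsTest Lneg Lpos φ) :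
    Differentiable ℝ φ :=
  h.smooth.differentiable (by simp)

theorem HasWeakDeriv.add {Lneg Lpos : ℝ} {u v u' v' : L2I Lneg Lpos} (h : HasWeakDeriv u v)
    (h' : HasWeakDeriv u' v') : HasWeakDeriv (u + u') (v + v') := by
  intro φ hφ
  have e1 : ∫ x in Ioo (-Lneg) Lpos, (u + u' : L2I Lneg Lpos) x * deriv φ x
      = ∫ x in Ioo (-Lneg) Lpos, (u x * deriv φ x + u' x * deriv φ x) := by
    refine integral_congr_ae ?_
    filter_upwards [Lp.coeFn_add u u'] with x hx
    rw [hx, Pi.add_apply, add_mul]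
  have e2 : ∫ x in Ioo (-Lneg) Lpos, (v + v' : L2I Lneg Lpos) x * φ x
      = ∫ x in Ioo (-Lneg) Lpos, (v x * φ x + v' x * φ x) := by
    refine integral_congr_ae ?_
    filter_upwards [Lp.coeFn_add v v'] with x hx
    rw [hx, Pi.add_apply, add_mul]
  rw [e1, e2, integral_add (integrable_mul_test u hφ.continuous_deriv hφ.compact.deriv)
    (integrable_mul_test u' hφ.continuous_deriv hφ.compact.deriv),
    integral_add (integrable_mul_test v hφ.smooth.continuous hφ.compact)
    (integrable_mul_test v' hφ.smooth.continuous hφ.compact), h φ hφ, h' φ hφ]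
  ring

theorem HasWeakDeriv.smul {Lneg Lpos : ℝ} {u v : L2I Lneg Lpos} (c : ℂ) (h : HasWeakDeriv u v) :
    HasWeakDeriv (c • u) (c • v) := by
  intro φ hφ
  have e1 : ∫ x in Ioo (-Lneg) Lpos, (c • u : L2I Lneg Lpos) x * deriv φ x
      = ∫ x in Ioo (-Lneg) Lpos, c * (u x * deriv φ x) := by
    refine integral_congr_ae ?_
    filter_upwards [Lp.coeFn_smul c u] with x hx
    rw [hx, Pi.smul_apply, smul_eq_mul, mul_assoc]
  have e2 : ∫ x in Ioo (-Lneg) Lpos, (c • v : L2I Lneg Lpos) x * φ x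
      = ∫ x in Ioo (-Lneg) Lpos, c * (v x * φ x) := by
    refine integral_congr_ae ?_
    filter_upwards [Lp.coeFn_smul c v] with x hx
    rw [hx, Pi.smul_apply, smul_eq_mul, mul_assoc]
  rw [e1, e2, integral_const_mul, integral_const_mul, h φ hφ, mul_neg]

theorem HasWeakDeriv.zero {Lneg Lpos : ℝ} : HasWeakDeriv (0 : L2I Lneg Lpos) 0 := by
  intro φ _
  have e : ∀ g : ℝ → ℂ, ∫ x in Ioo (-Lneg) Lpos, (0 : L2I Lneg Lpos) x * g x = 0 := by
    intro g
    refine integral_eq_zero_of_ae ?_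
    filter_upwards [Lp.coeFn_zero ℂ 2 (volI Lneg Lpos)] with x hx
    simp only [hx, Pi.zero_apply, zero_mul]
  rw [e, e, neg_zero]

/-- Weak derivatives are unique; by linearity this is the case `u = 0`. -/
theorem HasWeakDeriv.eq_zero {Lneg Lpos : ℝ} {v : L2I Lneg Lpos} (h : HasWeakDeriv 0 v) : v = 0 := by
  have key : ∀ᵐ x ∂volume, x ∈ Ioo (-Lneg) Lpos → v x = 0 := by
    have hint : IntegrableOn (v : ℝ → ℂ) (Ioo (-Lneg) Lpos) volume :=
      (Lp.memLp v).integrable (by norm_num)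
    refine isOpen_Ioo.ae_eq_zero_of_integral_contDiff_smul_eq_zero
      hint.locallyIntegrableOn ?_
    intro g hg hgc hgs
    have hsub : tsupport (fun x => (g x : ℂ)) ⊆ tsupport g := by
      refine closure_mono ?_
      intro x hx
      simpa using hx
    have ht : IsTest Lneg Lpos (fun x => (g x : ℂ)) :=
      ⟨Complex.ofRealCLM.contDiff.comp hg, hgc.mono' (subset_closure.trans hsub),
        hsub.trans hgs⟩
    have h1 := h _ ht
    have h0 : ∫ x in Ioo (-Lneg) Lpos, (0 : L2I Lneg Lpos) x * deriv (fun x => (g x : ℂ)) x = 0 := by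
      refine integral_eq_zero_of_ae ?_
      filter_upwards [Lp.coeFn_zero ℂ 2 (volI Lneg Lpos)] with x hx
      simp only [hx, Pi.zero_apply, zero_mul]
    rw [h0] at h1
    have h2 : ∫ x in Ioo (-Lneg) Lpos, v x * (g x : ℂ) = 0 := by
      rw [eq_comm, neg_eq_zero] at h1
      exact h1
    have h3 : ∫ x, g x • v x = ∫ x in Ioo (-Lneg) Lpos, g x • v x := by
      rw [setIntegral_eq_integral_of_forall_compl_eq_zero]
      intro x hx
      have : g x = 0 := by
        by_contra hne
        exact hx (hgs (subset_closure hne))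
      rw [this, zero_smul]
    rw [h3, ← h2]
    refine integral_congr_ae (Filter.Eventually.of_forall fun x => ?_)
    simp only [Complex.real_smul]
    ring
  have : (v : ℝ → ℂ) =ᵐ[volI Lneg Lpos] (0 : L2I Lneg Lpos) := by
    have k2 := (ae_restrict_iff' measurableSet_Ioo).2 key
    filter_upwards [k2, Lp.coeFn_zero ℂ 2 (volI Lneg Lpos)] with x hx h0
    rw [hx, h0, Pi.zero_apply]
  exact Lp.ext this

/-- The pairs `(φ, φ')` with `φ ∈ C_c^∞(I)`, as a subspace of `L²(I) × L²(I)`. -/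
def testPairs (Lneg Lpos : ℝ) : Submodule ℂ (L2I Lneg Lpos × L2I Lneg Lpos) where
  carrier := {p | ∃ φ : ℝ → ℂ, IsTest Lneg Lpos φ ∧
    p.1 =ᵐ[volI Lneg Lpos] φ ∧ p.2 =ᵐ[volI Lneg Lpos] deriv φ}
  zero_mem' := by
    refine ⟨0, ⟨contDiff_const, HasCompactSupport.zero, ?_⟩, Lp.coeFn_zero _ _ _, ?_⟩
    · simp [tsupport]
    · have : deriv (0 : ℝ → ℂ) = 0 := by ext x; simp
      rw [this]
      exact Lp.coeFn_zero _ _ _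
  add_mem' := by
    rintro p p' ⟨φ, hφ, h1, h2⟩ ⟨ψ, hψ, h1', h2'⟩
    refine ⟨φ + ψ, ⟨hφ.smooth.add hψ.smooth, hφ.compact.add hψ.compact,
      (tsupport_add φ ψ).trans (union_subset hφ.supp hψ.supp)⟩, ?_, ?_⟩
    · exact (Lp.coeFn_add _ _).trans (h1.add h1')
    · have : deriv (φ + ψ) = deriv φ + deriv ψ := by
        ext x
        exact deriv_add (hφ.differentiable x) (hψ.differentiable x)
      rw [this]
      exact (Lp.coeFn_add _ _).trans (h2.add h2')
  smul_mem' := by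
    rintro c p ⟨φ, hφ, h1, h2⟩
    refine ⟨c • φ, ⟨contDiff_const.smul hφ.smooth, hφ.compact.smul_left,
      (closure_mono (Function.support_const_smul_subset c φ)).trans hφ.supp⟩, ?_, ?_⟩
    · exact (Lp.coeFn_smul _ _).trans (h1.const_smul c)
    · have : deriv (c • φ) = c • deriv φ := by
        ext x
        exact deriv_const_smul c (hφ.differentiable x)
      rw [this]
      exact (Lp.coeFn_smul _ _).trans (h2.const_smul c)

/-- `H¹₀(I)`: the closure of `C_c^∞(I)` for the norm of `H¹(I)`. -/
def H10 (Lneg Lpos : ℝ) : Submodule ℂ (L2I Lneg Lpos) :=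
  (testPairs Lneg Lpos).topologicalClosure.map (LinearMap.fst ℂ _ _)

/-! ### The operator `P_ν = -∂_x² + ν² q(x)²` -/

/-- The graph of `P_ν`: the pairs `(u, -u'' + ν² q² u)` in `L²(I) × L²(I)` with
`u ∈ H²(I) ∩ H¹₀(I)`. -/
def schrodingerGraph (Lneg Lpos : ℝ) (q : ℝ → ℝ) (ν : ℂ) :
    Submodule ℂ (L2I Lneg Lpos × L2I Lneg Lpos) where
  carrier := {p | p.1 ∈ H10 Lneg Lpos ∧ ∃ u₁ u₂ : L2I Lneg Lpos,
    HasWeakDeriv p.1 u₁ ∧ HasWeakDeriv u₁ u₂ ∧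
    p.2 =ᵐ[volI Lneg Lpos] fun x => -u₂ x + ν ^ 2 * (q x : ℂ) ^ 2 * p.1 x}
  zero_mem' := by
    refine ⟨Submodule.zero_mem _, 0, 0, HasWeakDeriv.zero, HasWeakDeriv.zero, ?_⟩
    filter_upwards [Lp.coeFn_zero ℂ 2 (volI Lneg Lpos)] with x hx
    rw [Prod.snd_zero, Prod.fst_zero, hx]
    simp
  add_mem' := by
    rintro p p' ⟨h0, u₁, u₂, h1, h2, h3⟩ ⟨h0', u₁', u₂', h1', h2', h3'⟩
    refine ⟨Submodule.add_mem _ h0 h0', u₁ + u₁', u₂ + u₂', h1.add h1', h2.add h2', ?_⟩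
    filter_upwards [h3, h3', Lp.coeFn_add p.1 p'.1, Lp.coeFn_add p.2 p'.2,
      Lp.coeFn_add u₂ u₂'] with x e3 e3' a1 a2 a3
    rw [Prod.snd_add, Prod.fst_add, a1, a2, a3, Pi.add_apply, Pi.add_apply, Pi.add_apply, e3, e3']
    ring
  smul_mem' := by
    rintro c p ⟨h0, u₁, u₂, h1, h2, h3⟩
    refine ⟨Submodule.smul_mem _ c h0, c • u₁, c • u₂, h1.smul c, h2.smul c, ?_⟩
    filter_upwards [h3, Lp.coeFn_smul c p.1, Lp.coeFn_smul c p.2,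
      Lp.coeFn_smul c u₂] with x e3 a1 a2 a3
    rw [Prod.smul_snd, Prod.smul_fst, a1, a2, a3, Pi.smul_apply, Pi.smul_apply, Pi.smul_apply, e3,
      smul_eq_mul, smul_eq_mul, smul_eq_mul]
    ring

/-- The unbounded operator `P_ν` on `L²(I)`: `u ↦ -u'' + ν² q² u`, where `u` ranges over
`H²(I) ∩ H¹₀(I)` (for bounded `q`, the condition `P_ν u ∈ L²(I)` is automatic). -/
def schrodinger (Lneg Lpos : ℝ) (q : ℝ → ℝ) (ν : ℂ) : L2I Lneg Lpos →ₗ.[ℂ] L2I Lneg Lpos :=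
  (schrodingerGraph Lneg Lpos q ν).toLinearPMap

/-- `P_ν` is single-valued, so that its graph is indeed `schrodingerGraph`. -/
theorem schrodinger_graph (Lneg Lpos : ℝ) (q : ℝ → ℝ) (ν : ℂ) :
    (schrodinger Lneg Lpos q ν).graph = schrodingerGraph Lneg Lpos q ν := by
  refine Submodule.toLinearPMap_graph_eq _ ?_
  rintro ⟨u, v⟩ ⟨-, u₁, u₂, h1, h2, h3⟩ (hu : u = 0)
  subst hu
  have e1 := h1.eq_zero
  subst e1
  have e2 := h2.eq_zero
  subst e2
  refine Lp.ext ?_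
  filter_upwards [h3, Lp.coeFn_zero ℂ 2 (volI Lneg Lpos)] with x hx h0
  rw [hx, h0]
  simp

/-! ### Spectral theory of unbounded operators -/

section Spectral

variable {E : Type*} [NormedAddCommGroup E] [NormedSpace ℂ E]

/-- `R` is the bounded inverse of `z - A : Dom(A) → E`. -/
def IsResolventAt (A : E →ₗ.[ℂ] E) (z : ℂ) (R : E →L[ℂ] E) : Prop :=
  (∀ v : E, ∃ h : R v ∈ A.domain, z • R v - A ⟨R v, h⟩ = v) ∧
  ∀ u : A.domain, R (z • (u : E) - A u) = u

/-- The resolvent set of `A`. -/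
def resolventSet (A : E →ₗ.[ℂ] E) : Set ℂ := {z | ∃ R : E →L[ℂ] E, IsResolventAt A z R}

open Classical in
/-- `(z - A)⁻¹` for `z` in the resolvent set (and `0` elsewhere). -/
def resolventAt (A : E →ₗ.[ℂ] E) (z : ℂ) : E →L[ℂ] E :=
  if h : z ∈ resolventSet A then h.choose else 0

/-- `lam` is an eigenvalue of `A`. -/
def IsEigenvalue (A : E →ₗ.[ℂ] E) (lam : ℂ) : Prop :=
  ∃ u : A.domain, (u : E) ≠ 0 ∧ A u = lam • (u : E)

/-- `r > 0` is such that the closed disk of radius `r` about `lam` meets the spectrum of `A` at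
most at `lam`. -/
def IsIsolatingRadius (A : E →ₗ.[ℂ] E) (lam : ℂ) (r : ℝ) : Prop :=
  0 < r ∧ ∀ z ∈ Metric.closedBall lam r, z ≠ lam → z ∈ resolventSet A

open Classical in
/-- The spectral (Riesz) projection of `A` at `lam`,
`(2πi)⁻¹ ∮_{|z - lam| = r} (z - A)⁻¹ dz` for any isolating radius `r` (and `0` if there is none).
The integral does not depend on `r`. -/
def spectralProjection (A : E →ₗ.[ℂ] E) (lam : ℂ) : E →L[ℂ] E :=
  if h : ∃ r : ℝ, IsIsolatingRadius A lam r then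
    (2 * Real.pi * Complex.I : ℂ)⁻¹ • ∮ z in C(lam, h.choose), resolventAt A z
  else 0

/-- The eigenvalue `lam` of `A` has algebraic multiplicity one: the range of its spectral
projection is a line. -/
def IsAlgSimple (A : E →ₗ.[ℂ] E) (lam : ℂ) : Prop :=
  Module.finrank ℂ (LinearMap.range (spectralProjection A lam : E →ₗ[ℂ] E)) = 1

end Spectral

/-! ### The objects of the statement -/

/-- The sector `{ν : |ν| ≥ 1, |arg ν| ≤ θ₀}`. -/
def sector (θ₀ : ℝ) : Set ℂ := {ν | 1 ≤ ‖ν‖ ∧ |Complex.arg ν| ≤ θ₀}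

/-- The Agmon distance `δ(x) = ∫_0^x q(s) ds`. -/
def agmon (q : ℝ → ℝ) (x : ℝ) : ℝ := ∫ s in (0 : ℝ)..x, q s

/-- `lam` is an eigenvalue of `P_ν` with `|lam - q'(0) ν| ≤ q'(0) |ν|`. -/
def IsLowEigenvalue (Lneg Lpos : ℝ) (q : ℝ → ℝ) (ν lam : ℂ) : Prop :=
  IsEigenvalue (schrodinger Lneg Lpos q ν) lam ∧
    ‖lam - ((deriv q 0 : ℝ) : ℂ) * ν‖ ≤ deriv q 0 * ‖ν‖

/-- For every `ν` in the sector with `|ν| ≥ ν₀`, the operator `P_ν` has exactly one eigenvalue in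
the disk `|lam - q'(0) ν| ≤ q'(0) |ν|`, and it is algebraically simple. -/
def IsThreshold (Lneg Lpos : ℝ) (q : ℝ → ℝ) (θ₀ ν₀ : ℝ) : Prop :=
  0 ≤ ν₀ ∧ ∀ ν ∈ sector θ₀, ν₀ ≤ ‖ν‖ → ∃ lam : ℂ, IsLowEigenvalue Lneg Lpos q ν lam ∧
    IsAlgSimple (schrodinger Lneg Lpos q ν) lam ∧
    ∀ lam' : ℂ, IsLowEigenvalue Lneg Lpos q ν lam' → lam' = lam

open Classical in
/-- The eigenvalue `λ_ν` of `P_ν` in the disk `|lam - q'(0) ν| ≤ q'(0) |ν|`; used only where it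
exists and is unique. -/
def lowEigenvalue (Lneg Lpos : ℝ) (q : ℝ → ℝ) (ν : ℂ) : ℂ :=
  if h : ∃ lam : ℂ, IsLowEigenvalue Lneg Lpos q ν lam then h.choose else 0

/-- `x ↦ ν^{1/4} e^{-q'(0) ν x² / 2}`. -/
def gaussFun (q : ℝ → ℝ) (ν : ℂ) (x : ℝ) : ℂ :=
  ν ^ (1 / 4 : ℂ) * Complex.exp (-(((deriv q 0 : ℝ) : ℂ) * ν * (x : ℂ) ^ 2 / 2))

theorem memLp_gaussFun (Lneg Lpos : ℝ) (q : ℝ → ℝ) (ν : ℂ) :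
    MemLp (gaussFun q ν) 2 (volI Lneg Lpos) := by
  have hc : Continuous (gaussFun q ν) := by
    unfold gaussFun
    fun_prop
  obtain ⟨C, hC⟩ := isCompact_Icc.exists_bound_of_continuousOn (s := Icc (-Lneg) Lpos)
    hc.continuousOn
  refine MemLp.of_bound hc.aestronglyMeasurable C ?_
  refine (ae_restrict_iff' measurableSet_Ioo).2 (Filter.Eventually.of_forall ?_)
  intro x hx
  exact hC x (Ioo_subset_Icc_self hx)

/-- `φ̃_ν`, the restriction of `gaussFun` to `I`, as an element of `L²(I)`. -/
def gauss (Lneg Lpos : ℝ) (q : ℝ → ℝ) (ν : ℂ) : L2I Lneg Lpos :=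
  (memLp_gaussFun Lneg Lpos q ν).toLp

/-- `φ_ν = Π_ν φ̃_ν`, where `Π_ν` is the spectral projection of `P_ν` at `λ_ν`. -/
def phi (Lneg Lpos : ℝ) (q : ℝ → ℝ) (ν : ℂ) : L2I Lneg Lpos :=
  spectralProjection (schrodinger Lneg Lpos q ν) (lowEigenvalue Lneg Lpos q ν) (gauss Lneg Lpos q ν)

/-- `x ↦ φ_ν(x) e^{ν (1 - ε) δ(x)}` on `I`. -/
def weightedPhi (Lneg Lpos : ℝ) (q : ℝ → ℝ) (ε : ℝ) (ν : ℂ) (x : ℝ) : ℂ :=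
  phi Lneg Lpos q ν x * Complex.exp (ν * (1 - (ε : ℂ)) * (agmon q x : ℂ))

end Grushin

end

/-! `P_ν` is not self-adjoint for complex `ν`, but it is symmetric for the bilinear pairing `∫ u v`.
Let `y` be the solution of `(P_ν - z) y = 0` with `y = 0`, `y' = 1` at the left end point. It
depends continuously on `(ν, z)`, and `z` is an eigenvalue exactly when `y` vanishes at the right
end point. An eigenvalue is algebraically simple exactly when `∫ y² ≠ 0`, and then `Π_ν f = (∫ y f /
∫ y²) y`. So a bound on `φ_ν` comes down to `|∫ y²| ≥ c ‖y‖²`, uniformly in `ν`.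

For large `|ν|` this bound comes from comparison with `g = e^{-νδ}`, which is killed by `∂ + ν q`.
If `w` is a solution at low energy (`z` in the disk), then `v = w' + ν q w` solves an equation with
the additional potential `2 ν q'`. This moves the lowest level to about `3 q'(0) ν`, outside the
disk, so `‖v‖ ≤ C ‖w‖` (`exists_firstOrder_le`). Solving `w' + ν q w = v` gives `‖w - w(0) g‖ ≤ C
|ν|^{-1/2} ‖w‖` (`exists_approx`). Since `∫ g²` is close to the complex Gaussian integral `(π /
(q'(0) ν))^{1/2}`, its modulus is comparable to `‖g‖²` (`exists_le_norm_bil_wkbL`). The lower bound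
follows (`exists_le_norm_bil`). It yields simplicity, and also uniqueness, because eigenfunctions
for distinct eigenvalues are orthogonal for the pairing. Existence is proved by contradiction
(`exists_dirDet_eq_zero`): if the disk contained no eigenvalue, the maximum principle for a matrix
element of the resolvent would contradict the quasimode `X e^{-νδ}`, with `X` a cut-off.

Between an arbitrary threshold and the large-parameter regime, the bound on `∫ y²` follows by
compactness from simplicity alone (`exists_le_norm_bil_dirSol`). Hence `φ_ν` is a bounded family of
low-energy eigenfunctions, and an Agmon estimate with the complex weight `e^{ν(1-ε)δ}` gives the
decay (`exists_agmon_le`). -/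

noncomputable section

namespace Grushin

/-! ### Bilinear pairing, multiplication operators and primitives on `L²(I)` -/

section Pairing

variable {Lneg Lpos : ℝ}

/-- The bilinear pairing `(u, v) ↦ ∫_I u v`. -/
def bil (Lneg Lpos : ℝ) : L2I Lneg Lpos →L[ℂ] L2I Lneg Lpos →L[ℂ] ℂ :=
  (ContinuousLinearMap.mul ℂ ℂ).lpPairing (volI Lneg Lpos) 2 2

theorem bil_apply (u v : L2I Lneg Lpos) :
    bil Lneg Lpos u v = ∫ x in Ioo (-Lneg) Lpos, u x * v x :=
  ContinuousLinearMap.lpPairing_eq_integral _ _ _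

theorem bil_comm (u v : L2I Lneg Lpos) : bil Lneg Lpos u v = bil Lneg Lpos v u := by
  simp only [bil_apply, mul_comm]

theorem norm_sq_eq_integral (u : L2I Lneg Lpos) :
    ‖u‖ ^ 2 = ∫ x in Ioo (-Lneg) Lpos, ‖u x‖ ^ 2 := by
  have h := L2.inner_def (𝕜 := ℂ) u u
  rw [inner_self_eq_norm_sq_to_K] at h
  have h2 : ∫ x in Ioo (-Lneg) Lpos, (inner ℂ (u x) (u x) : ℂ)
      = ((∫ x in Ioo (-Lneg) Lpos, ‖u x‖ ^ 2 : ℝ) : ℂ) := by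
    rw [← integral_complex_ofReal]
    refine integral_congr_ae (Filter.Eventually.of_forall fun x => ?_)
    simp [inner_self_eq_norm_sq_to_K]
  rw [h2] at h
  apply Complex.ofReal_injective
  rw [← h]
  push_cast
  rfl

theorem norm_sq_toLp {f : ℝ → ℂ} (hf : MemLp f 2 (volI Lneg Lpos)) :
    ‖hf.toLp‖ ^ 2 = ∫ x in Ioo (-Lneg) Lpos, ‖f x‖ ^ 2 := by
  rw [norm_sq_eq_integral]
  refine integral_congr_ae ?_
  filter_upwards [hf.coeFn_toLp] with x hx
  rw [hx]

/-- Cauchy–Schwarz, the pairing being the inner product of `star u` with `v`. -/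
theorem norm_bil_le (u v : L2I Lneg Lpos) : ‖bil Lneg Lpos u v‖ ≤ ‖u‖ * ‖v‖ := by
  have h : bil Lneg Lpos u v = inner ℂ (star u) v := by
    rw [bil_apply, L2.inner_def]
    refine integral_congr_ae ?_
    filter_upwards [Lp.coeFn_star u] with x hx
    simp [hx, mul_comm]
  rw [h]
  have h2 : ‖star u‖ = ‖u‖ := by
    rw [Lp.norm_def, Lp.norm_def]
    congr 1
    refine eLpNorm_congr_norm_ae ?_
    filter_upwards [Lp.coeFn_star u] with x hx
    simp [hx]
  exact (norm_inner_le_norm _ _).trans_eq (by rw [h2])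

theorem memLp_of_continuous {f : ℝ → ℂ} (hf : Continuous f) : MemLp f 2 (volI Lneg Lpos) := by
  obtain ⟨C, hC⟩ := isCompact_Icc.exists_bound_of_continuousOn (s := Icc (-Lneg) Lpos)
    hf.continuousOn
  refine MemLp.of_bound hf.aestronglyMeasurable C ?_
  exact (ae_restrict_iff' measurableSet_Ioo).2
    (Filter.Eventually.of_forall fun x hx => hC x (Ioo_subset_Icc_self hx))

/-- The class in `L²(I)` of a continuous function. -/
def ofCont (Lneg Lpos : ℝ) (f : ℝ → ℂ) (hf : Continuous f) : L2I Lneg Lpos :=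
  (memLp_of_continuous hf).toLp

theorem coeFn_ofCont {f : ℝ → ℂ} (hf : Continuous f) :
    ofCont Lneg Lpos f hf =ᵐ[volI Lneg Lpos] f :=
  MemLp.coeFn_toLp _

theorem ofCont_eq_iff {f : ℝ → ℂ} {hf : Continuous f} {u : L2I Lneg Lpos} :
    u = ofCont Lneg Lpos f hf ↔ u =ᵐ[volI Lneg Lpos] f :=
  ⟨fun h => h ▸ coeFn_ofCont hf, fun h => Lp.ext (h.trans (coeFn_ofCont hf).symm)⟩

theorem ofCont_congr {f g : ℝ → ℂ} {hf : Continuous f} {hg : Continuous g}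
    (h : ∀ x ∈ Ioo (-Lneg) Lpos, f x = g x) : ofCont Lneg Lpos f hf = ofCont Lneg Lpos g hg := by
  rw [ofCont_eq_iff]
  refine (coeFn_ofCont hf).trans ?_
  exact (ae_restrict_iff' measurableSet_Ioo).2 (Filter.Eventually.of_forall h)

theorem ofCont_add {f g : ℝ → ℂ} (hf : Continuous f) (hg : Continuous g) :
    ofCont Lneg Lpos (fun x => f x + g x) (hf.add hg)
      = ofCont Lneg Lpos f hf + ofCont Lneg Lpos g hg := by
  symm
  rw [ofCont_eq_iff]
  exact (Lp.coeFn_add _ _).trans ((coeFn_ofCont hf).add (coeFn_ofCont hg))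

theorem ofCont_smul {f : ℝ → ℂ} (c : ℂ) (hf : Continuous f) :
    ofCont Lneg Lpos (fun x => c * f x) (continuous_const.mul hf)
      = c • ofCont Lneg Lpos f hf := by
  symm
  rw [ofCont_eq_iff]
  exact (Lp.coeFn_smul _ _).trans ((coeFn_ofCont hf).const_smul c)

theorem norm_sq_ofCont {f : ℝ → ℂ} (hf : Continuous f) :
    ‖ofCont Lneg Lpos f hf‖ ^ 2 = ∫ x in Ioo (-Lneg) Lpos, ‖f x‖ ^ 2 :=
  norm_sq_toLp _

theorem bil_ofCont {f g : ℝ → ℂ} (hf : Continuous f) (hg : Continuous g) :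
    bil Lneg Lpos (ofCont Lneg Lpos f hf) (ofCont Lneg Lpos g hg)
      = ∫ x in Ioo (-Lneg) Lpos, f x * g x := by
  rw [bil_apply]
  refine integral_congr_ae ?_
  filter_upwards [coeFn_ofCont hf, coeFn_ofCont hg] with x h1 h2
  rw [h1, h2]

theorem norm_ofCont_le {f : ℝ → ℂ} (hf : Continuous f) {C : ℝ}
    (h : ∀ x ∈ Ioo (-Lneg) Lpos, ‖f x‖ ≤ C) :
    ‖ofCont Lneg Lpos f hf‖ ^ 2 ≤ (volI Lneg Lpos).real univ * C ^ 2 := by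
  rw [norm_sq_ofCont]
  have := setIntegral_mono_on (s := Ioo (-Lneg) Lpos) (μ := volume)
    (f := fun x => ‖f x‖ ^ 2) (g := fun _ => C ^ 2)
    ((hf.norm.pow 2).integrableOn_Icc.mono_set Ioo_subset_Icc_self) (by simp)
    measurableSet_Ioo (fun x hx => by gcongr; exact h x hx)
  refine this.trans_eq ?_
  simp

theorem memLp_top_of_continuous {f : ℝ → ℂ} (hf : Continuous f) :
    MemLp f ∞ (volI Lneg Lpos) := by
  obtain ⟨C, hC⟩ := isCompact_Icc.exists_bound_of_continuousOn (s := Icc (-Lneg) Lpos)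
    hf.continuousOn
  refine memLp_top_of_bound hf.aestronglyMeasurable C ?_
  exact (ae_restrict_iff' measurableSet_Ioo).2
    (Filter.Eventually.of_forall fun x hx => hC x (Ioo_subset_Icc_self hx))

/-- Multiplication by a continuous function, as an operator on `L²(I)`. -/
def mulL (Lneg Lpos : ℝ) (m : ℝ → ℂ) (hm : Continuous m) : L2I Lneg Lpos →L[ℂ] L2I Lneg Lpos :=
  (ContinuousLinearMap.mul ℂ ℂ).holderL (volI Lneg Lpos) ∞ 2 2 (memLp_top_of_continuous hm).toLp

theorem coeFn_mulL {m : ℝ → ℂ} (hm : Continuous m) (u : L2I Lneg Lpos) :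
    mulL Lneg Lpos m hm u =ᵐ[volI Lneg Lpos] fun x => m x * u x := by
  refine (ContinuousLinearMap.coeFn_holder (r := 2) _ _ _).trans ?_
  filter_upwards [(memLp_top_of_continuous (Lneg := Lneg) (Lpos := Lpos) hm).coeFn_toLp] with x hx
  rw [hx]
  rfl

theorem mulL_mulL {m m' : ℝ → ℂ} (hm : Continuous m) (hm' : Continuous m') (u : L2I Lneg Lpos) :
    mulL Lneg Lpos m hm (mulL Lneg Lpos m' hm' u)
      = mulL Lneg Lpos (fun x => m x * m' x) (hm.mul hm') u := by
  refine Lp.ext ?_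
  filter_upwards [coeFn_mulL hm (mulL Lneg Lpos m' hm' u), coeFn_mulL hm' u,
    coeFn_mulL (hm.mul hm') u] with x h1 h2 h3
  rw [h1, h2, ← mul_assoc]
  exact h3.symm

theorem mulL_ofCont {m f : ℝ → ℂ} (hm : Continuous m) (hf : Continuous f) :
    mulL Lneg Lpos m hm (ofCont Lneg Lpos f hf)
      = ofCont Lneg Lpos (fun x => m x * f x) (hm.mul hf) := by
  rw [ofCont_eq_iff]
  filter_upwards [coeFn_mulL hm (ofCont Lneg Lpos f hf), coeFn_ofCont hf] with x h1 h2
  rw [h1, h2]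

theorem mulL_one {m : ℝ → ℂ} (hm : Continuous m) (h1 : ∀ x, m x = 1) (u : L2I Lneg Lpos) :
    mulL Lneg Lpos m hm u = u := by
  refine Lp.ext ?_
  filter_upwards [coeFn_mulL hm u] with x hx
  rw [hx, h1, one_mul]

/-! ### The primitive vanishing at the left end point -/

theorem integrable_L2I (f : L2I Lneg Lpos) : Integrable (f : ℝ → ℂ) (volI Lneg Lpos) :=
  (Lp.memLp f).integrable (by norm_num)

/-- `x ↦ ∫_{-Lneg}^x f`, where `f` is extended by zero outside `I`. -/
def primFun (f : L2I Lneg Lpos) (x : ℝ) : ℂ :=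
  ∫ s in (-Lneg)..x, f s ∂(volI Lneg Lpos)

theorem continuous_primFun (f : L2I Lneg Lpos) : Continuous (primFun f) :=
  intervalIntegral.continuous_primitive (fun _ _ => (integrable_L2I f).intervalIntegrable) _

theorem primFun_add (f g : L2I Lneg Lpos) (x : ℝ) :
    primFun (f + g) x = primFun f x + primFun g x := by
  unfold primFun
  rw [← intervalIntegral.integral_add (integrable_L2I f).intervalIntegrable
    (integrable_L2I g).intervalIntegrable]
  refine intervalIntegral.integral_congr_ae ?_
  filter_upwards [Lp.coeFn_add f g] with s hs _
  rw [hs, Pi.add_apply]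

theorem primFun_smul (c : ℂ) (f : L2I Lneg Lpos) (x : ℝ) :
    primFun (c • f) x = c * primFun f x := by
  unfold primFun
  rw [← intervalIntegral.integral_const_mul]
  refine intervalIntegral.integral_congr_ae ?_
  filter_upwards [Lp.coeFn_smul c f] with s hs _
  rw [hs, Pi.smul_apply, smul_eq_mul]

theorem primFun_eq_of_ae {f : L2I Lneg Lpos} {g : ℝ → ℂ} (h : f =ᵐ[volI Lneg Lpos] g) {x : ℝ}
    (hx : x ∈ Icc (-Lneg) Lpos) : primFun f x = ∫ s in (-Lneg)..x, g s := by
  have h1 : primFun f x = ∫ s in (-Lneg)..x, g s ∂(volI Lneg Lpos) := by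
    refine intervalIntegral.integral_congr_ae ?_
    filter_upwards [h] with s hs _
    exact hs
  rw [h1, intervalIntegral.integral_of_le hx.1, intervalIntegral.integral_of_le hx.1,
    Measure.restrict_restrict measurableSet_Ioc]
  refine setIntegral_congr_set ?_
  have h2 : (Ioc (-Lneg) x ∩ Ioo (-Lneg) Lpos : Set ℝ)
      =ᵐ[volume] (Ioc (-Lneg) x ∩ Ioc (-Lneg) Lpos : Set ℝ) :=
    (Filter.EventuallyEq.refl _ _).inter Ioo_ae_eq_Ioc
  rwa [inter_eq_self_of_subset_left (Ioc_subset_Ioc_right hx.2)] at h2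

/-- Cauchy–Schwarz with the weight kept explicit: `m = 1` gives the boundedness of the primitive,
and an exponential `m` gives the smallness of the conjugated primitive behind the Volterra
inversion. -/
theorem norm_primFun_mulL_le {m : ℝ → ℂ} (hm : Continuous m) (f : L2I Lneg Lpos) {x : ℝ}
    (hx : x ∈ Icc (-Lneg) Lpos) :
    ‖primFun (mulL Lneg Lpos m hm f) x‖
      ≤ Real.sqrt (∫ s in (-Lneg)..x, ‖m s‖ ^ 2) * ‖f‖ := by
  have hind : MemLp ((Ioc (-Lneg) x).indicator m) 2 (volI Lneg Lpos) :=
    (memLp_of_continuous hm).indicator measurableSet_Ioc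
  have h1 : primFun (mulL Lneg Lpos m hm f) x = bil Lneg Lpos hind.toLp f := by
    rw [primFun, intervalIntegral.integral_of_le hx.1, bil_apply,
      ← integral_indicator measurableSet_Ioc]
    refine integral_congr_ae ?_
    filter_upwards [hind.coeFn_toLp, coeFn_mulL hm f] with s h1 h2
    rw [h1]
    by_cases hs : s ∈ Ioc (-Lneg) x
    · simp only [indicator_of_mem hs, h2]
    · simp only [indicator_of_notMem hs, zero_mul]
  rw [h1]
  refine (norm_bil_le _ _).trans ?_
  gcongr
  refine Real.le_sqrt_of_sq_le ?_
  rw [norm_sq_toLp, intervalIntegral.integral_of_le hx.1]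
  have h2 : ∀ s, ‖(Ioc (-Lneg) x).indicator m s‖ ^ 2
      = (Ioc (-Lneg) x).indicator (fun s => ‖m s‖ ^ 2) s := by
    intro s
    by_cases hs : s ∈ Ioc (-Lneg) x
    · simp only [indicator_of_mem hs]
    · simp [indicator_of_notMem hs]
  simp_rw [h2]
  rw [integral_indicator measurableSet_Ioc, Measure.restrict_restrict measurableSet_Ioc]
  refine setIntegral_mono_set ?_ (Filter.Eventually.of_forall fun s => by positivity)
    (Filter.Eventually.of_forall inter_subset_left)
  exact ((hm.norm.pow 2).integrableOn_Icc (a := -Lneg) (b := x)).mono_set Ioc_subset_Icc_self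

theorem norm_primFun_le (f : L2I Lneg Lpos) {x : ℝ} (hx : x ∈ Icc (-Lneg) Lpos) :
    ‖primFun f x‖ ≤ Real.sqrt (Lpos + Lneg) * ‖f‖ := by
  have h := norm_primFun_mulL_le (m := fun _ => 1) continuous_const f hx
  rw [mulL_one _ (fun _ => rfl)] at h
  refine h.trans ?_
  gcongr
  simp only [norm_one, one_pow, intervalIntegral.integral_const, smul_eq_mul, mul_one]
  linarith [hx.2]

/-- The primitive `f ↦ ∫_{-Lneg}^x f` as an operator on `L²(I)`. -/
def prim (Lneg Lpos : ℝ) : L2I Lneg Lpos →L[ℂ] L2I Lneg Lpos :=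
  LinearMap.mkContinuousOfExistsBound
    { toFun := fun f => ofCont Lneg Lpos (primFun f) (continuous_primFun f)
      map_add' := fun f g => by
        rw [← ofCont_add]
        exact ofCont_congr fun x _ => primFun_add f g x
      map_smul' := fun c f => by
        rw [RingHom.id_apply, ← ofCont_smul]
        exact ofCont_congr fun x _ => primFun_smul c f x }
    ⟨Real.sqrt ((volI Lneg Lpos).real univ) * Real.sqrt (Lpos + Lneg), fun f => by
      have h := norm_ofCont_le (Lneg := Lneg) (Lpos := Lpos) (continuous_primFun f)
        (C := Real.sqrt (Lpos + Lneg) * ‖f‖)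
        (fun x hx => norm_primFun_le f (Ioo_subset_Icc_self hx))
      refine (sq_le_sq₀ (norm_nonneg _) (by positivity)).1 ?_
      refine h.trans_eq ?_
      rw [mul_assoc, mul_pow (Real.sqrt ((volI Lneg Lpos).real univ)),
        Real.sq_sqrt measureReal_nonneg]⟩

theorem prim_apply (f : L2I Lneg Lpos) :
    prim Lneg Lpos f = ofCont Lneg Lpos (primFun f) (continuous_primFun f) := rfl

theorem coeFn_prim (f : L2I Lneg Lpos) : prim Lneg Lpos f =ᵐ[volI Lneg Lpos] primFun f :=
  coeFn_ofCont (continuous_primFun f)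

end Pairing

/-! ### Weak derivatives and `H¹₀(I)` in terms of primitives -/

section WeakDerivatives

variable {Lneg Lpos : ℝ}

theorem IsTest.mem_testPairs {φ : ℝ → ℂ} (h : IsTest Lneg Lpos φ) :
    (ofCont Lneg Lpos φ h.smooth.continuous, ofCont Lneg Lpos (deriv φ) h.continuous_deriv)
      ∈ testPairs Lneg Lpos :=
  ⟨φ, h, coeFn_ofCont h.smooth.continuous, coeFn_ofCont h.continuous_deriv⟩

theorem bil_ofCont_right {f : ℝ → ℂ} (hf : Continuous f) (u : L2I Lneg Lpos) :
    bil Lneg Lpos u (ofCont Lneg Lpos f hf) = ∫ x in Ioo (-Lneg) Lpos, u x * f x := by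
  rw [bil_apply]
  refine integral_congr_ae ?_
  filter_upwards [coeFn_ofCont hf] with x h1
  rw [h1]

/-- Equalities between continuous functionals: they pass to the closure of the test pairs and to
limits in `u`, `v`. -/
theorem hasWeakDeriv_iff {u v : L2I Lneg Lpos} :
    HasWeakDeriv u v ↔
      ∀ p ∈ testPairs Lneg Lpos, bil Lneg Lpos u p.2 = -bil Lneg Lpos v p.1 := by
  constructor
  · rintro h p ⟨φ, hφ, h1, h2⟩
    rw [← ofCont_eq_iff (hf := hφ.smooth.continuous)] at h1
    rw [← ofCont_eq_iff (hf := hφ.continuous_deriv)] at h2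
    rw [h1, h2, bil_ofCont_right, bil_ofCont_right]
    exact h φ hφ
  · intro h φ hφ
    have := h _ hφ.mem_testPairs
    rwa [bil_ofCont_right, bil_ofCont_right] at this

theorem HasWeakDeriv.bil_eq {u v : L2I Lneg Lpos} (h : HasWeakDeriv u v)
    {p : L2I Lneg Lpos × L2I Lneg Lpos} (hp : p ∈ (testPairs Lneg Lpos).topologicalClosure) :
    bil Lneg Lpos u p.2 = -bil Lneg Lpos v p.1 := by
  have hcl : IsClosed {p : L2I Lneg Lpos × L2I Lneg Lpos |
      bil Lneg Lpos u p.2 = -bil Lneg Lpos v p.1} :=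
    isClosed_eq (by fun_prop) (by fun_prop)
  exact closure_minimal (hasWeakDeriv_iff.1 h) hcl hp

theorem isClosed_setOf_hasWeakDeriv_prim :
    IsClosed {f : L2I Lneg Lpos | HasWeakDeriv (prim Lneg Lpos f) f} := by
  have : {f : L2I Lneg Lpos | HasWeakDeriv (prim Lneg Lpos f) f}
      = ⋂ p ∈ testPairs Lneg Lpos,
        {f | bil Lneg Lpos (prim Lneg Lpos f) p.2 = -bil Lneg Lpos f p.1} := by
    ext f
    simp [hasWeakDeriv_iff]
  rw [this]
  exact isClosed_biInter fun p _ => isClosed_eq (by fun_prop) (by fun_prop)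

theorem exists_Icc_of_isCompact {a b : ℝ} (hab : a < b) {K : Set ℝ} (hK : IsCompact K)
    (h : K ⊆ Ioo a b) : ∃ a' b', a < a' ∧ a' < b' ∧ b' < b ∧ K ⊆ Icc a' b' := by
  rcases K.eq_empty_or_nonempty with rfl | hne
  · exact ⟨(2 * a + b) / 3, (a + 2 * b) / 3, by linarith, by linarith, by linarith,
      empty_subset _⟩
  · obtain ⟨x, hx, hx'⟩ := hK.exists_isLeast hne
    obtain ⟨y, hy, hy'⟩ := hK.exists_isGreatest hne
    have h1 := h hx
    have h2 := h hy
    refine ⟨(a + x) / 2, (y + b) / 2, by linarith [h1.1], ?_, by linarith [h2.2], ?_⟩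
    · linarith [hx' hy, h1.1, h2.2]
    · intro z hz
      have := hx' hz
      have := hy' hz
      constructor <;> linarith [h1.1, h2.2]

theorem hasDerivAt_primitive {f : ℝ → ℂ} (hf : Continuous f) (a x : ℝ) :
    HasDerivAt (fun x => ∫ s in a..x, f s) (f x) x :=
  intervalIntegral.integral_hasDerivAt_right (hf.intervalIntegrable _ _)
    hf.stronglyMeasurable.stronglyMeasurableAtFilter hf.continuousAt

theorem continuous_primitive' {f : ℝ → ℂ} (hf : Continuous f) (a : ℝ) :
    Continuous (fun x => ∫ s in a..x, f s) :=
  continuous_iff_continuousAt.2 fun x => (hasDerivAt_primitive hf a x).continuousAt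

theorem prim_ofCont {f : ℝ → ℂ} (hf : Continuous f) :
    prim Lneg Lpos (ofCont Lneg Lpos f hf)
      = ofCont Lneg Lpos (fun x => ∫ s in (-Lneg)..x, f s) (continuous_primitive' hf _) :=
  ofCont_congr (hf := continuous_primFun _) fun _ hx =>
    primFun_eq_of_ae (coeFn_ofCont hf) (Ioo_subset_Icc_self hx)

theorem IsTest.apply_eq_zero {φ : ℝ → ℂ} (h : IsTest Lneg Lpos φ) {x : ℝ}
    (hx : x ∉ Ioo (-Lneg) Lpos) : φ x = 0 := by
  by_contra hne
  exact hx (h.supp (subset_tsupport _ hne))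

theorem setIntegral_Ioo_eq_intervalIntegral {E : Type*} [NormedAddCommGroup E] [NormedSpace ℝ E]
    {a b : ℝ} (hab : a ≤ b) (f : ℝ → E) :
    ∫ x in Ioo a b, f x = ∫ x in a..b, f x := by
  rw [intervalIntegral.integral_of_le hab, integral_Ioc_eq_integral_Ioo]

theorem denseRange_ofCont :
    Dense {u : L2I Lneg Lpos | ∃ f, ∃ hf : Continuous f, u = ofCont Lneg Lpos f hf} := by
  have h := BoundedContinuousFunction.toLp_denseRange (p := 2) (E := ℂ) (𝕜 := ℂ)
    (μ := volI Lneg Lpos) (by norm_num)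
  refine h.mono ?_
  rintro _ ⟨f, rfl⟩
  exact ⟨f, f.continuous, ofCont_eq_iff.2 (BoundedContinuousFunction.coeFn_toLp (𝕜 := ℂ) 2 (volI Lneg Lpos) f)⟩

/-- The set of such `f` is closed, and it contains the dense set of classes of continuous functions
by integration by parts. -/
theorem hasWeakDeriv_prim (h0 : -Lneg < Lpos) (f : L2I Lneg Lpos) :
    HasWeakDeriv (prim Lneg Lpos f) f := by
  suffices H : {f : L2I Lneg Lpos | HasWeakDeriv (prim Lneg Lpos f) f} = univ by
    have hf : f ∈ {f : L2I Lneg Lpos | HasWeakDeriv (prim Lneg Lpos f) f} := H ▸ mem_univ f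
    exact hf
  rw [← isClosed_setOf_hasWeakDeriv_prim.closure_eq]
  refine (denseRange_ofCont.mono ?_).closure_eq
  rintro _ ⟨f, hf, rfl⟩ φ hφ
  have e1 : ∫ x in Ioo (-Lneg) Lpos, prim Lneg Lpos (ofCont Lneg Lpos f hf) x * deriv φ x
      = ∫ x in (-Lneg)..Lpos, (∫ s in (-Lneg)..x, f s) * deriv φ x := by
    rw [← setIntegral_Ioo_eq_intervalIntegral h0.le, prim_ofCont]
    refine integral_congr_ae ?_
    filter_upwards [coeFn_ofCont (Lneg := Lneg) (Lpos := Lpos)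
      (continuous_primitive' hf (-Lneg))] with x hx
    rw [hx]
  have e2 : ∫ x in Ioo (-Lneg) Lpos, ofCont Lneg Lpos f hf x * φ x
      = ∫ x in (-Lneg)..Lpos, f x * φ x := by
    rw [← setIntegral_Ioo_eq_intervalIntegral h0.le]
    refine integral_congr_ae ?_
    filter_upwards [coeFn_ofCont hf] with x hx
    rw [hx]
  rw [e1, e2, intervalIntegral.integral_mul_deriv_eq_deriv_mul
    (fun x _ => hasDerivAt_primitive hf _ x) (fun x _ => (hφ.differentiable x).hasDerivAt)
    (hf.intervalIntegrable _ _) (hφ.continuous_deriv.intervalIntegrable _ _)]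
  simp [hφ.apply_eq_zero]

/-- A test function with zero mean is the derivative of a test function. -/
theorem IsTest.exists_primitive (h0 : -Lneg < Lpos) {φ : ℝ → ℂ} (h : IsTest Lneg Lpos φ)
    (hz : ∫ x in Ioo (-Lneg) Lpos, φ x = 0) : ∃ Φ, IsTest Lneg Lpos Φ ∧ deriv Φ = φ := by
  obtain ⟨a', b', ha, hab, hb, hK⟩ := exists_Icc_of_isCompact h0 h.compact h.supp
  have hd := hasDerivAt_primitive h.smooth.continuous (-Lneg)
  have hderiv : deriv (fun x => ∫ s in (-Lneg)..x, φ s) = φ := funext fun x => (hd x).deriv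
  have hout : ∀ x ∉ Icc a' b', φ x = 0 := fun x hx => by
    by_contra hne
    exact hx (hK (subset_tsupport _ hne))
  have hsupp : Function.support (fun x => ∫ s in (-Lneg)..x, φ s) ⊆ Icc a' b' := by
    intro x hx
    by_contra hne
    refine hx ?_
    rw [mem_Icc, not_and_or, not_le, not_le] at hne
    rcases hne with hne | hne
    · refine (intervalIntegral.integral_congr (g := fun _ => 0) fun s hs => hout s ?_).trans
        (by simp)
      intro hs'
      have : s ≤ max (-Lneg) x := hs.2
      have : max (-Lneg) x < a' := max_lt ha hne
      linarith [hs'.1]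
    · have hz' : ∫ s in (-Lneg)..Lpos, φ s = 0 := by
        rwa [← setIntegral_Ioo_eq_intervalIntegral h0.le]
      show ∫ s in (-Lneg)..x, φ s = 0
      rw [← intervalIntegral.integral_add_adjacent_intervals
        (h.smooth.continuous.intervalIntegrable (-Lneg) Lpos)
        (h.smooth.continuous.intervalIntegrable Lpos x), hz', zero_add]
      refine (intervalIntegral.integral_congr (g := fun _ => 0) fun s hs => hout s ?_).trans
        (by simp)
      intro hs'
      have : min Lpos x ≤ s := hs.1
      have : b' < min Lpos x := lt_min hb hne
      linarith [hs'.2]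
  have hts : tsupport (fun x => ∫ s in (-Lneg)..x, φ s) ⊆ Icc a' b' :=
    closure_minimal hsupp isClosed_Icc
  refine ⟨fun x => ∫ s in (-Lneg)..x, φ s, ⟨?_, ?_, ?_⟩, hderiv⟩
  · rw [contDiff_infty_iff_deriv, hderiv]
    exact ⟨fun x => (hd x).differentiableAt, h.smooth⟩
  · exact isCompact_Icc.of_isClosed_subset (isClosed_tsupport _) hts
  · exact hts.trans (fun x hx => ⟨ha.trans_le hx.1, hx.2.trans_lt hb⟩)

/-- The constant function `1`. -/
abbrev oneL (Lneg Lpos : ℝ) : L2I Lneg Lpos := ofCont Lneg Lpos (fun _ => 1) continuous_const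

/-- A function with vanishing weak derivative is constant. -/
theorem HasWeakDeriv.eq_const (h0 : -Lneg < Lpos) {v : L2I Lneg Lpos} (h : HasWeakDeriv v 0) :
    ∃ c : ℂ, v = c • oneL Lneg Lpos := by
  obtain ⟨ψ, hψ, hψ1⟩ : ∃ ψ : ℝ → ℂ, IsTest Lneg Lpos ψ ∧ ∫ x in Ioo (-Lneg) Lpos, ψ x = 1 := by
    let B : ContDiffBump ((Lpos - Lneg) / 2 : ℝ) :=
      ⟨(Lpos + Lneg) / 8, (Lpos + Lneg) / 4, by linarith, by linarith⟩
    have hts : tsupport (fun x => ((B.normed volume x : ℝ) : ℂ)) ⊆ Ioo (-Lneg) Lpos := by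
      refine (closure_mono (t := Function.support (B.normed volume)) ?_).trans ?_
      · intro x hx
        simpa using hx
      · change tsupport (B.normed volume) ⊆ _
        rw [B.tsupport_normed_eq, Real.closedBall_eq_Icc]
        intro x hx
        have h1 : (Lpos - Lneg) / 2 - (Lpos + Lneg) / 4 ≤ x := hx.1
        have h2 : x ≤ (Lpos - Lneg) / 2 + (Lpos + Lneg) / 4 := hx.2
        constructor <;> linarith
    have hsub : ∀ x ∉ Ioo (-Lneg) Lpos, ((B.normed volume x : ℝ) : ℂ) = 0 := by
      intro x hx
      by_contra hne
      exact hx (hts (subset_tsupport _ hne))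
    refine ⟨fun x => ((B.normed volume x : ℝ) : ℂ),
      ⟨Complex.ofRealCLM.contDiff.comp B.contDiff_normed, ?_, hts⟩, ?_⟩
    · exact B.hasCompactSupport_normed.comp_left (g := fun x : ℝ => (x : ℂ)) (by simp)
    · rw [setIntegral_eq_integral_of_forall_compl_eq_zero hsub, integral_complex_ofReal,
        B.integral_normed, Complex.ofReal_one]
  refine ⟨∫ x in Ioo (-Lneg) Lpos, v x * ψ x, ?_⟩
  set c := ∫ x in Ioo (-Lneg) Lpos, v x * ψ x with hc
  rw [← sub_eq_zero]
  refine HasWeakDeriv.eq_zero (hasWeakDeriv_iff.2 ?_)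
  rintro p ⟨φ, hφ, h1, -⟩
  rw [← ofCont_eq_iff (hf := hφ.smooth.continuous)] at h1
  rw [h1, map_zero, zero_apply, eq_comm, neg_eq_zero, map_sub, map_smul,
    sub_apply, smul_apply, bil_ofCont_right, bil_ofCont]
  set m := ∫ x in Ioo (-Lneg) Lpos, φ x with hm
  have hint : ∀ g : ℝ → ℂ, Continuous g → IntegrableOn g (Ioo (-Lneg) Lpos) := fun g hg =>
    hg.integrableOn_Icc.mono_set Ioo_subset_Icc_self
  -- Du Bois-Reymond: `φ - m ψ` has mean zero, hence is the derivative of a test function, and `v`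
  -- integrates to zero against it.
  have ht : IsTest Lneg Lpos (fun x => φ x + (-m) * ψ x) := by
    have htm : tsupport (fun x => (-m) * ψ x) ⊆ tsupport ψ :=
      closure_mono (Function.support_const_smul_subset (-m) ψ)
    exact ⟨hφ.smooth.add (contDiff_const.mul hψ.smooth),
      hφ.compact.add (hψ.compact.smul_left (f := fun _ => -m)),
      (tsupport_add _ _).trans (union_subset hφ.supp (htm.trans hψ.supp))⟩
  obtain ⟨Φ, hΦ, hΦ'⟩ := ht.exists_primitive h0 (by
    have e := integral_add (hint _ hφ.smooth.continuous)
      (hint (fun x => -m * ψ x) (continuous_const.mul hψ.smooth.continuous))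
    rw [e, integral_const_mul, hψ1, ← hm]
    ring)
  have h2 := h Φ hΦ
  rw [hΦ'] at h2
  have h3 : ∫ x in Ioo (-Lneg) Lpos, (0 : L2I Lneg Lpos) x * Φ x = 0 := by
    refine integral_eq_zero_of_ae ?_
    filter_upwards [Lp.coeFn_zero ℂ 2 (volI Lneg Lpos)] with x hx
    rw [hx]
    simp
  rw [h3, neg_zero] at h2
  have h4 : ∫ x in Ioo (-Lneg) Lpos, v x * (φ x + (-m) * ψ x)
      = (∫ x in Ioo (-Lneg) Lpos, v x * φ x) + (-m) * ∫ x in Ioo (-Lneg) Lpos, v x * ψ x := by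
    rw [← integral_const_mul, ← integral_add (integrable_mul_test v hφ.smooth.continuous hφ.compact)
      ((integrable_mul_test v hψ.smooth.continuous hψ.compact).const_mul _)]
    congr 1
    ext x
    ring
  rw [h4, ← hc] at h2
  simp only [one_mul, smul_eq_mul]
  rw [← hm]
  linear_combination h2

/-- `∫_I f`. -/
abbrev meanL (Lneg Lpos : ℝ) : L2I Lneg Lpos →L[ℂ] ℂ := bil Lneg Lpos (oneL Lneg Lpos)

/-- Both conditions are closed and hold for test functions. The vanishing mean of the derivative
encodes the Dirichlet condition at the right end point; the primitive already vanishes at the left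
one. -/
theorem eq_prim_of_mem_closure (h0 : -Lneg < Lpos) {p : L2I Lneg Lpos × L2I Lneg Lpos}
    (hp : p ∈ (testPairs Lneg Lpos).topologicalClosure) :
    p.1 = prim Lneg Lpos p.2 ∧ meanL Lneg Lpos p.2 = 0 := by
  have hcl : IsClosed {p : L2I Lneg Lpos × L2I Lneg Lpos |
      p.1 = prim Lneg Lpos p.2 ∧ meanL Lneg Lpos p.2 = 0} :=
    (isClosed_eq (by fun_prop) (by fun_prop)).inter (isClosed_eq (by fun_prop) (by fun_prop))
  refine closure_minimal ?_ hcl hp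
  rintro p ⟨φ, hφ, h1, h2⟩
  rw [← ofCont_eq_iff (hf := hφ.smooth.continuous)] at h1
  rw [← ofCont_eq_iff (hf := hφ.continuous_deriv)] at h2
  have key : ∀ x, ∫ s in (-Lneg)..x, deriv φ s = φ x := fun x => by
    rw [intervalIntegral.integral_deriv_eq_sub (fun x _ => hφ.differentiable x)
      (hφ.continuous_deriv.intervalIntegrable _ _), hφ.apply_eq_zero (x := -Lneg) (by simp),
      sub_zero]
  constructor
  · rw [h1, h2, prim_ofCont]
    exact ofCont_congr fun x _ => (key x).symm
  · rw [h2, meanL, bil_ofCont, setIntegral_Ioo_eq_intervalIntegral h0.le]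
    simp only [one_mul, key]
    exact hφ.apply_eq_zero (by simp)

/-- By duality: a vector orthogonal to all derivatives of test functions has a conjugate with zero
weak derivative, so it is constant. Hence these derivatives are dense among functions of mean zero,
and the primitive is continuous. -/
theorem prim_mem_closure (h0 : -Lneg < Lpos) {w : L2I Lneg Lpos} (hw : meanL Lneg Lpos w = 0) :
    (prim Lneg Lpos w, w) ∈ (testPairs Lneg Lpos).topologicalClosure := by
  set M : Submodule ℂ (L2I Lneg Lpos) := (testPairs Lneg Lpos).map (LinearMap.snd ℂ _ _) with hM
  have hwM : w ∈ M.topologicalClosure := by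
    rw [← Submodule.orthogonal_orthogonal_eq_closure, Submodule.mem_orthogonal]
    intro h hh
    rw [Submodule.mem_orthogonal'] at hh
    have hi : ∀ v : L2I Lneg Lpos, inner ℂ h v = bil Lneg Lpos (star h) v := fun v => by
      rw [bil_apply, L2.inner_def]
      refine integral_congr_ae ?_
      filter_upwards [Lp.coeFn_star h] with x hx
      simp [hx, mul_comm]
    have hwd : HasWeakDeriv (star h) 0 := by
      refine hasWeakDeriv_iff.2 fun p hp => ?_
      have h1 : inner ℂ h p.2 = 0 := hh _ ⟨p, hp, rfl⟩
      rw [← hi, h1]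
      simp
    obtain ⟨c, hc⟩ := hwd.eq_const h0
    rw [hi, hc, map_smul, smul_apply, hw, smul_zero]
  have hcont : Continuous fun w : L2I Lneg Lpos => (prim Lneg Lpos w, w) := by fun_prop
  refine map_mem_closure (f := fun w : L2I Lneg Lpos => (prim Lneg Lpos w, w)) hcont hwM ?_
  rintro _ ⟨p, hp, rfl⟩
  have := (eq_prim_of_mem_closure h0 (subset_closure hp)).1
  show (prim Lneg Lpos p.2, p.2) ∈ testPairs Lneg Lpos
  rw [← this]
  exact hp

/-- This removes all approximation from `H10`: membership in the domain of `P_ν` becomes an integral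
equation. -/
theorem mem_H10_and_hasWeakDeriv_iff (h0 : -Lneg < Lpos) {u w : L2I Lneg Lpos} :
    (u ∈ H10 Lneg Lpos ∧ HasWeakDeriv u w) ↔ u = prim Lneg Lpos w ∧ meanL Lneg Lpos w = 0 := by
  constructor
  · rintro ⟨⟨p, hp, rfl⟩, hw⟩
    obtain ⟨h1, h2⟩ := eq_prim_of_mem_closure h0 hp
    have h3 : HasWeakDeriv p.1 p.2 := h1 ▸ hasWeakDeriv_prim h0 p.2
    have h4 : w = p.2 := by
      have := (HasWeakDeriv.add hw (h3.smul (-1)))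
      rw [neg_one_smul, neg_one_smul, ← sub_eq_add_neg, ← sub_eq_add_neg] at this
      have h5 : LinearMap.fst ℂ (L2I Lneg Lpos) (L2I Lneg Lpos) p - p.1 = 0 := sub_self _
      rw [h5] at this
      exact sub_eq_zero.1 this.eq_zero
    rw [h4]
    exact ⟨h1, h2⟩
  · rintro ⟨rfl, h2⟩
    exact ⟨⟨_, prim_mem_closure h0 h2, rfl⟩, hasWeakDeriv_prim h0 w⟩

end WeakDerivatives

/-! ### Resolvents and spectral projections of unbounded operators -/

section AbstractSpectral

/-- A family of elements of a Banach algebra that satisfies the resolvent identity on a set is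
differentiable there. -/
theorem differentiableOn_of_resolvent_identity {𝔸 : Type*} [NormedRing 𝔸] [NormedAlgebra ℂ 𝔸]
    [CompleteSpace 𝔸] {F : ℂ → 𝔸} {U : Set ℂ}
    (h : ∀ z ∈ U, ∀ w ∈ U, F z - F w = (w - z) • (F z * F w)) : DifferentiableOn ℂ F U := by
  intro z hz
  have hG : DifferentiableAt ℂ (fun w : ℂ => 1 + (w - z) • F z) z := by fun_prop
  have hGz : IsUnit (1 + (z - z) • F z) := by simp
  -- The resolvent identity, solved for `F w`, reads `F w = (1 + (w - z) F z)⁻¹ F z` near `z`.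
  have h1 : DifferentiableWithinAt ℂ (fun w => Ring.inverse (1 + (w - z) • F z) * F z) U z :=
    ((hG.inverse hGz).mul_const (F z)).differentiableWithinAt
  refine h1.congr_of_eventuallyEq ?_ (by simp)
  have hun : ∀ᶠ w in nhds z, IsUnit (1 + (w - z) • F z) :=
    hG.continuousAt.eventually (p := fun x => IsUnit x) (Units.isOpen.mem_nhds hGz)
  filter_upwards [mem_nhdsWithin_of_mem_nhds hun, self_mem_nhdsWithin] with w hw hwU
  have e : (1 + (w - z) • F z) * F w = F z := by
    rw [add_mul, one_mul, smul_mul_assoc, ← h z hz w hwU]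
    abel
  calc F w = Ring.inverse (1 + (w - z) • F z) * ((1 + (w - z) • F z) * F w) := by
        rw [← mul_assoc, Ring.inverse_mul_cancel _ hw, one_mul]
    _ = _ := by rw [e]

variable {E : Type*} [NormedAddCommGroup E] [NormedSpace ℂ E]

theorem mul_apply_eq (S T : E →L[ℂ] E) (x : E) : (S * T) x = S (T x) := rfl

theorem isResolventAt_resolventAt {A : E →ₗ.[ℂ] E} {z : ℂ} (h : z ∈ resolventSet A) :
    IsResolventAt A z (resolventAt A z) := by
  rw [resolventAt, dif_pos h]
  exact h.choose_spec

theorem resolventAt_sub {A : E →ₗ.[ℂ] E} {z w : ℂ} (hz : z ∈ resolventSet A)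
    (hw : w ∈ resolventSet A) :
    resolventAt A z - resolventAt A w = (w - z) • (resolventAt A z * resolventAt A w) := by
  have Hz := isResolventAt_resolventAt hz
  have Hw := isResolventAt_resolventAt hw
  ext v
  obtain ⟨hd, hv⟩ := Hw.1 v
  have h1 := Hz.2 ⟨_, hd⟩
  have h2 : z • resolventAt A w v - A ⟨resolventAt A w v, hd⟩
      = (w • resolventAt A w v - A ⟨resolventAt A w v, hd⟩) - (w - z) • resolventAt A w v := by
    module
  change resolventAt A z (z • resolventAt A w v - A ⟨resolventAt A w v, hd⟩) = _ at h1
  rw [h2, hv, map_sub, map_smul] at h1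
  change resolventAt A z v - resolventAt A w v = (w - z) • resolventAt A z (resolventAt A w v)
  change _ = resolventAt A w v at h1
  rw [← h1]
  rw [h1]
  rw [sub_eq_iff_eq_add, ← sub_eq_iff_eq_add']
  exact h1

/-- The radius obtained is the one picked by the definition, which need not be the given `r`; the
contour computations therefore start by replacing `r` with it. -/
theorem spectralProjection_apply {A : E →ₗ.[ℂ] E} {lam : ℂ} {r : ℝ}
    (h : IsIsolatingRadius A lam r) :
    ∃ r, IsIsolatingRadius A lam r ∧ spectralProjection A lam
      = (2 * Real.pi * Complex.I : ℂ)⁻¹ • ∮ z in C(lam, r), resolventAt A z := by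
  have hex : ∃ r, IsIsolatingRadius A lam r := ⟨r, h⟩
  refine ⟨hex.choose, hex.choose_spec, ?_⟩
  rw [spectralProjection, dif_pos hex]

theorem IsIsolatingRadius.mem_resolventSet_of_mem_sphere {A : E →ₗ.[ℂ] E} {lam : ℂ} {r : ℝ}
    (h : IsIsolatingRadius A lam r) {z : ℂ} (hz : z ∈ Metric.sphere lam r) :
    z ≠ lam ∧ z ∈ resolventSet A := by
  have hne : z ≠ lam := by
    rintro rfl
    simp only [Metric.mem_sphere, dist_self] at hz
    exact h.1.ne hz
  exact ⟨hne, h.2 z (Metric.sphere_subset_closedBall hz) hne⟩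

/-- Without an isolating radius the projection is `0` by convention, and its range is not a line. -/
theorem IsAlgSimple.exists_isIsolatingRadius {A : E →ₗ.[ℂ] E} {lam : ℂ} (h : IsAlgSimple A lam) :
    ∃ r, IsIsolatingRadius A lam r := by
  by_contra hne
  rw [IsAlgSimple, spectralProjection, dif_neg hne] at h
  have h0 : ((0 : E →L[ℂ] E) : E →ₗ[ℂ] E) = 0 := rfl
  rw [h0, LinearMap.range_zero, finrank_bot] at h
  exact zero_ne_one h

theorem isAlgSimple_of_spectralProjection_eq {A : E →ₗ.[ℂ] E} {lam : ℂ} {y : E} (hy : y ≠ 0)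
    (ℓ : E →L[ℂ] ℂ) (hℓy : ℓ y = 1) (h : ∀ f, spectralProjection A lam f = ℓ f • y) :
    IsAlgSimple A lam := by
  have : LinearMap.range (spectralProjection A lam : E →ₗ[ℂ] E) = Submodule.span ℂ {y} := by
    ext v
    rw [Submodule.mem_span_singleton, LinearMap.mem_range]
    constructor
    · rintro ⟨f, rfl⟩
      exact ⟨ℓ f, (h f).symm⟩
    · rintro ⟨c, rfl⟩
      exact ⟨c • y, by rw [ContinuousLinearMap.coe_coe, h, map_smul, hℓy]; simp⟩
  rw [IsAlgSimple, this, finrank_span_singleton hy]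

variable [CompleteSpace E]

theorem differentiableOn_resolventAt (A : E →ₗ.[ℂ] E) :
    DifferentiableOn ℂ (resolventAt A) (resolventSet A) :=
  differentiableOn_of_resolvent_identity fun _ hz _ hw => resolventAt_sub hz hw

theorem circleIntegral_apply {F : ℂ → E →L[ℂ] E} {c : ℂ} {r : ℝ} (hF : CircleIntegrable F c r)
    (v : E) : (∮ z in C(c, r), F z) v = ∮ z in C(c, r), F z v := by
  have := ContinuousLinearMap.intervalIntegral_comp_comm (ContinuousLinearMap.apply ℂ E v)
    hF.out
  simp only [ContinuousLinearMap.apply_apply, smul_apply] at this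
  exact this.symm

theorem IsIsolatingRadius.circleIntegrable {A : E →ₗ.[ℂ] E} {lam : ℂ} {r : ℝ}
    (h : IsIsolatingRadius A lam r) : CircleIntegrable (resolventAt A) lam r := by
  refine ContinuousOn.circleIntegrable h.1.le
    ((differentiableOn_resolventAt A).continuousOn.mono ?_)
  intro z hz
  refine h.2 z (Metric.sphere_subset_closedBall hz) ?_
  rintro rfl
  simp only [Metric.mem_sphere, dist_self] at hz
  exact h.1.ne hz

/-- The spectral projection fixes generalized eigenvectors of order two. -/
theorem spectralProjection_apply_of_generalized {A : E →ₗ.[ℂ] E} {lam : ℂ} {r : ℝ}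
    (h : IsIsolatingRadius A lam r) (y w : A.domain) (hy : A y = lam • (y : E))
    (hw : A w = lam • (w : E) + (y : E)) : spectralProjection A lam (w : E) = w := by
  obtain ⟨r, hr, e⟩ := spectralProjection_apply h
  -- On a Jordan chain of length two the resolvent is explicit, and only its simple pole contributes
  -- to the contour integral.
  have e1 : ∀ z ∈ Metric.sphere lam r, resolventAt A z (w : E)
      = (z - lam)⁻¹ • (w : E) + (z - lam) ^ (-2 : ℤ) • (y : E) := by
    intro z hz
    obtain ⟨hne, hz'⟩ := hr.mem_resolventSet_of_mem_sphere hz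
    have hne' := sub_ne_zero.2 hne
    have H := (isResolventAt_resolventAt hz').2
      ((z - lam)⁻¹ • w + (z - lam) ^ (-2 : ℤ) • y)
    rw [← Submodule.coe_smul, ← Submodule.coe_smul, ← Submodule.coe_add, ← H]
    congr 1
    rw [LinearPMap.map_add, LinearPMap.map_smul, LinearPMap.map_smul, hy, hw]
    have e2 : (z - lam) ^ (-2 : ℤ) = (z - lam)⁻¹ * (z - lam)⁻¹ := by
      rw [zpow_neg, ← mul_inv]
      congr 1
      norm_cast
      ring
    rw [e2]
    simp only [Submodule.coe_add, Submodule.coe_smul]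
    have e3 : (z - lam) * (z - lam)⁻¹ = 1 := mul_inv_cancel₀ hne'
    match_scalars
    · linear_combination -e3
    · linear_combination -(z - lam)⁻¹ * e3
  have hc1 : CircleIntegrable (fun z => (z - lam)⁻¹ • (w : E)) lam r := by
    refine ContinuousOn.circleIntegrable hr.1.le ?_
    refine ContinuousOn.smul (ContinuousOn.inv₀ (by fun_prop) fun z hz => ?_) continuousOn_const
    exact sub_ne_zero.2 (hr.mem_resolventSet_of_mem_sphere hz).1
  have hc2 : CircleIntegrable (fun z => (z - lam) ^ (-2 : ℤ) • (y : E)) lam r := by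
    refine ContinuousOn.circleIntegrable hr.1.le ?_
    refine ContinuousOn.smul (ContinuousOn.zpow₀ (by fun_prop) _ fun z hz => Or.inl ?_)
      continuousOn_const
    exact sub_ne_zero.2 (hr.mem_resolventSet_of_mem_sphere hz).1
  rw [e, smul_apply, circleIntegral_apply hr.circleIntegrable,
    circleIntegral.integral_congr hr.1.le e1, circleIntegral.integral_add hc1 hc2,
    circleIntegral.integral_smul_const, circleIntegral.integral_smul_const,
    circleIntegral.integral_sub_center_inv _ hr.1.ne',
    circleIntegral.integral_sub_zpow_of_ne (by norm_num), zero_smul, add_zero,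
    inv_smul_smul₀ Complex.two_pi_I_ne_zero]

theorem spectralProjection_apply_of_eigenvector {A : E →ₗ.[ℂ] E} {lam : ℂ} {r : ℝ}
    (h : IsIsolatingRadius A lam r) (y : A.domain) (hy : A y = lam • (y : E)) :
    spectralProjection A lam (y : E) = y :=
  spectralProjection_apply_of_generalized h 0 y (by simp) (by simpa using hy)

/-- An algebraically simple eigenvalue has no generalized eigenvectors of order two. -/
theorem IsAlgSimple.not_generalized {A : E →ₗ.[ℂ] E} {lam : ℂ} (h : IsAlgSimple A lam)
    (y w : A.domain) (hy : A y = lam • (y : E)) (hy0 : (y : E) ≠ 0) :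
    A w ≠ lam • (w : E) + (y : E) := by
  intro hw
  obtain ⟨r, hr⟩ := h.exists_isIsolatingRadius
  have h1 := spectralProjection_apply_of_eigenvector hr y hy
  have h2 := spectralProjection_apply_of_generalized hr y w hy hw
  -- Both vectors lie in the range of the projection, a line. So `w` is a multiple of `y`, hence an
  -- eigenvector, which forces `y = 0`.
  obtain ⟨c, hc⟩ := (finrank_eq_one_iff_of_nonzero'
    (⟨(y : E), ⟨(y : E), h1⟩⟩ : LinearMap.range (spectralProjection A lam : E →ₗ[ℂ] E))
    (fun h0 => hy0 (congrArg Subtype.val h0))).1 h ⟨(w : E), ⟨(w : E), h2⟩⟩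
  have hc' : c • (y : E) = (w : E) := congrArg Subtype.val hc
  have hcw : w = c • y := Subtype.ext hc'.symm
  rw [hcw, LinearPMap.map_smul, hy] at hw
  apply hy0
  rw [Submodule.coe_smul, smul_comm] at hw
  simpa using hw

/-- The spectral projection at an isolated eigenvalue at which the operator splits as a direct sum
of an eigenline and an invertible part. -/
theorem spectralProjection_eq_of_splitting {A : E →ₗ.[ℂ] E} {lam : ℂ} {r : ℝ}
    (h : IsIsolatingRadius A lam r) (y : A.domain) (hy : A y = lam • (y : E))
    (ℓ : E →L[ℂ] ℂ) (hℓy : ℓ y = 1) (hℓ : ∀ u : A.domain, ℓ (A u) = lam * ℓ u)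
    (S : E →L[ℂ] E)
    (hS : ∀ f, ℓ f = 0 → ∃ hd : S f ∈ A.domain, lam • S f - A ⟨S f, hd⟩ = f)
    (hinj : ∀ u : A.domain, A u = lam • (u : E) → ℓ u = 0 → (u : E) = 0) (f : E) :
    spectralProjection A lam f = ℓ f • (y : E) := by
  classical
  set Q : E →L[ℂ] E := 1 - ℓ.smulRight (y : E) with hQ
  have hQa : ∀ f, Q f = f - ℓ f • (y : E) := fun f => by simp [hQ]
  have hℓQ : ∀ f, ℓ (Q f) = 0 := fun f => by rw [hQa, map_sub, map_smul, hℓy]; simp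
  -- The part of the resolvent on the kernel of `ℓ`, with its removable singularity at `lam` filled
  -- in by `Q S Q`. It satisfies the resolvent identity on the whole closed disk, so it is
  -- holomorphic and integrates to zero; what remains is the rank-one term with a simple pole.
  set F : ℂ → E →L[ℂ] E := fun z => if z = lam then Q * S * Q else resolventAt A z * Q with hF
  obtain ⟨r, hr, e⟩ := spectralProjection_apply h
  have hFs : ∀ z ∈ Metric.closedBall lam r, ∀ f, ∃ hd : F z f ∈ A.domain,
      z • F z f - A ⟨F z f, hd⟩ = Q f ∧ ℓ (F z f) = 0 := by
    intro z hz f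
    by_cases hzl : z = lam
    · obtain ⟨hd, hv⟩ := hS (Q f) (hℓQ f)
      have hFz : F z f = Q (S (Q f)) := by
        simp only [hF, if_pos hzl, mul_apply_eq]
      have hval : F z f = ((⟨S (Q f), hd⟩ - ℓ (S (Q f)) • y : A.domain) : E) := by
        rw [hFz, hQa (S (Q f))]; rfl
      have hmem : F z f ∈ A.domain := hval ▸ Subtype.coe_prop _
      refine ⟨hmem, ?_, by rw [hFz, hℓQ]⟩
      have : (⟨F z f, hmem⟩ : A.domain) = ⟨S (Q f), hd⟩ - ℓ (S (Q f)) • y := Subtype.ext hval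
      rw [this, LinearPMap.map_sub, LinearPMap.map_smul, hy, hval, hzl]
      refine Eq.trans ?_ hv
      simp only [Submodule.coe_sub, Submodule.coe_smul]
      module
    · obtain ⟨hd, hv⟩ := (isResolventAt_resolventAt (hr.2 z hz hzl)).1 (Q f)
      have hFz : F z f = resolventAt A z (Q f) := by
        simp only [hF, if_neg hzl, mul_apply_eq]
      simp only [hFz]
      refine ⟨hd, hv, ?_⟩
      have h2 := congrArg ℓ hv
      rw [map_sub, map_smul, hℓ, hℓQ, smul_eq_mul, ← sub_mul] at h2
      exact (mul_eq_zero.1 h2).resolve_left (sub_ne_zero.2 hzl)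
  have huniq : ∀ z ∈ Metric.closedBall lam r, ∀ u : A.domain, z • (u : E) - A u = 0 →
      ℓ u = 0 → (u : E) = 0 := by
    intro z hz u hu hu'
    by_cases hzl : z = lam
    · exact hinj u (by rw [← hzl]; exact (sub_eq_zero.1 hu).symm) hu'
    · have := (isResolventAt_resolventAt (hr.2 z hz hzl)).2 u
      rw [hu, map_zero] at this
      exact this.symm
  have hid : ∀ z ∈ Metric.closedBall lam r, ∀ w ∈ Metric.closedBall lam r,
      F z - F w = (w - z) • (F z * F w) := by
    intro z hz w hw
    ext f
    obtain ⟨d1, v1, l1⟩ := hFs z hz f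
    obtain ⟨d2, v2, l2⟩ := hFs w hw f
    obtain ⟨d3, v3, l3⟩ := hFs z hz (F w f)
    have h0 := huniq z hz (⟨F z f, d1⟩ - ⟨F w f, d2⟩ - (w - z) • ⟨F z (F w f), d3⟩) ?_ ?_
    · simp only [sub_apply, smul_apply, mul_apply_eq]
      exact sub_eq_zero.1 h0
    · rw [LinearPMap.map_sub, LinearPMap.map_sub, LinearPMap.map_smul]
      simp only [Submodule.coe_sub, Submodule.coe_smul]
      rw [hQa, l2, zero_smul, sub_zero] at v3
      have e1 : z • (F z f - F w f - (w - z) • F z (F w f))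
          - (A ⟨F z f, d1⟩ - A ⟨F w f, d2⟩ - (w - z) • A ⟨F z (F w f), d3⟩)
          = (z • F z f - A ⟨F z f, d1⟩) - (w • F w f - A ⟨F w f, d2⟩)
            - (w - z) • (z • F z (F w f) - A ⟨F z (F w f), d3⟩) + (w - z) • F w f := by module
      rw [e1, v1, v2, v3]
      module
    · simp [l1, l2, l3]
  have hdiff := differentiableOn_of_resolvent_identity hid
  have hzero : ∮ z in C(lam, r), F z = 0 :=
    Complex.circleIntegral_eq_zero_of_differentiable_on_off_countable hr.1.le
      countable_empty hdiff.continuousOn fun z hz =>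
        hdiff.differentiableAt (Metric.closedBall_mem_nhds_of_mem hz.1)
  have hFint : CircleIntegrable F lam r :=
    ContinuousOn.circleIntegrable hr.1.le (hdiff.continuousOn.mono Metric.sphere_subset_closedBall)
  have hres : ∀ z ∈ Metric.sphere lam r, resolventAt A z
      = F z + (z - lam)⁻¹ • ℓ.smulRight (y : E) := by
    intro z hz
    obtain ⟨hne, hz'⟩ := hr.mem_resolventSet_of_mem_sphere hz
    have H := (isResolventAt_resolventAt hz').2 y
    rw [hy, ← sub_smul, map_smul] at H
    have H' : resolventAt A z (y : E) = (z - lam)⁻¹ • (y : E) := by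
      rw [← H, inv_smul_smul₀ (sub_ne_zero.2 hne), H]
    ext f
    simp only [hF, if_neg hne, add_apply, mul_apply_eq, smul_apply, ContinuousLinearMap.smulRight_apply]
    rw [hQa, map_sub, map_smul, H', smul_comm]
    abel
  have hinv : ContinuousOn (fun z : ℂ => (z - lam)⁻¹) (Metric.sphere lam r) :=
    ContinuousOn.inv₀ (by fun_prop) fun z hz =>
      sub_ne_zero.2 (hr.mem_resolventSet_of_mem_sphere hz).1
  have hc1 : CircleIntegrable (fun z => (z - lam)⁻¹ • ℓ.smulRight (y : E)) lam r :=
    ContinuousOn.circleIntegrable hr.1.le (hinv.smul continuousOn_const)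
  rw [e, circleIntegral.integral_congr hr.1.le hres, circleIntegral.integral_add hFint hc1, hzero,
    zero_add, circleIntegral.integral_smul_const,
    circleIntegral.integral_sub_center_inv _ hr.1.ne', inv_smul_smul₀ Complex.two_pi_I_ne_zero]
  rfl

end AbstractSpectral

/-! ### The boundary value problem as a Volterra equation -/

section Volterra

variable {Lneg Lpos : ℝ}

theorem schrodingerGraph_congr {q q' : ℝ → ℝ} (h : ∀ x ∈ Ioo (-Lneg) Lpos, q x = q' x) (ν : ℂ) :
    schrodingerGraph Lneg Lpos q ν = schrodingerGraph Lneg Lpos q' ν := by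
  have key : ∀ q q' : ℝ → ℝ, (∀ x ∈ Ioo (-Lneg) Lpos, q x = q' x) →
      schrodingerGraph Lneg Lpos q ν ≤ schrodingerGraph Lneg Lpos q' ν := by
    rintro q q' h p ⟨h0, u₁, u₂, h1, h2, h3⟩
    refine ⟨h0, u₁, u₂, h1, h2, h3.trans ?_⟩
    refine (ae_restrict_iff' measurableSet_Ioo).2 (Filter.Eventually.of_forall fun x hx => ?_)
    simp only [h x hx]
  exact le_antisymm (key q q' h) (key q' q fun x hx => (h x hx).symm)

theorem schrodinger_congr {q q' : ℝ → ℝ} (h : ∀ x ∈ Ioo (-Lneg) Lpos, q x = q' x) (ν : ℂ) :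
    schrodinger Lneg Lpos q ν = schrodinger Lneg Lpos q' ν := by
  rw [schrodinger, schrodinger, schrodingerGraph_congr h]

/-- Multiplication by `q²`. -/
def qsq (Lneg Lpos : ℝ) (q : ℝ → ℝ) (hq : Continuous q) : L2I Lneg Lpos →L[ℂ] L2I Lneg Lpos :=
  mulL Lneg Lpos (fun x => (q x : ℂ) ^ 2) (by fun_prop)

variable {q : ℝ → ℝ}

theorem hasWeakDeriv_const_add_prim (h0 : -Lneg < Lpos) (c : ℂ) (h : L2I Lneg Lpos) :
    HasWeakDeriv (c • oneL Lneg Lpos + prim Lneg Lpos h) h := by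
  have h6 : HasWeakDeriv (c • oneL Lneg Lpos) 0 := by
    refine hasWeakDeriv_iff.2 fun p hp => ?_
    have := (eq_prim_of_mem_closure h0 (subset_closure hp)).2
    rw [map_smul, smul_apply, this]
    simp
  simpa using h6.add (hasWeakDeriv_prim h0 h)

/-- Here `w` is `u'` and `c` is its value at the left end point. The Dirichlet conditions are
contained in `u = prim w` and in the vanishing mean of `w`. -/
theorem mem_schrodingerGraph_iff (h0 : -Lneg < Lpos) (hq : Continuous q) {ν : ℂ}
    {u f : L2I Lneg Lpos} :
    (u, f) ∈ schrodingerGraph Lneg Lpos q ν ↔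
      ∃ (w : L2I Lneg Lpos) (c : ℂ), u = prim Lneg Lpos w ∧ meanL Lneg Lpos w = 0 ∧
        w = c • oneL Lneg Lpos + prim Lneg Lpos (ν ^ 2 • qsq Lneg Lpos q hq u - f) := by
  have hae : ∀ u₂ : L2I Lneg Lpos, (f =ᵐ[volI Lneg Lpos]
      fun x => -u₂ x + ν ^ 2 * (q x : ℂ) ^ 2 * u x) ↔ u₂ = ν ^ 2 • qsq Lneg Lpos q hq u - f := by
    intro u₂
    have e : f = -u₂ + ν ^ 2 • qsq Lneg Lpos q hq u ↔ u₂ = ν ^ 2 • qsq Lneg Lpos q hq u - f := by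
      constructor <;> · intro h; rw [h]; abel
    rw [← e]
    have e2 : (-u₂ + ν ^ 2 • qsq Lneg Lpos q hq u : L2I Lneg Lpos) =ᵐ[volI Lneg Lpos]
        fun x => -u₂ x + ν ^ 2 * (q x : ℂ) ^ 2 * u x := by
      filter_upwards [Lp.coeFn_add (-u₂) (ν ^ 2 • qsq Lneg Lpos q hq u), Lp.coeFn_neg u₂,
        Lp.coeFn_smul (ν ^ 2) (qsq Lneg Lpos q hq u),
        coeFn_mulL (m := fun x => (q x : ℂ) ^ 2) (by fun_prop) u] with x h1 h2 h3 h4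
      rw [h1, Pi.add_apply, h2, h3, Pi.smul_apply, qsq, h4, Pi.neg_apply, smul_eq_mul, mul_assoc]
    exact ⟨fun h => Lp.ext (h.trans e2.symm), fun h => h ▸ e2⟩
  constructor
  · rintro ⟨h1, w, u₂, h2, h3, h4⟩
    obtain ⟨h5, h6⟩ := (mem_H10_and_hasWeakDeriv_iff h0).1 ⟨h1, h2⟩
    rw [hae] at h4
    have h7 := h3.add ((hasWeakDeriv_prim h0 u₂).smul (-1))
    rw [neg_one_smul, neg_one_smul, add_neg_cancel] at h7
    obtain ⟨c, hc⟩ := h7.eq_const h0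
    refine ⟨w, c, h5, h6, ?_⟩
    rw [← h4, ← hc]
    abel
  · rintro ⟨w, c, h1, h2, h3⟩
    obtain ⟨h4, h5⟩ := (mem_H10_and_hasWeakDeriv_iff h0).2 ⟨h1, h2⟩
    refine ⟨h4, w, ν ^ 2 • qsq Lneg Lpos q hq u - f, h5, ?_, (hae _).2 rfl⟩
    rw [h3]
    exact hasWeakDeriv_const_add_prim h0 c _

/-- `P_ν` is symmetric for the bilinear pairing. -/
theorem bil_symm_of_mem_graph (h0 : -Lneg < Lpos) (hq : Continuous q) {ν : ℂ}
    {u f v g : L2I Lneg Lpos} (hu : (u, f) ∈ schrodingerGraph Lneg Lpos q ν)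
    (hv : (v, g) ∈ schrodingerGraph Lneg Lpos q ν) :
    bil Lneg Lpos f v = bil Lneg Lpos u g := by
  obtain ⟨w, c, h1, h2, h3⟩ := (mem_schrodingerGraph_iff h0 hq).1 hu
  obtain ⟨w', c', h1', h2', h3'⟩ := (mem_schrodingerGraph_iff h0 hq).1 hv
  -- `∫ u' v'` is integrated by parts in both directions.
  have e1 := (hasWeakDeriv_const_add_prim h0 c (ν ^ 2 • qsq Lneg Lpos q hq u - f)).bil_eq
    (prim_mem_closure h0 h2')
  have e2 := (hasWeakDeriv_const_add_prim h0 c' (ν ^ 2 • qsq Lneg Lpos q hq v - g)).bil_eq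
    (prim_mem_closure h0 h2)
  rw [← h3, ← h1'] at e1
  rw [← h3', ← h1] at e2
  change bil Lneg Lpos w w' = _ at e1
  change bil Lneg Lpos w' w = _ at e2
  rw [bil_comm w' w, e1] at e2
  have e3 : bil Lneg Lpos (qsq Lneg Lpos q hq u) v = bil Lneg Lpos (qsq Lneg Lpos q hq v) u := by
    rw [bil_apply, bil_apply]
    refine integral_congr_ae ?_
    filter_upwards [coeFn_mulL (m := fun x => (q x : ℂ) ^ 2) (by fun_prop) u,
      coeFn_mulL (m := fun x => (q x : ℂ) ^ 2) (by fun_prop) v] with x h1 h2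
    rw [qsq, h1, h2]
    ring
  rw [map_sub, map_smul, map_sub, map_smul, sub_apply, sub_apply, smul_apply, smul_apply, e3,
    bil_comm g u] at e2
  linear_combination e2

/-- The operator of multiplication by `ν² q² - z`. -/
def potL (Lneg Lpos : ℝ) (q : ℝ → ℝ) (hq : Continuous q) (p : ℂ × ℂ) :
    L2I Lneg Lpos →L[ℂ] L2I Lneg Lpos :=
  p.1 ^ 2 • qsq Lneg Lpos q hq - p.2 • 1

/-- The Volterra operator `1 - J² (ν² q² - z)`. -/
def volterra (Lneg Lpos : ℝ) (q : ℝ → ℝ) (hq : Continuous q) (p : ℂ × ℂ) :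
    L2I Lneg Lpos →L[ℂ] L2I Lneg Lpos :=
  1 - prim Lneg Lpos * prim Lneg Lpos * potL Lneg Lpos q hq p

theorem potL_mulL (hq : Continuous q) (p : ℂ × ℂ) {m : ℝ → ℂ} (hm : Continuous m)
    (u : L2I Lneg Lpos) :
    potL Lneg Lpos q hq p (mulL Lneg Lpos m hm u) = mulL Lneg Lpos m hm (potL Lneg Lpos q hq p u) := by
  have e : qsq Lneg Lpos q hq (mulL Lneg Lpos m hm u)
      = mulL Lneg Lpos m hm (qsq Lneg Lpos q hq u) := by
    rw [qsq, mulL_mulL, mulL_mulL]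
    congr 2
    ext x
    ring
  simp only [potL, sub_apply, smul_apply, one_apply_eq_self, e, map_sub, map_smul]

theorem integral_exp_sq_le {μ : ℝ} (hμ : 0 < μ) (a x : ℝ) :
    ∫ s in a..x, ‖Complex.exp (μ * s)‖ ^ 2 ≤ Real.exp (2 * μ * x) / (2 * μ) := by
  have e : ∀ s : ℝ, ‖Complex.exp (μ * s)‖ ^ 2 = Real.exp (2 * μ * s) := fun s => by
    rw [Complex.norm_exp, ← Real.exp_nat_mul]
    congr 1
    simp
    ring
  simp_rw [e]
  have hd : ∀ s ∈ uIcc a x, HasDerivAt (fun s => Real.exp (2 * μ * s) / (2 * μ))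
      (Real.exp (2 * μ * s)) s := fun s _ => by
    have h1 : HasDerivAt (fun s : ℝ => 2 * μ * s) (2 * μ) s := by
      simpa using (hasDerivAt_id s).const_mul (2 * μ)
    have h2 := h1.exp.div_const (2 * μ)
    rwa [mul_div_assoc, div_self (by positivity), mul_one] at h2
  rw [intervalIntegral.integral_eq_sub_of_hasDerivAt hd
    ((by fun_prop : Continuous fun s => Real.exp (2 * μ * s)).intervalIntegrable _ _)]
  have : 0 < Real.exp (2 * μ * a) / (2 * μ) := by positivity
  linarith

/-- Multiplication by `e^{μ x}`. -/
def expL (Lneg Lpos : ℝ) (μ : ℝ) : L2I Lneg Lpos →L[ℂ] L2I Lneg Lpos :=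
  mulL Lneg Lpos (fun x => Complex.exp (μ * x)) (by fun_prop)

theorem expL_mul_expL_neg (μ : ℝ) : expL Lneg Lpos μ * expL Lneg Lpos (-μ) = 1 := by
  ext1 u
  rw [mul_apply_eq, expL, expL, mulL_mulL, mulL_one _ fun x => ?_]
  · rfl
  · rw [← Complex.exp_add]
    simp

/-- Conjugation turns the kernel of the primitive into `e^{-μ(x - s)}`, `s < x`, whose `L²` norm in
`s` is at most `(2μ)^{-1/2}`. -/
theorem norm_expL_prim_expL_le {μ : ℝ} (hμ : 0 < μ) :
    ‖expL Lneg Lpos (-μ) * prim Lneg Lpos * expL Lneg Lpos μ‖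
      ≤ Real.sqrt ((volI Lneg Lpos).real univ / (2 * μ)) := by
  refine ContinuousLinearMap.opNorm_le_bound _ (Real.sqrt_nonneg _) fun f => ?_
  have e : (expL Lneg Lpos (-μ) * prim Lneg Lpos * expL Lneg Lpos μ) f
      = ofCont Lneg Lpos (fun x => Complex.exp ((-μ : ℝ) * x) * primFun (expL Lneg Lpos μ f) x)
        (by have := continuous_primFun (expL Lneg Lpos μ f); fun_prop) := by
    rw [mul_apply_eq, mul_apply_eq, prim_apply]
    exact mulL_ofCont _ _
  rw [e]
  refine (sq_le_sq₀ (norm_nonneg _) (by positivity)).1 ?_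
  refine (norm_ofCont_le (C := Real.sqrt (1 / (2 * μ)) * ‖f‖) _ fun x hx => ?_).trans_eq ?_
  · rw [norm_mul, Complex.norm_exp]
    have h1 := norm_primFun_mulL_le (m := fun x => Complex.exp (μ * x)) (by fun_prop) f
      (Ioo_subset_Icc_self hx)
    have h2 := Real.sqrt_le_sqrt (integral_exp_sq_le hμ (-Lneg) x)
    have h3 : Real.exp (2 * μ * x) / (2 * μ) = Real.exp (μ * x) ^ 2 * (1 / (2 * μ)) := by
      rw [← Real.exp_nat_mul]
      push_cast
      ring_nf
    rw [h3, Real.sqrt_mul (by positivity), Real.sqrt_sq (Real.exp_pos _).le] at h2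
    have h4 : Real.exp ((((-μ : ℝ) : ℂ) * x).re) * Real.exp (μ * x) = 1 := by
      rw [← Real.exp_add]
      simp
    calc _ ≤ Real.exp ((((-μ : ℝ) : ℂ) * x).re) *
          ((Real.exp (μ * x) * Real.sqrt (1 / (2 * μ))) * ‖f‖) := by
          gcongr
          exact h1.trans (by gcongr)
      _ = (Real.exp ((((-μ : ℝ) : ℂ) * x).re) * Real.exp (μ * x))
          * (Real.sqrt (1 / (2 * μ)) * ‖f‖) := by ring
      _ = _ := by rw [h4, one_mul]
  · rw [mul_pow, mul_pow, Real.sq_sqrt (by positivity), Real.sq_sqrt (by positivity)]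
    ring

/-- The potential commutes with multiplication by exponentials, so conjugation by `e^{μx}` replaces
the operator by `1 - T² K` with `‖T² K‖ ≤ V ‖K‖ / (2μ)`. The choice of `μ` makes this less than `1`,
and a Neumann series inverts it. -/
theorem isUnit_volterra (hq : Continuous q) (p : ℂ × ℂ) :
    IsUnit (volterra Lneg Lpos q hq p) := by
  set K := potL Lneg Lpos q hq p with hK
  set V := (volI Lneg Lpos).real univ with hV
  have hV0 : 0 ≤ V := measureReal_nonneg
  set μ : ℝ := V * ‖K‖ + 1 with hμ
  have hμ0 : 0 < μ := by positivity
  set T := expL Lneg Lpos (-μ) * prim Lneg Lpos * expL Lneg Lpos μ with hT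
  have hT' := norm_expL_prim_expL_le (Lneg := Lneg) (Lpos := Lpos) hμ0
  have e1 := expL_mul_expL_neg (Lneg := Lneg) (Lpos := Lpos) μ
  have e2 := expL_mul_expL_neg (Lneg := Lneg) (Lpos := Lpos) (-μ)
  rw [neg_neg] at e2
  have e3 : K * expL Lneg Lpos μ = expL Lneg Lpos μ * K := by
    ext1 u
    exact potL_mulL hq p _ u
  have hlt : ‖T * T * K‖ < 1 := by
    calc ‖T * T * K‖ ≤ ‖T‖ * ‖T‖ * ‖K‖ := by
          refine (norm_mul_le _ _).trans ?_
          gcongr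
          exact norm_mul_le _ _
      _ ≤ Real.sqrt (V / (2 * μ)) * Real.sqrt (V / (2 * μ)) * ‖K‖ := by gcongr
      _ = V * ‖K‖ / (2 * μ) := by rw [Real.mul_self_sqrt (by positivity)]; ring
      _ < 1 := by
          rw [div_lt_one (by positivity)]
          have : 0 ≤ V * ‖K‖ := by positivity
          linarith
  have hu := isUnit_one_sub_of_norm_lt_one hlt
  have huE : IsUnit (expL Lneg Lpos μ) := ⟨⟨_, _, e1, e2⟩, rfl⟩
  have huE' : IsUnit (expL Lneg Lpos (-μ)) := ⟨⟨_, _, e2, e1⟩, rfl⟩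
  have e4 : volterra Lneg Lpos q hq p
      = expL Lneg Lpos μ * (1 - T * T * K) * expL Lneg Lpos (-μ) := by
    have e5 : expL Lneg Lpos μ * (T * T * K) * expL Lneg Lpos (-μ)
        = (expL Lneg Lpos μ * expL Lneg Lpos (-μ)) * prim Lneg Lpos
          * (expL Lneg Lpos μ * expL Lneg Lpos (-μ)) * prim Lneg Lpos
          * ((expL Lneg Lpos μ * K) * expL Lneg Lpos (-μ)) := by
      simp only [hT, mul_assoc]
    rw [mul_sub, sub_mul, mul_one, e1, e5, ← e3, mul_assoc K, e1, volterra]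
    simp [hK]
  rw [e4]
  exact (huE.mul hu).mul huE'

/-- The inverse of `volterra`. -/
def volterraInv (Lneg Lpos : ℝ) (q : ℝ → ℝ) (hq : Continuous q) (p : ℂ × ℂ) :
    L2I Lneg Lpos →L[ℂ] L2I Lneg Lpos :=
  Ring.inverse (volterra Lneg Lpos q hq p)

theorem volterraInv_eq_iff (hq : Continuous q) (p : ℂ × ℂ) {u v : L2I Lneg Lpos} :
    u = volterraInv Lneg Lpos q hq p v ↔ volterra Lneg Lpos q hq p u = v := by
  constructor
  · rintro rfl
    rw [← mul_apply_eq, volterraInv, Ring.mul_inverse_cancel _ (isUnit_volterra hq p)]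
    rfl
  · rintro rfl
    rw [← mul_apply_eq, volterraInv, Ring.inverse_mul_cancel _ (isUnit_volterra hq p)]
    rfl

theorem continuous_potL (hq : Continuous q) : Continuous (potL Lneg Lpos q hq) := by
  unfold potL
  fun_prop

theorem continuous_volterraInv (hq : Continuous q) :
    Continuous (volterraInv Lneg Lpos q hq) := by
  refine continuous_iff_continuousAt.2 fun p => ?_
  obtain ⟨U, hU⟩ := isUnit_volterra (Lneg := Lneg) (Lpos := Lpos) hq p
  have h1 : Continuous (volterra Lneg Lpos q hq) := by
    have := continuous_potL (Lneg := Lneg) (Lpos := Lpos) hq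
    unfold volterra
    fun_prop
  have h2 := NormedRing.inverse_continuousAt U
  rw [hU] at h2
  exact ContinuousAt.comp (f := volterra Lneg Lpos q hq) h2 h1.continuousAt

end Volterra

/-! ### Eigenvalues, resolvent and spectral projections of `P_ν` -/

section Dirichlet

variable {Lneg Lpos : ℝ} {q : ℝ → ℝ}

/-- The solution of `-y'' + (ν² q² - z) y = 0` with `y = 0` and `y' = 1` at the left end point;
here `p = (ν, z)`. -/
def dirSol (Lneg Lpos : ℝ) (q : ℝ → ℝ) (hq : Continuous q) (p : ℂ × ℂ) : L2I Lneg Lpos :=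
  volterraInv Lneg Lpos q hq p (prim Lneg Lpos (oneL Lneg Lpos))

/-- The value of `dirSol` at the right end point. -/
def dirDet (Lneg Lpos : ℝ) (q : ℝ → ℝ) (hq : Continuous q) (p : ℂ × ℂ) : ℂ :=
  meanL Lneg Lpos (oneL Lneg Lpos
    + prim Lneg Lpos (potL Lneg Lpos q hq p (dirSol Lneg Lpos q hq p)))

/-- The solution operator of the inhomogeneous equation with zero Cauchy data at the left end
point. -/
def cauchyL (Lneg Lpos : ℝ) (q : ℝ → ℝ) (hq : Continuous q) (p : ℂ × ℂ) :
    L2I Lneg Lpos →L[ℂ] L2I Lneg Lpos :=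
  volterraInv Lneg Lpos q hq p * prim Lneg Lpos * prim Lneg Lpos

/-- The value at the right end point of the solution given by `cauchyL`. -/
def cauchyEnd (Lneg Lpos : ℝ) (q : ℝ → ℝ) (hq : Continuous q) (p : ℂ × ℂ) :
    L2I Lneg Lpos →L[ℂ] ℂ :=
  meanL Lneg Lpos ∘L prim Lneg Lpos ∘L
    (potL Lneg Lpos q hq p * cauchyL Lneg Lpos q hq p + 1)

theorem continuous_dirSol (hq : Continuous q) : Continuous (dirSol Lneg Lpos q hq) := by
  have := continuous_volterraInv (Lneg := Lneg) (Lpos := Lpos) hq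
  unfold dirSol
  fun_prop

theorem continuous_dirDet (hq : Continuous q) : Continuous (dirDet Lneg Lpos q hq) := by
  have := continuous_dirSol (Lneg := Lneg) (Lpos := Lpos) hq
  have := continuous_potL (Lneg := Lneg) (Lpos := Lpos) hq
  unfold dirDet
  fun_prop

/-- The shooting method: solutions that vanish at the left end point are parametrised by their slope
`c` there, and the last equation is the boundary condition at the right end point. -/
theorem mem_graph_iff_dirSol (h0 : -Lneg < Lpos) (hq : Continuous q) {ν z : ℂ}
    {u f : L2I Lneg Lpos} :
    (u, z • u - f) ∈ schrodingerGraph Lneg Lpos q ν ↔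
      ∃ c : ℂ, u = c • dirSol Lneg Lpos q hq (ν, z) + cauchyL Lneg Lpos q hq (ν, z) f ∧
        c * dirDet Lneg Lpos q hq (ν, z) + cauchyEnd Lneg Lpos q hq (ν, z) f = 0 := by
  rw [mem_schrodingerGraph_iff h0 hq]
  have e0 : ν ^ 2 • qsq Lneg Lpos q hq u - (z • u - f) = potL Lneg Lpos q hq (ν, z) u + f := by
    simp only [potL, sub_apply, smul_apply, one_apply_eq_self]
    abel
  rw [e0]
  have e1 : ∀ c : ℂ, u = c • dirSol Lneg Lpos q hq (ν, z) + cauchyL Lneg Lpos q hq (ν, z) f ↔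
      u = prim Lneg Lpos (c • oneL Lneg Lpos
        + prim Lneg Lpos (potL Lneg Lpos q hq (ν, z) u + f)) := by
    intro c
    have : c • dirSol Lneg Lpos q hq (ν, z) + cauchyL Lneg Lpos q hq (ν, z) f
        = volterraInv Lneg Lpos q hq (ν, z) (c • prim Lneg Lpos (oneL Lneg Lpos)
          + prim Lneg Lpos (prim Lneg Lpos f)) := by
      rw [map_add, map_smul]; rfl
    rw [this, volterraInv_eq_iff, volterra, sub_apply, sub_eq_iff_eq_add]
    simp only [one_apply_eq_self, mul_apply_eq, map_add, map_smul]
    rw [add_assoc, add_comm (prim Lneg Lpos (prim Lneg Lpos f))]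
  have e2 : ∀ c : ℂ, u = c • dirSol Lneg Lpos q hq (ν, z) + cauchyL Lneg Lpos q hq (ν, z) f →
      meanL Lneg Lpos (c • oneL Lneg Lpos + prim Lneg Lpos (potL Lneg Lpos q hq (ν, z) u + f))
      = c * dirDet Lneg Lpos q hq (ν, z) + cauchyEnd Lneg Lpos q hq (ν, z) f := by
    rintro c rfl
    simp only [dirDet, cauchyEnd, map_add, map_smul, ContinuousLinearMap.comp_apply, add_apply,
      mul_apply_eq, one_apply_eq_self, smul_eq_mul]
    ring
  constructor
  · rintro ⟨w, c, h1, h2, rfl⟩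
    have h3 := (e1 c).2 h1
    exact ⟨c, h3, (e2 c h3) ▸ h2⟩
  · rintro ⟨c, h1, h2⟩
    exact ⟨_, c, (e1 c).1 h1, (e2 c h1).trans h2, rfl⟩

theorem apply_eq_iff_mem_graph {ν : ℂ} {u g : L2I Lneg Lpos} :
    (∃ hd : u ∈ (schrodinger Lneg Lpos q ν).domain, schrodinger Lneg Lpos q ν ⟨u, hd⟩ = g) ↔
      (u, g) ∈ schrodingerGraph Lneg Lpos q ν := by
  rw [← schrodinger_graph, LinearPMap.mem_graph_iff]
  constructor
  · rintro ⟨hd, h⟩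
    exact ⟨⟨u, hd⟩, rfl, h⟩
  · rintro ⟨⟨v, hv⟩, rfl, h⟩
    exact ⟨hv, h⟩

theorem dirSol_ne_zero (h0 : -Lneg < Lpos) (hq : Continuous q) (p : ℂ × ℂ) :
    dirSol Lneg Lpos q hq p ≠ 0 := by
  intro h
  have h1 := (volterraInv_eq_iff hq p).1 h.symm
  rw [map_zero] at h1
  have h2 := hasWeakDeriv_prim h0 (oneL Lneg Lpos)
  rw [← h1] at h2
  have h3 := norm_sq_ofCont (Lneg := Lneg) (Lpos := Lpos) (f := fun _ => (1 : ℂ)) continuous_const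
  have h4 : oneL Lneg Lpos = 0 := h2.eq_zero
  rw [oneL] at h4
  rw [h4] at h3
  simp at h3
  linarith

theorem mem_graph_zero_iff (h0 : -Lneg < Lpos) (hq : Continuous q) {ν z : ℂ}
    {u : L2I Lneg Lpos} :
    (u, z • u) ∈ schrodingerGraph Lneg Lpos q ν ↔
      ∃ c : ℂ, u = c • dirSol Lneg Lpos q hq (ν, z) ∧ c * dirDet Lneg Lpos q hq (ν, z) = 0 := by
  have := mem_graph_iff_dirSol h0 hq (ν := ν) (z := z) (u := u) (f := 0)
  simpa only [sub_zero, map_zero, add_zero] using this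

theorem dirSol_mem_graph (h0 : -Lneg < Lpos) (hq : Continuous q) {ν z : ℂ}
    (hD : dirDet Lneg Lpos q hq (ν, z) = 0) :
    (dirSol Lneg Lpos q hq (ν, z), z • dirSol Lneg Lpos q hq (ν, z))
      ∈ schrodingerGraph Lneg Lpos q ν :=
  (mem_graph_zero_iff h0 hq).2 ⟨1, (one_smul _ _).symm, by rw [hD, mul_zero]⟩

theorem isEigenvalue_iff (h0 : -Lneg < Lpos) (hq : Continuous q) {ν z : ℂ} :
    IsEigenvalue (schrodinger Lneg Lpos q ν) z ↔ dirDet Lneg Lpos q hq (ν, z) = 0 := by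
  constructor
  · rintro ⟨⟨u, hd⟩, hu, h⟩
    obtain ⟨c, hc, hc'⟩ := (mem_graph_zero_iff h0 hq).1 (apply_eq_iff_mem_graph.1 ⟨hd, h⟩)
    refine (mul_eq_zero.1 hc').resolve_left ?_
    rintro rfl
    exact hu (hc.trans (zero_smul _ _))
  · intro hD
    obtain ⟨hd, h⟩ := apply_eq_iff_mem_graph.2 (dirSol_mem_graph h0 hq hD)
    exact ⟨⟨_, hd⟩, dirSol_ne_zero h0 hq _, h⟩

/-- A nonzero determinant fixes the slope, `c = -cauchyEnd f / dirDet`, which gives the resolvent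
explicitly as a rank-one correction of `cauchyL`. -/
theorem mem_resolventSet_of_dirDet_ne_zero (h0 : -Lneg < Lpos) (hq : Continuous q) {ν z : ℂ}
    (hD : dirDet Lneg Lpos q hq (ν, z) ≠ 0) : z ∈ resolventSet (schrodinger Lneg Lpos q ν) := by
  refine ⟨cauchyL Lneg Lpos q hq (ν, z) - (dirDet Lneg Lpos q hq (ν, z))⁻¹ •
    (cauchyEnd Lneg Lpos q hq (ν, z)).smulRight (dirSol Lneg Lpos q hq (ν, z)), ?_, ?_⟩
  · intro f
    set u := (cauchyL Lneg Lpos q hq (ν, z) - (dirDet Lneg Lpos q hq (ν, z))⁻¹ •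
      (cauchyEnd Lneg Lpos q hq (ν, z)).smulRight (dirSol Lneg Lpos q hq (ν, z))) f with hu
    have hmem : (u, z • u - f) ∈ schrodingerGraph Lneg Lpos q ν := by
      refine (mem_graph_iff_dirSol h0 hq).2
        ⟨-(dirDet Lneg Lpos q hq (ν, z))⁻¹ * cauchyEnd Lneg Lpos q hq (ν, z) f, ?_, ?_⟩
      · rw [hu]
        simp only [sub_apply, smul_apply, ContinuousLinearMap.smulRight_apply]
        module
      · field_simp
        ring
    obtain ⟨hd, h⟩ := apply_eq_iff_mem_graph.2 hmem
    exact ⟨hd, by rw [h]; abel⟩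
  · rintro ⟨u, hd⟩
    set g := schrodinger Lneg Lpos q ν ⟨u, hd⟩ with hg
    have hmem : (u, z • u - (z • u - g)) ∈ schrodingerGraph Lneg Lpos q ν := by
      rw [sub_sub_cancel]
      exact apply_eq_iff_mem_graph.1 ⟨hd, hg.symm⟩
    obtain ⟨c, hc, hc'⟩ := (mem_graph_iff_dirSol h0 hq).1 hmem
    have hc'' : c = -(dirDet Lneg Lpos q hq (ν, z))⁻¹
        * cauchyEnd Lneg Lpos q hq (ν, z) (z • u - g) := by
      field_simp
      linear_combination hc'
    show _ = u
    conv_rhs => rw [hc, hc'']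
    simp only [sub_apply, smul_apply, ContinuousLinearMap.smulRight_apply]
    module

theorem exists_bil_ne_zero {y : L2I Lneg Lpos} (hy : y ≠ 0) : ∃ f, bil Lneg Lpos f y ≠ 0 := by
  refine ⟨star y, fun h => hy ?_⟩
  have h2 : inner ℂ y y = bil Lneg Lpos (star y) y := by
    rw [bil_apply, L2.inner_def]
    refine integral_congr_ae ?_
    filter_upwards [Lp.coeFn_star y] with x hx
    rw [hx, RCLike.inner_apply, mul_comm, Pi.star_apply]
    rfl
  rw [h] at h2
  exact inner_self_eq_zero.1 h2

/-- The Fredholm alternative for `z - P_ν` at an eigenvalue. -/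
theorem cauchyL_mem_graph (h0 : -Lneg < Lpos) (hq : Continuous q) {ν z : ℂ}
    (hD : dirDet Lneg Lpos q hq (ν, z) = 0) {f : L2I Lneg Lpos}
    (hf : bil Lneg Lpos f (dirSol Lneg Lpos q hq (ν, z)) = 0) :
    (cauchyL Lneg Lpos q hq (ν, z) f, z • cauchyL Lneg Lpos q hq (ν, z) f - f)
      ∈ schrodingerGraph Lneg Lpos q ν := by
  set y := dirSol Lneg Lpos q hq (ν, z) with hy
  set ρ := cauchyEnd Lneg Lpos q hq (ν, z) with hρ
  have hmem : ∀ f, ρ f = 0 → (cauchyL Lneg Lpos q hq (ν, z) f,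
      z • cauchyL Lneg Lpos q hq (ν, z) f - f) ∈ schrodingerGraph Lneg Lpos q ν := fun f h =>
    (mem_graph_iff_dirSol h0 hq).2 ⟨0, by simp, by simpa using h⟩
  -- Symmetry puts the kernel of `ρ` inside the kernel of `f ↦ bil f y`. Both functionals are
  -- nonzero, so the two hyperplanes coincide.
  have hker : ∀ f, ρ f = 0 → bil Lneg Lpos f y = 0 := by
    intro f h
    have := bil_symm_of_mem_graph h0 hq (hmem f h) (dirSol_mem_graph h0 hq hD)
    rw [map_sub, map_smul, map_smul, sub_apply, smul_apply] at this
    linear_combination -this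
  obtain ⟨f₀, hf₀⟩ := exists_bil_ne_zero (dirSol_ne_zero h0 hq (ν, z))
  have hρ₀ : ρ f₀ ≠ 0 := fun h => hf₀ (hker f₀ h)
  refine hmem f ?_
  have h1 := hker (f - (ρ f / ρ f₀) • f₀) (by
    rw [map_sub, map_smul, smul_eq_mul]; field_simp; ring)
  rw [map_sub, map_smul, sub_apply, smul_apply, hf, zero_sub, neg_eq_zero, smul_eq_mul] at h1
  have h2 := (mul_eq_zero.1 h1).resolve_right hf₀
  exact (div_eq_zero_iff.1 h2).resolve_right hρ₀

/-- If `w ≠ z` is also an eigenvalue, symmetry makes the two eigenfunctions orthogonal for `bil`. By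
continuity in `w` the pairing stays nonzero near `z`, so no analyticity of `dirDet` is needed. -/
theorem exists_isIsolatingRadius (h0 : -Lneg < Lpos) (hq : Continuous q) {ν z : ℂ}
    (hD : dirDet Lneg Lpos q hq (ν, z) = 0)
    (hB : bil Lneg Lpos (dirSol Lneg Lpos q hq (ν, z)) (dirSol Lneg Lpos q hq (ν, z)) ≠ 0) :
    ∃ r, IsIsolatingRadius (schrodinger Lneg Lpos q ν) z r := by
  have hc : Continuous fun w => bil Lneg Lpos (dirSol Lneg Lpos q hq (ν, w))
      (dirSol Lneg Lpos q hq (ν, z)) := by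
    have := continuous_dirSol (Lneg := Lneg) (Lpos := Lpos) hq
    fun_prop
  have hev := hc.continuousAt.eventually_ne (x := z) hB
  obtain ⟨r, hr, hr'⟩ := Metric.nhds_basis_closedBall.eventually_iff.1 hev
  refine ⟨r, hr, fun w hw hne => mem_resolventSet_of_dirDet_ne_zero h0 hq fun hDw => ?_⟩
  have := bil_symm_of_mem_graph h0 hq (dirSol_mem_graph h0 hq hDw) (dirSol_mem_graph h0 hq hD)
  rw [map_smul, map_smul, smul_apply, smul_eq_mul, smul_eq_mul, ← sub_eq_zero, ← sub_mul] at this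
  exact (mul_ne_zero (sub_ne_zero.2 hne) (hr' hw)) this

/-- The spectral projection at a nondegenerate eigenvalue. -/
theorem spectralProjection_eq (h0 : -Lneg < Lpos) (hq : Continuous q) {ν z : ℂ}
    (hD : dirDet Lneg Lpos q hq (ν, z) = 0)
    (hB : bil Lneg Lpos (dirSol Lneg Lpos q hq (ν, z)) (dirSol Lneg Lpos q hq (ν, z)) ≠ 0)
    (f : L2I Lneg Lpos) :
    spectralProjection (schrodinger Lneg Lpos q ν) z f
      = ((bil Lneg Lpos (dirSol Lneg Lpos q hq (ν, z)) (dirSol Lneg Lpos q hq (ν, z)))⁻¹ •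
          bil Lneg Lpos (dirSol Lneg Lpos q hq (ν, z))) f • dirSol Lneg Lpos q hq (ν, z) := by
  set y := dirSol Lneg Lpos q hq (ν, z) with hy
  obtain ⟨r, hr⟩ := exists_isIsolatingRadius h0 hq hD hB
  have hyg := dirSol_mem_graph h0 hq hD
  obtain ⟨hd, hAy⟩ := apply_eq_iff_mem_graph.2 hyg
  refine spectralProjection_eq_of_splitting hr ⟨y, hd⟩ hAy _ ?_ ?_
    (cauchyL Lneg Lpos q hq (ν, z)) ?_ ?_ f
  · rw [smul_apply, smul_eq_mul, inv_mul_cancel₀ hB]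
  · rintro ⟨u, hu⟩
    have := bil_symm_of_mem_graph h0 hq hyg (apply_eq_iff_mem_graph.1 ⟨hu, rfl⟩)
    rw [map_smul, smul_apply, smul_eq_mul] at this
    simp only [smul_apply, smul_eq_mul]
    rw [← this]
    ring
  · intro f hf
    rw [smul_apply, smul_eq_mul] at hf
    have hf' := (mul_eq_zero.1 hf).resolve_left (inv_ne_zero hB)
    rw [bil_comm] at hf'
    obtain ⟨hd, h⟩ := apply_eq_iff_mem_graph.2 (cauchyL_mem_graph h0 hq hD hf')
    exact ⟨hd, by rw [h]; abel⟩
  · rintro ⟨u, hu⟩ h hl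
    obtain ⟨c, rfl, -⟩ := (mem_graph_zero_iff h0 hq).1 (apply_eq_iff_mem_graph.1 ⟨hu, h⟩)
    simp only [map_smul, smul_apply, smul_eq_mul] at hl ⊢
    rw [← hy, inv_mul_cancel₀ hB, mul_one] at hl
    rw [hl, zero_smul]

/-- An eigenvalue of `P_ν` is algebraically simple if and only if the eigenfunction is not
isotropic for the bilinear pairing. -/
theorem isAlgSimple_iff (h0 : -Lneg < Lpos) (hq : Continuous q) {ν z : ℂ}
    (hD : dirDet Lneg Lpos q hq (ν, z) = 0) :
    IsAlgSimple (schrodinger Lneg Lpos q ν) z ↔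
      bil Lneg Lpos (dirSol Lneg Lpos q hq (ν, z)) (dirSol Lneg Lpos q hq (ν, z)) ≠ 0 := by
  constructor
  · intro h hB
    obtain ⟨hd, hAy⟩ := apply_eq_iff_mem_graph.2 (dirSol_mem_graph h0 hq hD)
    -- If `y` is isotropic, the Fredholm alternative applies to `f = y` and solves `(z - P_ν) u =
    -- y`; then `-u` is a generalized eigenvector of order two.
    obtain ⟨hd', hAw⟩ := apply_eq_iff_mem_graph.2 (cauchyL_mem_graph h0 hq hD hB)
    refine h.not_generalized ⟨_, hd⟩ (-⟨_, hd'⟩) hAy (dirSol_ne_zero h0 hq _) ?_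
    rw [LinearPMap.map_neg, hAw]
    simp only [Submodule.coe_neg]
    module
  · intro hB
    refine isAlgSimple_of_spectralProjection_eq (dirSol_ne_zero h0 hq (ν, z)) _ ?_
      (spectralProjection_eq h0 hq hD hB)
    rw [smul_apply, smul_eq_mul, inv_mul_cancel₀ hB]

end Dirichlet

/-! ### Classical solutions -/

section Classical

variable {Lneg Lpos : ℝ} {q : ℝ → ℝ}

/-- `u` is of class `C²` with derivatives `u₁`, `u₂` and vanishes at the end points of `I`. -/
structure IsDirichletC2 (Lneg Lpos : ℝ) (u u₁ u₂ : ℝ → ℂ) : Prop where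
  hasDerivAt : ∀ x, HasDerivAt u (u₁ x) x
  hasDerivAt' : ∀ x, HasDerivAt u₁ (u₂ x) x
  cont : Continuous u₂
  left : u (-Lneg) = 0
  right : u Lpos = 0

theorem continuous_of_hasDerivAt {u u₁ : ℝ → ℂ} (h : ∀ x, HasDerivAt u (u₁ x) x) :
    Continuous u :=
  continuous_iff_continuousAt.2 fun x => (h x).continuousAt

theorem IsDirichletC2.continuous {u u₁ u₂ : ℝ → ℂ} (h : IsDirichletC2 Lneg Lpos u u₁ u₂) :
    Continuous u :=
  continuous_of_hasDerivAt h.hasDerivAt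

theorem IsDirichletC2.continuous' {u u₁ u₂ : ℝ → ℂ} (h : IsDirichletC2 Lneg Lpos u u₁ u₂) :
    Continuous u₁ :=
  continuous_of_hasDerivAt h.hasDerivAt'

/-- Solutions of `(z - P_ν) u = f` with `f` continuous are classical. -/
theorem exists_classical (h0 : -Lneg < Lpos) (hq : Continuous q) {ν z : ℂ} {u : L2I Lneg Lpos}
    {f : ℝ → ℂ} (hf : Continuous f)
    (hu : (u, z • u - ofCont Lneg Lpos f hf) ∈ schrodingerGraph Lneg Lpos q ν) :
    ∃ U U₁ U₂ : ℝ → ℂ, ∃ h : IsDirichletC2 Lneg Lpos U U₁ U₂,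
      u = ofCont Lneg Lpos U h.continuous ∧
      ∀ x ∈ Icc (-Lneg) Lpos, U₂ x = (ν ^ 2 * (q x : ℂ) ^ 2 - z) * U x + f x := by
  obtain ⟨w, c, h1, h2, h3⟩ := (mem_schrodingerGraph_iff h0 hq).1 hu
  have hc0 := continuous_primFun w
  set H : ℝ → ℂ := fun x => (ν ^ 2 * (q x : ℂ) ^ 2 - z) * primFun w x + f x with hH
  have hHc : Continuous H := by fun_prop
  have e1 : ν ^ 2 • qsq Lneg Lpos q hq u - (z • u - ofCont Lneg Lpos f hf)
      = ofCont Lneg Lpos H hHc := by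
    rw [ofCont_eq_iff]
    filter_upwards [Lp.coeFn_sub (ν ^ 2 • qsq Lneg Lpos q hq u) (z • u - ofCont Lneg Lpos f hf),
      Lp.coeFn_sub (z • u) (ofCont Lneg Lpos f hf), Lp.coeFn_smul (ν ^ 2) (qsq Lneg Lpos q hq u),
      Lp.coeFn_smul z u, coeFn_mulL (m := fun x => (q x : ℂ) ^ 2) (by fun_prop) u,
      coeFn_ofCont hf, h1 ▸ coeFn_prim w] with x a1 a2 a3 a4 a5 a6 a7
    rw [a1, Pi.sub_apply, a2, Pi.sub_apply, a3, a4, Pi.smul_apply, Pi.smul_apply, qsq, a5, a6, a7]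
    simp only [hH, smul_eq_mul]
    ring
  rw [e1, prim_ofCont] at h3
  set W : ℝ → ℂ := fun x => c + ∫ s in (-Lneg)..x, H s with hW
  have hWd : ∀ x, HasDerivAt W (H x) x := fun x => (hasDerivAt_primitive hHc _ x).const_add c
  have hWc : Continuous W := continuous_of_hasDerivAt hWd
  have h4 : w = ofCont Lneg Lpos W hWc := by
    rw [h3, ← ofCont_smul, ← ofCont_add]
    exact ofCont_congr fun x _ => by simp [hW]
  have hU : ∀ x ∈ Icc (-Lneg) Lpos, primFun w x = ∫ s in (-Lneg)..x, W s := fun x hx =>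
    primFun_eq_of_ae (ofCont_eq_iff.1 h4) hx
  refine ⟨fun x => ∫ s in (-Lneg)..x, W s, W, H,
    ⟨fun x => hasDerivAt_primitive hWc _ x, hWd, hHc, by simp, ?_⟩, ?_, ?_⟩
  · rw [h4, meanL, bil_ofCont, setIntegral_Ioo_eq_intervalIntegral h0.le] at h2
    simpa using h2
  · rw [h1]
    exact (congrArg _ h4).trans (prim_ofCont _)
  · intro x hx
    simp only [hH, hU x hx]

/-- Classical functions vanishing at the end points belong to the domain of `P_ν`. -/
theorem IsDirichletC2.mem_graph {u u₁ u₂ : ℝ → ℂ} (h : IsDirichletC2 Lneg Lpos u u₁ u₂)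
    (h0 : -Lneg < Lpos) (hq : Continuous q) (ν : ℂ) :
    (ofCont Lneg Lpos u h.continuous, ofCont Lneg Lpos
      (fun x => -u₂ x + ν ^ 2 * (q x : ℂ) ^ 2 * u x)
      (by have := h.continuous; have := h.cont; fun_prop)) ∈ schrodingerGraph Lneg Lpos q ν := by
  have hc := h.continuous
  have hc' := h.continuous'
  have hc'' := h.cont
  refine (mem_schrodingerGraph_iff h0 hq).2
    ⟨ofCont Lneg Lpos u₁ hc', u₁ (-Lneg), ?_, ?_, ?_⟩
  · rw [prim_ofCont]
    refine ofCont_congr fun x _ => ?_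
    rw [intervalIntegral.integral_eq_sub_of_hasDerivAt (fun x _ => h.hasDerivAt x)
      (hc'.intervalIntegrable _ _), h.left, sub_zero]
  · rw [meanL, bil_ofCont, setIntegral_Ioo_eq_intervalIntegral h0.le]
    simp only [one_mul]
    rw [intervalIntegral.integral_eq_sub_of_hasDerivAt (fun x _ => h.hasDerivAt x)
      (hc'.intervalIntegrable _ _), h.left, h.right, sub_zero]
  · have e : ν ^ 2 • qsq Lneg Lpos q hq (ofCont Lneg Lpos u hc)
        - ofCont Lneg Lpos (fun x => -u₂ x + ν ^ 2 * (q x : ℂ) ^ 2 * u x) (by fun_prop)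
        = ofCont Lneg Lpos u₂ hc'' := by
      rw [sub_eq_iff_eq_add, qsq, mulL_ofCont, ← ofCont_smul, ← ofCont_add]
      exact ofCont_congr fun x _ => by ring
    rw [e, prim_ofCont, ← ofCont_smul, ← ofCont_add]
    refine ofCont_congr fun x _ => ?_
    rw [intervalIntegral.integral_eq_sub_of_hasDerivAt (fun x _ => h.hasDerivAt' x)
      (hc''.intervalIntegrable _ _)]
    ring

end Classical

/-! ### The potential -/

section Potential

/-- The standing assumptions on the potential, for a function that is `C²` on the whole line, with
derivatives `q₁` and `q₂`. -/
structure IsPotential (Lneg Lpos : ℝ) (q q₁ q₂ : ℝ → ℝ) : Prop where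
  Lneg_pos : 0 < Lneg
  Lpos_pos : 0 < Lpos
  hasDerivAt : ∀ x, HasDerivAt q (q₁ x) x
  hasDerivAt' : ∀ x, HasDerivAt q₁ (q₂ x) x
  cont : Continuous q₂
  zero : q 0 = 0
  deriv_pos : 0 < q₁ 0
  ne_zero : ∀ x ∈ Icc (-Lneg) Lpos, x ≠ 0 → q x ≠ 0

/-- The second derivative is extended by constants and integrated twice. The analysis can then use
two-sided derivatives at every point of the line. -/
theorem exists_C2_extension {a b : ℝ} (hab : a < b) {q : ℝ → ℝ} (hq : ContDiffOn ℝ 2 q (Icc a b)) :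
    ∃ Q Q₁ Q₂ : ℝ → ℝ, (∀ x, HasDerivAt Q (Q₁ x) x) ∧ (∀ x, HasDerivAt Q₁ (Q₂ x) x) ∧
      Continuous Q₂ ∧ ∀ x ∈ Icc a b, Q x = q x := by
  have hu := uniqueDiffOn_Icc hab
  have h1 : ContDiffOn ℝ 1 (derivWithin q (Icc a b)) (Icc a b) :=
    hq.derivWithin hu (by norm_num)
  have h2 : ContDiffOn ℝ 0 (derivWithin (derivWithin q (Icc a b)) (Icc a b)) (Icc a b) :=
    h1.derivWithin hu (by norm_num)
  set g := derivWithin (derivWithin q (Icc a b)) (Icc a b) with hg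
  set Q₂ : ℝ → ℝ := IccExtend hab.le ((Icc a b).domRestrict g) with hQ₂
  have hQ₂c : Continuous Q₂ := (continuousOn_iff_continuous_domRestrict.1 h2.continuousOn).Icc_extend'
  have hQ₂e : ∀ x ∈ Icc a b, Q₂ x = g x := fun x hx => by
    rw [hQ₂, IccExtend_of_mem _ _ hx]; rfl
  have hprim : ∀ {f : ℝ → ℝ}, Continuous f → ∀ c x,
      HasDerivAt (fun x => c + ∫ s in a..x, f s) (f x) x := fun hf c x =>
    (intervalIntegral.integral_hasDerivAt_right (hf.intervalIntegrable _ _)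
      hf.stronglyMeasurable.stronglyMeasurableAtFilter hf.continuousAt).const_add c
  have hftc : ∀ {f F : ℝ → ℝ}, ContDiffOn ℝ 1 F (Icc a b) →
      (∀ x ∈ Icc a b, f x = derivWithin F (Icc a b) x) → Continuous f →
      ∀ x ∈ Icc a b, F a + ∫ s in a..x, f s = F x := by
    intro f F hF hf hfc x hx
    have : ∫ s in a..x, f s = F x - F a := by
      refine intervalIntegral.integral_eq_sub_of_hasDerivAt_of_le hx.1
        (hF.continuousOn.mono (Icc_subset_Icc_right hx.2)) (fun y hy => ?_)
        (hfc.intervalIntegrable _ _)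
      have hy' : y ∈ Ioo a b := ⟨hy.1, hy.2.trans_le hx.2⟩
      rw [hf y (Ioo_subset_Icc_self hy')]
      exact ((hF.differentiableOn one_ne_zero y
        (Ioo_subset_Icc_self hy')).hasDerivWithinAt).hasDerivAt (Icc_mem_nhds hy'.1 hy'.2)
    linarith
  set Q₁ : ℝ → ℝ := fun x => derivWithin q (Icc a b) a + ∫ s in a..x, Q₂ s with hQ₁
  have hQ₁d : ∀ x, HasDerivAt Q₁ (Q₂ x) x := hprim hQ₂c _
  have hQ₁c : Continuous Q₁ := continuous_iff_continuousAt.2 fun x => (hQ₁d x).continuousAt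
  have hQ₁e : ∀ x ∈ Icc a b, Q₁ x = derivWithin q (Icc a b) x := hftc h1 hQ₂e hQ₂c
  exact ⟨fun x => q a + ∫ s in a..x, Q₁ s, Q₁, Q₂, hprim hQ₁c _, hQ₁d, hQ₂c,
    hftc (hq.of_le (by norm_num)) hQ₁e hQ₁c⟩

namespace IsPotential

variable {Lneg Lpos : ℝ} {q q₁ q₂ : ℝ → ℝ}

theorem neg_lt (h : IsPotential Lneg Lpos q q₁ q₂) : -Lneg < Lpos := by
  linarith [h.Lneg_pos, h.Lpos_pos]

theorem continuous (h : IsPotential Lneg Lpos q q₁ q₂) : Continuous q :=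
  continuous_iff_continuousAt.2 fun x => (h.hasDerivAt x).continuousAt

theorem continuous' (h : IsPotential Lneg Lpos q q₁ q₂) : Continuous q₁ :=
  continuous_iff_continuousAt.2 fun x => (h.hasDerivAt' x).continuousAt

theorem zero_mem (h : IsPotential Lneg Lpos q q₁ q₂) : (0 : ℝ) ∈ Icc (-Lneg) Lpos :=
  ⟨by linarith [h.Lneg_pos], h.Lpos_pos.le⟩

theorem hasDerivAt_agmon (h : IsPotential Lneg Lpos q q₁ q₂) (x : ℝ) :
    HasDerivAt (agmon q) (q x) x :=
  intervalIntegral.integral_hasDerivAt_right (h.continuous.intervalIntegrable _ _)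
    h.continuous.stronglyMeasurable.stronglyMeasurableAtFilter h.continuous.continuousAt

theorem continuous_agmon (h : IsPotential Lneg Lpos q q₁ q₂) : Continuous (agmon q) :=
  continuous_iff_continuousAt.2 fun x => (h.hasDerivAt_agmon x).continuousAt

/-- `q` has a positive lower bound by `|x|`, with the sign of `x`. -/
theorem exists_lower (h : IsPotential Lneg Lpos q q₁ q₂) :
    ∃ m, 0 < m ∧ m ≤ q₁ 0 ∧ ∀ x ∈ Icc (-Lneg) Lpos, m * x ^ 2 ≤ x * q x := by
  -- `dslope q 0` is `q x / x`, with value `q'(0)` at `0`. It is continuous without zeros on the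
  -- interval, so it is positive and attains a positive minimum.
  have hc : Continuous (dslope q 0) := by
    rw [← continuousOn_univ, continuousOn_dslope Filter.univ_mem]
    exact ⟨h.continuous.continuousOn, (h.hasDerivAt 0).differentiableAt⟩
  have h0 : dslope q 0 0 = q₁ 0 := by rw [dslope_same, (h.hasDerivAt 0).deriv]
  have hx : ∀ x, x * dslope q 0 x = q x := fun x => by
    have := sub_smul_dslope q 0 x
    simpa [h.zero] using this
  have hne : ∀ x ∈ Icc (-Lneg) Lpos, dslope q 0 x ≠ 0 := by
    intro x hxI h1
    rcases eq_or_ne x 0 with rfl | hx0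
    · rw [h0] at h1
      exact h.deriv_pos.ne' h1
    · refine h.ne_zero x hxI hx0 ?_
      rw [← hx, h1, mul_zero]
  have hpos : ∀ x ∈ Icc (-Lneg) Lpos, 0 < dslope q 0 x := by
    intro x hxI
    by_contra hcon
    rw [not_lt] at hcon
    obtain ⟨y, hy, hy'⟩ := isPreconnected_Icc.intermediate_value hxI h.zero_mem
      hc.continuousOn ⟨hcon, (h0 ▸ h.deriv_pos.le : (0 : ℝ) ≤ dslope q 0 0)⟩
    exact hne y hy hy'
  obtain ⟨x₀, hx₀, hmin⟩ := isCompact_Icc.exists_isMinOn ⟨0, h.zero_mem⟩ hc.continuousOn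
  refine ⟨dslope q 0 x₀, hpos x₀ hx₀, h0 ▸ hmin h.zero_mem, fun x hxI => ?_⟩
  rw [← hx x]
  have : dslope q 0 x₀ ≤ dslope q 0 x := hmin hxI
  nlinarith [sq_nonneg x]

/-- Mean value estimates at `0`, from bounds on `q₁` and `q₂`. The cubic error in `agmon` is what
makes `e^{-2νδ}` close to a Gaussian. -/
theorem exists_upper (h : IsPotential Lneg Lpos q q₁ q₂) :
    ∃ M, 1 ≤ M ∧ ∀ x ∈ Icc (-Lneg) Lpos, |x| ≤ M ∧ |q₁ x| ≤ M ∧ |q₂ x| ≤ M ∧ |q x| ≤ M * |x| ∧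
      |q₁ x - q₁ 0| ≤ M * |x| ∧ |agmon q x - q₁ 0 * x ^ 2 / 2| ≤ M * |x| ^ 3 ∧
      |agmon q x| ≤ M * x ^ 2 := by
  obtain ⟨M₁, hM₁⟩ := isCompact_Icc.exists_bound_of_continuousOn (s := Icc (-Lneg) Lpos)
    h.continuous'.continuousOn
  obtain ⟨M₂, hM₂⟩ := isCompact_Icc.exists_bound_of_continuousOn (s := Icc (-Lneg) Lpos)
    h.cont.continuousOn
  set M := max (max M₁ M₂) (max 1 (max Lneg Lpos)) with hM
  have hM1 : 1 ≤ M := (le_max_left _ _).trans (le_max_right _ _)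
  have b1 : ∀ x ∈ Icc (-Lneg) Lpos, |q₁ x| ≤ M := fun x hx =>
    (hM₁ x hx).trans ((le_max_left _ _).trans (le_max_left _ _))
  have b2 : ∀ x ∈ Icc (-Lneg) Lpos, |q₂ x| ≤ M := fun x hx =>
    (hM₂ x hx).trans ((le_max_right _ _).trans (le_max_left _ _))
  have mvt : ∀ {f f' : ℝ → ℝ} {C x : ℝ}, (∀ y, HasDerivAt f (f' y) y) → x ∈ Icc (-Lneg) Lpos →
      (∀ y ∈ Icc (-Lneg) Lpos, |y| ≤ |x| → |f' y| ≤ C) → |f x - f 0| ≤ C * |x| := by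
    intro f f' C x hf hx hb
    have := Convex.norm_image_sub_le_of_norm_hasDerivWithin_le (f := f) (f' := f') (C := C)
      (s := uIcc 0 x) (x := 0) (y := x) (fun y _ => (hf y).hasDerivWithinAt) (fun y hy => ?_)
      (convex_uIcc _ _) left_mem_uIcc right_mem_uIcc
    · simpa using this
    · refine hb y (uIcc_subset_Icc h.zero_mem hx hy) ?_
      rw [mem_uIcc] at hy
      rcases hy with hy | hy
      · rw [abs_of_nonneg hy.1, abs_of_nonneg (hy.1.trans hy.2)]; exact hy.2
      · rw [abs_of_nonpos hy.2, abs_of_nonpos (hy.1.trans hy.2)]; linarith [hy.1]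
  have c1 : ∀ x ∈ Icc (-Lneg) Lpos, |q x| ≤ M * |x| := fun x hx => by
    have := mvt h.hasDerivAt hx fun y hy _ => b1 y hy
    simpa [h.zero] using this
  have c2 : ∀ x ∈ Icc (-Lneg) Lpos, |q₁ x - q₁ 0| ≤ M * |x| := fun x hx =>
    mvt h.hasDerivAt' hx fun y hy _ => b2 y hy
  have c3 : ∀ x ∈ Icc (-Lneg) Lpos, |q x - q₁ 0 * x| ≤ M * |x| * |x| := fun x hx => by
    have hd : ∀ y, HasDerivAt (fun y => q y - q₁ 0 * y) (q₁ y - q₁ 0) y := fun y => by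
      exact ((h.hasDerivAt y).sub ((hasDerivAt_id y).const_mul (q₁ 0))).congr_deriv (by rw [mul_one])
    have := mvt (C := M * |x|) hd hx fun y hy hyx => (c2 y hy).trans (by gcongr)
    simpa [h.zero] using this
  have ha0 : agmon q 0 = 0 := by simp [agmon]
  refine ⟨M, hM1, fun x hx => ⟨?_, b1 x hx, b2 x hx, c1 x hx, c2 x hx, ?_, ?_⟩⟩
  · have h1 : Lneg ≤ M := (le_max_left _ _).trans ((le_max_right 1 _).trans (le_max_right _ _))
    have h2 : Lpos ≤ M := (le_max_right _ _).trans ((le_max_right 1 _).trans (le_max_right _ _))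
    exact abs_le.2 ⟨by linarith [hx.1], by linarith [hx.2]⟩
  · have hd : ∀ y, HasDerivAt (fun y => agmon q y - q₁ 0 * y ^ 2 / 2) (q y - q₁ 0 * y) y := by
      intro y
      have h2 : HasDerivAt (fun y : ℝ => q₁ 0 * y ^ 2 / 2) (q₁ 0 * y) y := by
        exact (((hasDerivAt_pow 2 y).const_mul (q₁ 0)).div_const 2).congr_deriv (by
          push_cast
          ring)
      exact (h.hasDerivAt_agmon y).sub h2
    have := mvt (C := M * |x| * |x|) hd hx fun y hy hyx => (c3 y hy).trans (by gcongr)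
    rw [ha0] at this
    simp only [ne_eq, OfNat.ofNat_ne_zero, not_false_eq_true, zero_pow, mul_zero, zero_div,
      sub_zero] at this
    calc _ ≤ _ := this
      _ = M * |x| ^ 3 := by ring
  · have := mvt (C := M * |x|) h.hasDerivAt_agmon hx fun y hy hyx => (c1 y hy).trans (by gcongr)
    rw [ha0, sub_zero, mul_assoc, ← sq, sq_abs] at this
    exact this

/-- Differentiating along `t ↦ t x` treats both signs of `x` at once: the derivative of the
difference is `x (q (t x) - m t x) ≥ 0`. -/
theorem agmon_lower (h : IsPotential Lneg Lpos q q₁ q₂) {m : ℝ}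
    (hm : ∀ x ∈ Icc (-Lneg) Lpos, m * x ^ 2 ≤ x * q x) {x : ℝ} (hx : x ∈ Icc (-Lneg) Lpos) :
    m * x ^ 2 / 2 ≤ agmon q x := by
  have hd : ∀ t : ℝ, HasDerivAt (fun t => agmon q (t * x) - m * (t * x) ^ 2 / 2)
      (x * (q (t * x) - m * (t * x))) t := by
    intro t
    have h1 : HasDerivAt (fun t : ℝ => t * x) x t := by
      simpa using (hasDerivAt_id t).mul_const x
    have h2 := (h.hasDerivAt_agmon (t * x)).comp t h1
    have h3 := ((h1.pow 2).const_mul m).div_const 2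
    exact (h2.sub h3).congr_deriv (by push_cast; ring)
  have hmono : MonotoneOn (fun t => agmon q (t * x) - m * (t * x) ^ 2 / 2) (Icc (0 : ℝ) 1) := by
    refine monotoneOn_of_deriv_nonneg (convex_Icc _ _)
      (fun t _ => (hd t).continuousAt.continuousWithinAt)
      (fun t _ => (hd t).differentiableAt.differentiableWithinAt) fun t ht => ?_
    rw [interior_Icc] at ht
    rw [(hd t).deriv]
    have htx : t * x ∈ Icc (-Lneg) Lpos := by
      constructor
      · nlinarith [hx.1, ht.1, ht.2, h.Lneg_pos]
      · nlinarith [hx.2, ht.1, ht.2, h.Lpos_pos]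
    have := hm _ htx
    have h2 : 0 ≤ t * (x * (q (t * x) - m * (t * x))) := by nlinarith
    exact nonneg_of_mul_nonneg_right h2 ht.1
  have := hmono (left_mem_Icc.2 zero_le_one) (right_mem_Icc.2 zero_le_one) zero_le_one
  simp only [zero_mul, one_mul] at this
  have ha0 : agmon q 0 = 0 := by simp [agmon]
  rw [ha0] at this
  simp at this
  linarith

end IsPotential

end Potential

/-! ### Energy estimates -/

section Energy

open scoped ComplexConjugate

/-- `x ↦ e^{-ν δ(x)}`, which satisfies `g' = -ν q g`. -/
def wkb (q : ℝ → ℝ) (ν : ℂ) (x : ℝ) : ℂ := Complex.exp (-(ν * (agmon q x : ℂ)))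

/-- The form in which the energy estimates are used: `F` is an exact derivative whose boundary terms
vanish, and a pointwise inequality is all that remains to check. -/
theorem integral_le_of_le_add {a b : ℝ} (hab : a ≤ b) {F A B : ℝ → ℝ} (hF : Continuous F)
    (hA : Continuous A) (hB : Continuous B) (hF0 : ∫ x in a..b, F x = 0)
    (h : ∀ x ∈ Icc a b, A x ≤ F x + B x) : ∫ x in a..b, A x ≤ ∫ x in a..b, B x := by
  have h1 := intervalIntegral.integral_mono_on (μ := volume) hab (hA.intervalIntegrable a b)
    ((hF.add hB).intervalIntegrable a b) h
  have h2 := intervalIntegral.integral_add (hF.intervalIntegrable (μ := volume) a b)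
    (hB.intervalIntegrable a b)
  simp only [Pi.add_apply] at h1
  rw [h2, hF0, zero_add] at h1
  exact h1

theorem integral_re_deriv_mul_conj {A A' B B' : ℝ → ℂ} (hA : ∀ x, HasDerivAt A (A' x) x)
    (hB : ∀ x, HasDerivAt B (B' x) x) (hA' : Continuous A') (hB' : Continuous B') {a b : ℝ}
    (ha : A a * conj (B a) = 0) (hb : A b * conj (B b) = 0) (c : ℂ) :
    ∫ x in a..b, (c * (A' x * conj (B x) + A x * conj (B' x))).re = 0 := by
  have hAc := continuous_of_hasDerivAt hA
  have hBc := continuous_of_hasDerivAt hB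
  have hd : ∀ x, HasDerivAt (fun x => (c * (A x * conj (B x))).re)
      ((c * (A' x * conj (B x) + A x * conj (B' x))).re) x := fun x => by
    have h1 : HasDerivAt (fun x => conj (B x)) (conj (B' x)) x := (hB x).star
    have h2 := ((hA x).mul h1).const_mul c
    exact Complex.reCLM.hasFDerivAt.comp_hasDerivAt x h2
  rw [intervalIntegral.integral_eq_sub_of_hasDerivAt (fun x _ => hd x), ha, hb]
  · simp
  · refine Continuous.intervalIntegrable ?_ _ _
    have : Continuous fun x => conj (B x) := Complex.continuous_conj.comp hBc
    have : Continuous fun x => conj (B' x) := Complex.continuous_conj.comp hB'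
    fun_prop

/-- Since `conj ν * ν² = ‖ν‖² ν`, the factor `conj ν` gives both the kinetic term and the potential
term a real part proportional to `Re ν`. This is the substitute for self-adjointness in the sector.
-/
theorem energy_identity (ν z f w w₁ : ℂ) (Q X X' : ℝ) :
    (conj ν * ((((ν ^ 2 * (Q : ℂ) ^ 2 - z) * w - f) * X + w₁ * X') * conj w
      + w₁ * X * conj w₁)).re
      = X * (ν.re * ‖w₁‖ ^ 2 + ‖ν‖ ^ 2 * ν.re * Q ^ 2 * ‖w‖ ^ 2 - (conj ν * z).re * ‖w‖ ^ 2
        - (conj ν * f * conj w).re) + X' * (conj ν * w₁ * conj w).re := by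
  simp only [Complex.sq_norm, Complex.normSq_apply]
  simp only [Complex.mul_re, Complex.mul_im, Complex.add_re,
    Complex.add_im, Complex.sub_re, Complex.sub_im, Complex.conj_re, Complex.conj_im,
    Complex.ofReal_re, Complex.ofReal_im, pow_two]
  ring

theorem re_conj_mul_le (ν f w : ℂ) : |(conj ν * f * conj w).re| ≤ ‖ν‖ * ‖f‖ * ‖w‖ := by
  refine (Complex.abs_re_le_norm _).trans_eq ?_
  simp

/-- A low-energy solution: `-w'' + (ν² q² - z) w = a e^{-ν δ}` with Dirichlet conditions, for `ν` in
a sector and `z` in the disk around `γ ν` of radius `γ |ν|`. -/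
structure IsLowSol (Lneg Lpos : ℝ) (q : ℝ → ℝ) (γ κ : ℝ) (ν z a : ℂ) (w w₁ w₂ : ℝ → ℂ) : Prop
    extends IsDirichletC2 Lneg Lpos w w₁ w₂ where
  one_le : 1 ≤ ‖ν‖
  re_le : κ * ‖ν‖ ≤ ν.re
  z_le : ‖z - (γ : ℂ) * ν‖ ≤ γ * ‖ν‖
  eq : ∀ x ∈ Icc (-Lneg) Lpos,
    w₂ x = (ν ^ 2 * (q x : ℂ) ^ 2 - z) * w x - a * wkb q ν x

/-- The density `|w|² + |a e^{-νδ}|² / |ν|²`. -/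
def massFn (q : ℝ → ℝ) (ν a : ℂ) (w : ℝ → ℂ) (x : ℝ) : ℝ :=
  ‖w x‖ ^ 2 + (‖a * wkb q ν x‖ / ‖ν‖) ^ 2

theorem re_conj_mul_le_of_mem_disk {γ : ℝ} (hγ : 0 ≤ γ) {ν z : ℂ}
    (hz : ‖z - (γ : ℂ) * ν‖ ≤ γ * ‖ν‖) :
    (conj ν * z).re ≤ 2 * γ * ‖ν‖ ^ 2 := by
  have h1 : ‖z‖ ≤ 2 * γ * ‖ν‖ := by
    have h2 := norm_add_le (z - (γ : ℂ) * ν) ((γ : ℂ) * ν)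
    rw [sub_add_cancel, norm_mul (γ : ℂ), Complex.norm_real, Real.norm_of_nonneg hγ] at h2
    linarith
  have h3 := (Complex.re_le_norm (conj ν * z))
  rw [norm_mul, RCLike.norm_conj] at h3
  nlinarith [norm_nonneg ν]

variable {Lneg Lpos : ℝ} {q q₁ q₂ : ℝ → ℝ}

namespace IsPotential

theorem hasDerivAt_wkb (h : IsPotential Lneg Lpos q q₁ q₂) (ν : ℂ) (x : ℝ) :
    HasDerivAt (wkb q ν) (-(ν * q x * wkb q ν x)) x := by
  have h1 := (((h.hasDerivAt_agmon x).ofReal_comp).const_mul ν).neg.cexp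
  exact h1.congr_deriv (by
    change Complex.exp (-(ν * (agmon q x : ℂ))) * -(ν * (q x : ℂ)) = _
    rw [wkb]
    ring)

theorem continuous_wkb (h : IsPotential Lneg Lpos q q₁ q₂) (ν : ℂ) : Continuous (wkb q ν) :=
  continuous_of_hasDerivAt (h.hasDerivAt_wkb ν)

theorem continuous_massFn (h : IsPotential Lneg Lpos q q₁ q₂) (ν a : ℂ) {w : ℝ → ℂ}
    (hw : Continuous w) : Continuous (massFn q ν a w) := by
  have := h.continuous_wkb ν
  unfold massFn
  fun_prop

/-- The equation is tested against `w`. The source costs `‖ν‖ ‖a g‖ ‖w‖`; the division by `‖ν‖` in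
`massFn` makes this of the same order as the spectral term `2 q'(0) ‖ν‖² ‖w‖²`. -/
theorem energy_le (h : IsPotential Lneg Lpos q q₁ q₂) {κ : ℝ} {ν z a : ℂ}
    {w w₁ w₂ : ℝ → ℂ} (hw : IsLowSol Lneg Lpos q (q₁ 0) κ ν z a w w₁ w₂) :
    ∫ x in (-Lneg)..Lpos, κ * (‖w₁ x‖ ^ 2 + ‖ν‖ ^ 2 * q x ^ 2 * ‖w x‖ ^ 2)
      ≤ (2 * q₁ 0 + 1) * ‖ν‖ * ∫ x in (-Lneg)..Lpos, massFn q ν a w x := by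
  have hwc := hw.continuous
  have hw1c := hw.continuous'
  have hw2c := hw.cont
  have hqc := h.continuous
  have hmc := h.continuous_massFn ν a hwc
  have hn0 : 0 < ‖ν‖ := by linarith [hw.one_le]
  have h0 := integral_re_deriv_mul_conj hw.hasDerivAt' hw.hasDerivAt hw.cont hw1c
    (a := -Lneg) (b := Lpos) (by rw [hw.left]; simp) (by rw [hw.right]; simp) (conj ν)
  have hcw : Continuous fun x => conj (w x) := Complex.continuous_conj.comp hwc
  have hcw1 : Continuous fun x => conj (w₁ x) := Complex.continuous_conj.comp hw1c
  rw [← intervalIntegral.integral_const_mul]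
  have h1 : ∫ x in (-Lneg)..Lpos, ‖ν‖ * (κ * (‖w₁ x‖ ^ 2 + ‖ν‖ ^ 2 * q x ^ 2 * ‖w x‖ ^ 2))
      ≤ ∫ x in (-Lneg)..Lpos, ‖ν‖ * ((2 * q₁ 0 + 1) * ‖ν‖ * massFn q ν a w x) := by
    refine integral_le_of_le_add h.neg_lt.le (by fun_prop) (by fun_prop) (by fun_prop) h0
      fun x hx => ?_
    have e := energy_identity ν z (a * wkb q ν x) (w x) (w₁ x) (q x) 1 0
    simp only [Complex.ofReal_one, Complex.ofReal_zero, mul_one, mul_zero, add_zero,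
      one_mul, zero_mul] at e
    rw [← hw.eq x hx] at e
    rw [e, massFn]
    have b1 := re_conj_mul_le ν (a * wkb q ν x) (w x)
    have b2 := re_conj_mul_le_of_mem_disk h.deriv_pos.le hw.z_le
    have b3 := hw.re_le
    set s := ‖a * wkb q ν x‖ with hs
    set t := s / ‖ν‖ with ht
    have hst : s = ‖ν‖ * t := by rw [ht]; field_simp
    rw [hst] at b1
    have c1 : ‖ν‖ * (‖ν‖ * t) * ‖w x‖ ≤ ‖ν‖ ^ 2 * (‖w x‖ ^ 2 + t ^ 2) := by
      nlinarith [sq_nonneg (‖w x‖ - t), sq_nonneg (‖w x‖ + t), sq_nonneg ‖ν‖]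
    have c2 : (conj ν * z).re * ‖w x‖ ^ 2 ≤ 2 * q₁ 0 * ‖ν‖ ^ 2 * (‖w x‖ ^ 2 + t ^ 2) := by
      have : (conj ν * z).re * ‖w x‖ ^ 2 ≤ 2 * q₁ 0 * ‖ν‖ ^ 2 * ‖w x‖ ^ 2 := by gcongr
      have h3 : 0 ≤ 2 * q₁ 0 * ‖ν‖ ^ 2 * t ^ 2 := by have := h.deriv_pos; positivity
      linarith
    have c3 : κ * ‖ν‖ * ‖w₁ x‖ ^ 2 ≤ ν.re * ‖w₁ x‖ ^ 2 := by gcongr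
    have c4 : ‖ν‖ ^ 2 * (κ * ‖ν‖) * q x ^ 2 * ‖w x‖ ^ 2
        ≤ ‖ν‖ ^ 2 * ν.re * q x ^ 2 * ‖w x‖ ^ 2 := by gcongr
    have c5 := le_abs_self (conj ν * (a * wkb q ν x) * conj (w x)).re
    linarith
  rw [intervalIntegral.integral_const_mul, intervalIntegral.integral_const_mul (‖ν‖)] at h1
  exact le_of_mul_le_mul_left h1 hn0

/-- Testing with the weight `q²` gains a factor `‖ν‖` over `energy_le`: the spectral term now
carries `q² ‖w‖²`, which `energy_le` controls, and the term from the derivative of the weight is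
absorbed. This reflects concentration of `w` at scale `‖ν‖^{-1/2}`. -/
theorem exists_weighted_energy_le (h : IsPotential Lneg Lpos q q₁ q₂) {κ : ℝ} (hκ : 0 < κ) :
    ∃ C, 0 < C ∧ ∀ (ν z a : ℂ) (w w₁ w₂ : ℝ → ℂ),
      IsLowSol Lneg Lpos q (q₁ 0) κ ν z a w w₁ w₂ →
      ∫ x in (-Lneg)..Lpos, (q x ^ 2 * ‖w₁ x‖ ^ 2 + ‖ν‖ ^ 2 * q x ^ 4 * ‖w x‖ ^ 2)
        ≤ C * ∫ x in (-Lneg)..Lpos, massFn q ν a w x := by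
  obtain ⟨M, hM1, hM⟩ := h.exists_upper
  have hγ := h.deriv_pos
  refine ⟨2 / κ * (2 * q₁ 0 / κ * (2 * q₁ 0 + 1) + (2 * M ^ 2 + 1) / κ), by positivity, ?_⟩
  intro ν z a w w₁ w₂ hw
  have hwc := hw.continuous
  have hw1c := hw.continuous'
  have hw2c := hw.cont
  have hqc := h.continuous
  have hq1c := h.continuous'
  have hmc := h.continuous_massFn ν a hwc
  have hn0 : 0 < ‖ν‖ := by linarith [hw.one_le]
  have hE1 := h.energy_le hw
  set S := ∫ x in (-Lneg)..Lpos, massFn q ν a w x with hS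
  have hcw : Continuous fun x => conj (w x) := Complex.continuous_conj.comp hwc
  have hcw1 : Continuous fun x => conj (w₁ x) := Complex.continuous_conj.comp hw1c
  have hd : ∀ x, HasDerivAt (fun x => w₁ x * ((q x ^ 2 : ℝ) : ℂ))
      (w₂ x * ((q x ^ 2 : ℝ) : ℂ) + w₁ x * ((2 * q x * q₁ x : ℝ) : ℂ)) x := fun x => by
    have h1 : HasDerivAt (fun x => q x ^ 2) (2 * q x * q₁ x) x :=
      ((h.hasDerivAt x).pow 2).congr_deriv (by push_cast; ring)
    exact (hw.hasDerivAt' x).mul h1.ofReal_comp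
  have h0 := integral_re_deriv_mul_conj hd hw.hasDerivAt (by fun_prop) hw1c
    (a := -Lneg) (b := Lpos) (by rw [hw.left]; simp) (by rw [hw.right]; simp) (conj ν)
  have h1 : ∫ x in (-Lneg)..Lpos,
        ‖ν‖ * (κ / 2) * (q x ^ 2 * ‖w₁ x‖ ^ 2 + ‖ν‖ ^ 2 * q x ^ 4 * ‖w x‖ ^ 2)
      ≤ ∫ x in (-Lneg)..Lpos, (2 * q₁ 0 / κ * (κ * (‖w₁ x‖ ^ 2 + ‖ν‖ ^ 2 * q x ^ 2 * ‖w x‖ ^ 2))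
        + ‖ν‖ * (2 * M ^ 2 + 1) / κ * massFn q ν a w x) := by
    refine integral_le_of_le_add h.neg_lt.le (by fun_prop) (by fun_prop) (by fun_prop) h0
      fun x hx => ?_
    have e := energy_identity ν z (a * wkb q ν x) (w x) (w₁ x) (q x) (q x ^ 2) (2 * q x * q₁ x)
    rw [← hw.eq x hx] at e
    rw [e, massFn]
    have b1 := re_conj_mul_le ν (a * wkb q ν x) (w x)
    have b1' := re_conj_mul_le ν (w₁ x) (w x)
    have b2 := re_conj_mul_le_of_mem_disk h.deriv_pos.le hw.z_le
    have b3 := hw.re_le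
    obtain ⟨-, hq1, -⟩ := hM x hx
    set s := ‖a * wkb q ν x‖ with hs
    set t := s / ‖ν‖ with ht
    have hst : s = ‖ν‖ * t := by rw [ht]; field_simp
    rw [hst] at b1
    set W := ‖w x‖ with hW
    set W₁ := ‖w₁ x‖ with hW₁
    set n := ‖ν‖ with hn
    have hqq := abs_mul_abs_self (q x)
    set Q := |q x| with hQ
    have hQ2 : q x ^ 2 = Q ^ 2 := by rw [hQ, sq_abs]
    have hQ4 : q x ^ 4 = Q ^ 4 := by rw [show (4 : ℕ) = 2 * 2 by norm_num, pow_mul, hQ2, pow_mul]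
    have hQ0 : 0 ≤ Q := abs_nonneg _
    have hW0 : 0 ≤ W := norm_nonneg _
    have hW10 : 0 ≤ W₁ := norm_nonneg _
    have c3 : q x ^ 2 * (κ * n * W₁ ^ 2) ≤ q x ^ 2 * (ν.re * W₁ ^ 2) := by gcongr
    have c4 : q x ^ 2 * (n ^ 2 * (κ * n) * q x ^ 2 * W ^ 2)
        ≤ q x ^ 2 * (n ^ 2 * ν.re * q x ^ 2 * W ^ 2) := by gcongr
    have c2 : q x ^ 2 * ((conj ν * z).re * W ^ 2) ≤ q x ^ 2 * (2 * q₁ 0 * n ^ 2 * W ^ 2) := by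
      gcongr
    have c5 : q x ^ 2 * (conj ν * (a * wkb q ν x) * conj (w x)).re ≤ Q ^ 2 * (n * (n * t) * W) := by
      rw [hQ2]
      gcongr
      exact (le_abs_self _).trans b1
    have c6 : -(2 * q x * q₁ x * (conj ν * w₁ x * conj (w x)).re) ≤ 2 * Q * M * (n * W₁ * W) := by
      refine (neg_le_abs _).trans ?_
      rw [abs_mul, abs_mul, abs_mul, abs_two]
      gcongr
    have c7 : Q ^ 2 * (n * (n * t) * W) ≤ n * (κ / 2 * (n ^ 2 * Q ^ 4 * W ^ 2)) + n * (1 / κ * t ^ 2) := by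
      have : 0 ≤ n * (κ / 2) * ((n * Q ^ 2 * W - t / κ) ^ 2 + (t / κ) ^ 2) := by positivity
      have e1 : n * (κ / 2) * ((n * Q ^ 2 * W - t / κ) ^ 2 + (t / κ) ^ 2)
          = n * (κ / 2 * (n ^ 2 * Q ^ 4 * W ^ 2)) - Q ^ 2 * (n * (n * t) * W)
            + n * (1 / κ * t ^ 2) := by
        field_simp
        ring
      linarith
    have c8 : 2 * Q * M * (n * W₁ * W)
        ≤ n * (κ / 2 * (Q ^ 2 * W₁ ^ 2)) + n * (2 * M ^ 2 / κ * W ^ 2) := by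
      have : 0 ≤ n * (κ / 2) * (Q * W₁ - 2 * M / κ * W) ^ 2 := by positivity
      have e1 : n * (κ / 2) * (Q * W₁ - 2 * M / κ * W) ^ 2
          = n * (κ / 2 * (Q ^ 2 * W₁ ^ 2)) - 2 * Q * M * (n * W₁ * W)
            + n * (2 * M ^ 2 / κ * W ^ 2) := by
        field_simp
        ring
      linarith
    have c9 : 2 * q₁ 0 / κ * (κ * (W₁ ^ 2 + n ^ 2 * q x ^ 2 * W ^ 2))
        = 2 * q₁ 0 * W₁ ^ 2 + q x ^ 2 * (2 * q₁ 0 * n ^ 2 * W ^ 2) := by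
      field_simp
    have c10 : n * (2 * M ^ 2 + 1) / κ * (W ^ 2 + t ^ 2)
        = n * (2 * M ^ 2 / κ * W ^ 2) + n * (1 / κ * t ^ 2)
          + (n * (2 * M ^ 2 / κ * t ^ 2) + n * (1 / κ * W ^ 2)) := by
      field_simp
      ring
    have c11 : 0 ≤ n * (2 * M ^ 2 / κ * t ^ 2) + n * (1 / κ * W ^ 2) := by positivity
    have c12 : 0 ≤ 2 * q₁ 0 * W₁ ^ 2 := by positivity
    rw [c9, c10]
    rw [hQ4, hQ2] at *
    linarith
  rw [intervalIntegral.integral_const_mul] at h1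
  set X := ∫ x in (-Lneg)..Lpos, (q x ^ 2 * ‖w₁ x‖ ^ 2 + ‖ν‖ ^ 2 * q x ^ 4 * ‖w x‖ ^ 2) with hX
  rw [intervalIntegral.integral_add
    (Continuous.intervalIntegrable (by fun_prop) _ _)
    (Continuous.intervalIntegrable (by fun_prop) _ _),
    intervalIntegral.integral_const_mul, intervalIntegral.integral_const_mul (‖ν‖ * _ / κ),
    ← hS] at h1
  have h2 : 2 * q₁ 0 / κ * (∫ x in (-Lneg)..Lpos,
      κ * (‖w₁ x‖ ^ 2 + ‖ν‖ ^ 2 * q x ^ 2 * ‖w x‖ ^ 2))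
      ≤ 2 * q₁ 0 / κ * ((2 * q₁ 0 + 1) * ‖ν‖ * S) := by gcongr
  have h3 : ‖ν‖ * (κ / 2) * X ≤ ‖ν‖ * (κ / 2) *
      (2 / κ * (2 * q₁ 0 / κ * (2 * q₁ 0 + 1) + (2 * M ^ 2 + 1) / κ) * S) := by
    have e : ‖ν‖ * (κ / 2) *
        (2 / κ * (2 * q₁ 0 / κ * (2 * q₁ 0 + 1) + (2 * M ^ 2 + 1) / κ) * S)
        = 2 * q₁ 0 / κ * ((2 * q₁ 0 + 1) * ‖ν‖ * S) + ‖ν‖ * (2 * M ^ 2 + 1) / κ * S := by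
      field_simp
    rw [e]
    linarith
  exact le_of_mul_le_mul_left h3 (by positivity)

end IsPotential

end Energy

/-! ### The first-order reduction -/

section FirstOrder

open scoped ComplexConjugate

/-- A cut-off vanishing at both end points and equal to `1` to second order at `0`. -/
theorem exists_cutoff {Lneg Lpos : ℝ} (h1 : 0 < Lneg) (h2 : 0 < Lpos) :
    ∃ X X₁ X₂ : ℝ → ℝ, ∃ K : ℝ, (∀ x, HasDerivAt X (X₁ x) x) ∧ (∀ x, HasDerivAt X₁ (X₂ x) x) ∧
      Continuous X₂ ∧ X (-Lneg) = 0 ∧ X Lpos = 0 ∧ 1 ≤ K ∧ ∀ x ∈ Icc (-Lneg) Lpos,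
      |X x| ≤ K ∧ |X₁ x| ≤ K * |x| ∧ |X₂ x| ≤ K ∧ |X x - 1| ≤ K * x ^ 2 := by
  -- The cut-off `1 + e x² + f x³` is `(1 - x/Lpos)(1 + x/Lneg)(1 + c x)`, with `c` chosen to remove
  -- the linear term.
  set c : ℝ := 1 / Lpos - 1 / Lneg with hc
  set e : ℝ := -(c ^ 2 + 1 / (Lpos * Lneg)) with he
  set f : ℝ := -(c / (Lpos * Lneg)) with hf
  have hd : ∀ x, HasDerivAt (fun x : ℝ => 1 + (e * x ^ 2 + f * x ^ 3))
      (2 * e * x + 3 * f * x ^ 2) x := fun x =>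
    ((((hasDerivAt_pow 2 x).const_mul e).add ((hasDerivAt_pow 3 x).const_mul f)).const_add
      1).congr_deriv (by push_cast; ring)
  have hd' : ∀ x, HasDerivAt (fun x : ℝ => 2 * e * x + 3 * f * x ^ 2)
      (2 * e + 6 * f * x) x := fun x =>
    (((hasDerivAt_id x).const_mul (2 * e)).add
      ((hasDerivAt_pow 2 x).const_mul (3 * f))).congr_deriv (by push_cast; ring)
  set L := Lneg + Lpos with hL
  have hL0 : 0 < L := by positivity
  have hx : ∀ x ∈ Icc (-Lneg) Lpos, |x| ≤ L := fun x hx =>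
    abs_le.2 ⟨by linarith [hx.1], by linarith [hx.2]⟩
  have hK : 0 ≤ 6 * |e| + 6 * |f| * L := by positivity
  refine ⟨_, _, _, 1 + (6 * |e| + 6 * |f| * L) * (1 + L ^ 2), hd, hd', by fun_prop, ?_, ?_, ?_, ?_⟩
  · simp only [he, hf, hc]
    field_simp
    ring
  · simp only [he, hf, hc]
    field_simp
    ring
  · have : 0 ≤ (6 * |e| + 6 * |f| * L) * (1 + L ^ 2) := by positivity
    linarith
  · intro x hxI
    have hx1 := hx x hxI
    have hx0 := abs_nonneg x
    set T := 6 * |e| + 6 * |f| * L with hT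
    have b0 : |e * x ^ 2 + f * x ^ 3| ≤ T * x ^ 2 := by
      have : e * x ^ 2 + f * x ^ 3 = (e + f * x) * x ^ 2 := by ring
      rw [this, abs_mul, abs_of_nonneg (sq_nonneg x)]
      gcongr
      refine (abs_add_le _ _).trans ?_
      rw [abs_mul]
      have : |f| * |x| ≤ |f| * L := by gcongr
      have : 0 ≤ |f| * L := by positivity
      have := abs_nonneg e
      linarith
    have hx2 : x ^ 2 ≤ L ^ 2 := by rw [← sq_abs]; gcongr
    refine ⟨?_, ?_, ?_, ?_⟩
    · refine (abs_add_le _ _).trans ?_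
      rw [abs_one]
      gcongr
      refine b0.trans ?_
      gcongr
      linarith
    · have : 2 * e * x + 3 * f * x ^ 2 = (2 * e + 3 * f * x) * x := by ring
      rw [this, abs_mul]
      gcongr
      refine (abs_add_le _ _).trans ?_
      rw [abs_mul, abs_mul (3 * f), abs_mul 3, abs_of_pos (by norm_num : (0 : ℝ) < 2),
        abs_of_pos (by norm_num : (0 : ℝ) < 3)]
      have h3 : 3 * |f| * |x| ≤ 3 * |f| * L := by gcongr
      have h4 : 0 ≤ |f| * L := by positivity
      have h5 := abs_nonneg e
      have h6 : 0 ≤ T * L ^ 2 := by positivity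
      linarith
    · refine (abs_add_le _ _).trans ?_
      rw [abs_mul, abs_mul (6 * f), abs_mul 6, abs_of_pos (by norm_num : (0 : ℝ) < 2),
        abs_of_pos (by norm_num : (0 : ℝ) < 6)]
      have h3 : 6 * |f| * |x| ≤ 6 * |f| * L := by gcongr
      have h5 := abs_nonneg e
      have h6 : 0 ≤ T * L ^ 2 := by positivity
      linarith
    · rw [add_sub_cancel_left]
      refine b0.trans ?_
      gcongr
      have : 0 ≤ T * L ^ 2 := by positivity
      linarith

theorem commutator_identity (ν V W : ℂ) (Q₁ Q₂ : ℝ) :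
    (conj ν * -(2 * ν * (Q₁ : ℂ) * V + ν * (Q₂ : ℂ) * W) * conj V).re
      = -(‖ν‖ ^ 2 * (2 * Q₁ * ‖V‖ ^ 2 + Q₂ * (W * conj V).re)) := by
  simp only [Complex.sq_norm, Complex.normSq_apply]
  simp only [Complex.mul_re, Complex.mul_im, Complex.add_re, Complex.neg_re, Complex.neg_im,
    Complex.add_im, Complex.conj_re, Complex.conj_im, Complex.re_ofNat, Complex.im_ofNat,
    Complex.ofReal_re, Complex.ofReal_im]
  ring

theorem weight_identity (V V₁ : ℂ) (X X' : ℝ) :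
    (1 * ((V₁ * (X : ℂ) + V * (X' : ℂ)) * conj V + V * (X : ℂ) * conj V₁)).re
      = X' * ‖V‖ ^ 2 + 2 * X * (V₁ * conj V).re := by
  simp only [Complex.sq_norm, Complex.normSq_apply]
  simp only [Complex.mul_re, Complex.mul_im, Complex.add_re,
    Complex.add_im, Complex.conj_re, Complex.conj_im, Complex.one_re, Complex.one_im,
    Complex.ofReal_re, Complex.ofReal_im]
  ring

theorem abs_re_mul_conj_le (W V : ℂ) : |(W * conj V).re| ≤ ‖W‖ * ‖V‖ := by
  refine (Complex.abs_re_le_norm _).trans_eq ?_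
  simp

/-- The pointwise inequality behind the coercivity of `P_ν + 2 ν q' - z`. -/
theorem coercivity_aux {κ γ m M n P R Q y V V₁ W : ℝ} (hκ : 0 < κ) (hκ1 : κ ≤ 1) (hγ : 0 < γ)
    (hm : 0 < m) (hM : 0 ≤ M) (hn : 72 * M ^ 2 / (κ ^ 2 * γ * m ^ 2) ≤ n) (hn0 : 0 < n)
    (hy : 0 ≤ y) (hyQ : m * y ≤ Q) :
    n ^ 2 * (κ * γ / 8) * (P ^ 2 * V ^ 2) ≤
      (P ^ 2 * (κ * n * V₁ ^ 2 + n ^ 2 * (κ * n) * Q ^ 2 * V ^ 2 - 2 * n ^ 2 * (M * y) * V ^ 2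
        - n ^ 2 * (M * (W * V))) - 2 * P * R * (n * V₁ * V))
      + κ / 4 * n ^ 2 * ((γ - M * y) * P ^ 2 * V ^ 2 - 2 * Q * P * R * V ^ 2
        - 2 * Q * P ^ 2 * (V₁ * V))
      + n ^ 2 * (4 * M ^ 2 / (κ * γ)) * (P ^ 2 * W ^ 2) + n * (5 / κ) * (R ^ 2 * V ^ 2) := by
  have t1 : κ / 4 * n ^ 2 * (2 * Q * P * R * V ^ 2)
      ≤ κ / 4 * (n ^ 3 * Q ^ 2 * P ^ 2 * V ^ 2 + n * (R ^ 2 * V ^ 2)) := by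
    have : 0 ≤ κ / 4 * n * (n * Q * P * V - R * V) ^ 2 := by positivity
    nlinarith
  have t2 : κ / 4 * n ^ 2 * (2 * Q * P ^ 2 * (V₁ * V))
      ≤ κ / 4 * (n ^ 3 * Q ^ 2 * P ^ 2 * V ^ 2 + n * (P ^ 2 * V₁ ^ 2)) := by
    have : 0 ≤ κ / 4 * n * (n * Q * P * V - P * V₁) ^ 2 := by positivity
    nlinarith
  have t3 : 2 * P * R * (n * V₁ * V)
      ≤ κ / 4 * (n * (P ^ 2 * V₁ ^ 2)) + 4 / κ * (n * (R ^ 2 * V ^ 2)) := by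
    have : 0 ≤ κ / 4 * n * (P * V₁ - 4 / κ * (R * V)) ^ 2 := by positivity
    have e : κ / 4 * n * (P * V₁ - 4 / κ * (R * V)) ^ 2
        = κ / 4 * (n * (P ^ 2 * V₁ ^ 2)) - 2 * P * R * (n * V₁ * V)
          + 4 / κ * (n * (R ^ 2 * V ^ 2)) := by
      field_simp
      ring
    linarith
  have t4 : P ^ 2 * (n ^ 2 * (M * (W * V)))
      ≤ n ^ 2 * (κ * γ / 16) * (P ^ 2 * V ^ 2) + n ^ 2 * (4 * M ^ 2 / (κ * γ)) * (P ^ 2 * W ^ 2) := by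
    have : 0 ≤ n ^ 2 * (κ * γ / 16) * (P * V - 8 * M / (κ * γ) * (P * W)) ^ 2 := by positivity
    have e : n ^ 2 * (κ * γ / 16) * (P * V - 8 * M / (κ * γ) * (P * W)) ^ 2
        = n ^ 2 * (κ * γ / 16) * (P ^ 2 * V ^ 2) - P ^ 2 * (n ^ 2 * (M * (W * V)))
          + n ^ 2 * (4 * M ^ 2 / (κ * γ)) * (P ^ 2 * W ^ 2) := by
      field_simp
      ring
    linarith
  -- The error `M y` in replacing `q'` by `q'(0)` is absorbed near `0` by part of the gap and
  -- elsewhere by `n Q²`; this is where `n` has to be large.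
  have t5 : 3 * (M * y) ≤ κ * γ / 16 + κ / 2 * n * Q ^ 2 := by
    have h1 : 36 * M ^ 2 / (κ * γ) * y ^ 2 ≤ κ / 2 * n * Q ^ 2 := by
      have h2 : (m * y) ^ 2 ≤ Q ^ 2 := by gcongr
      have h3 : κ / 2 * (72 * M ^ 2 / (κ ^ 2 * γ * m ^ 2)) * (m * y) ^ 2 ≤ κ / 2 * n * Q ^ 2 := by
        gcongr
      have e : κ / 2 * (72 * M ^ 2 / (κ ^ 2 * γ * m ^ 2)) * (m * y) ^ 2
          = 36 * M ^ 2 / (κ * γ) * y ^ 2 := by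
        field_simp
        ring
      linarith
    have h4 : 0 ≤ κ * γ / 16 * (1 - 24 * M * y / (κ * γ)) ^ 2 := by positivity
    have e : κ * γ / 16 * (1 - 24 * M * y / (κ * γ)) ^ 2
        = κ * γ / 16 - 3 * (M * y) + 36 * M ^ 2 / (κ * γ) * y ^ 2 := by
      field_simp
      ring
    linarith
  have t6 : P ^ 2 * (2 * n ^ 2 * (M * y) * V ^ 2) + κ / 4 * n ^ 2 * (M * y * P ^ 2 * V ^ 2)
      ≤ n ^ 2 * (P ^ 2 * V ^ 2) * (κ * γ / 16 + κ / 2 * n * Q ^ 2) := by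
    have h1 : n ^ 2 * (P ^ 2 * V ^ 2) * (3 * (M * y))
        ≤ n ^ 2 * (P ^ 2 * V ^ 2) * (κ * γ / 16 + κ / 2 * n * Q ^ 2) := by gcongr
    have h2 : 0 ≤ n ^ 2 * (P ^ 2 * V ^ 2) * (M * y) * (1 - κ / 4) := by
      have : 0 ≤ 1 - κ / 4 := by linarith
      positivity
    linarith
  have t7 : κ / 4 * (n * (R ^ 2 * V ^ 2)) + 4 / κ * (n * (R ^ 2 * V ^ 2))
      ≤ n * (5 / κ) * (R ^ 2 * V ^ 2) := by
    have h1 : κ / 4 ≤ 1 / κ := by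
      rw [div_le_div_iff₀ (by norm_num) hκ]
      nlinarith
    have h2 : κ / 4 * (n * (R ^ 2 * V ^ 2)) ≤ 1 / κ * (n * (R ^ 2 * V ^ 2)) := by gcongr
    have e : 1 / κ * (n * (R ^ 2 * V ^ 2)) + 4 / κ * (n * (R ^ 2 * V ^ 2))
        = n * (5 / κ) * (R ^ 2 * V ^ 2) := by ring
    linarith
  have t8 : 0 ≤ κ / 2 * (n * (P ^ 2 * V₁ ^ 2)) := by positivity
  linarith

theorem norm_add_mul_mul_sq_le (ν w₁ w : ℂ) (Q : ℝ) :
    ‖w₁ + ν * Q * w‖ ^ 2 ≤ 2 * (‖w₁‖ ^ 2 + ‖ν‖ ^ 2 * Q ^ 2 * ‖w‖ ^ 2) := by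
  have h1 := norm_add_le w₁ (ν * Q * w)
  rw [norm_mul, norm_mul, Complex.norm_real, Real.norm_eq_abs] at h1
  have h2 : ‖w₁ + ν * Q * w‖ ^ 2 ≤ (‖w₁‖ + ‖ν‖ * |Q| * ‖w‖) ^ 2 := by gcongr
  have h3 : (‖ν‖ * |Q| * ‖w‖) ^ 2 = ‖ν‖ ^ 2 * Q ^ 2 * ‖w‖ ^ 2 := by
    rw [mul_pow, mul_pow, sq_abs]
  nlinarith [sq_nonneg (‖w₁‖ - ‖ν‖ * |Q| * ‖w‖)]

/-- The extra potential `2 ν q'` compensates the largest value `2γ ‖ν‖²` of `Re (conj ν z)` on the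
disk, up to an error `M y`. What is left behaves like a harmonic oscillator; its positive ground
level is extracted by adding a multiple of the exact derivative of `q P² ‖v‖²`, a local form of the
uncertainty principle. `R` plays the role of the derivative of `P`. -/
theorem coercivity_pointwise {κ γ m M : ℝ} {ν z : ℂ} (hκ : 0 < κ) (hκ1 : κ ≤ 1) (hγ : 0 < γ)
    (hm : 0 < m) (hM : 0 ≤ M) (hn : 72 * M ^ 2 / (κ ^ 2 * γ * m ^ 2) ≤ ‖ν‖) (hn0 : 0 < ‖ν‖)
    (hre : κ * ‖ν‖ ≤ ν.re) (hz : ‖z - (γ : ℂ) * ν‖ ≤ γ * ‖ν‖) {y Q Q₁ Q₂ : ℝ} (hy : 0 ≤ y)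
    (hyQ : m * y ≤ |Q|) (hQ₁ : |Q₁ - γ| ≤ M * y) (hQ₂ : |Q₂| ≤ M) (P R : ℝ) (v V w : ℂ) :
    ‖ν‖ ^ 2 * (κ * γ / 8) * (P ^ 2 * ‖v‖ ^ 2) ≤
      ((conj ν * ((((ν ^ 2 * (Q : ℂ) ^ 2 - z) * v - -(2 * ν * (Q₁ : ℂ) * v + ν * (Q₂ : ℂ) * w))
          * ((P ^ 2 : ℝ) : ℂ) + V * ((2 * P * R : ℝ) : ℂ)) * conj v
        + V * ((P ^ 2 : ℝ) : ℂ) * conj V)).re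
      + κ / 4 * ‖ν‖ ^ 2 * (1 * ((V * ((Q * P ^ 2 : ℝ) : ℂ)
          + v * ((Q₁ * P ^ 2 + Q * (2 * P * R) : ℝ) : ℂ)) * conj v
        + v * ((Q * P ^ 2 : ℝ) : ℂ) * conj V)).re)
      + (‖ν‖ ^ 2 * (4 * M ^ 2 / (κ * γ)) * (P ^ 2 * ‖w‖ ^ 2)
        + ‖ν‖ * (5 / κ) * (R ^ 2 * ‖v‖ ^ 2)) := by
  have e2 := weight_identity v V (Q * P ^ 2) (Q₁ * P ^ 2 + Q * (2 * P * R))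
  rw [energy_identity, commutator_identity, e2]
  have b1 := re_conj_mul_le ν V v
  have b2 := re_conj_mul_le_of_mem_disk hγ.le hz
  have b3 := abs_re_mul_conj_le w v
  have b4 := abs_re_mul_conj_le V v
  have c := coercivity_aux (P := |P|) (R := |R|) (Q := |Q|) (V := ‖v‖) (V₁ := ‖V‖) (W := ‖w‖)
    hκ hκ1 hγ hm hM hn hn0 hy hyQ
  rw [sq_abs, sq_abs, sq_abs] at c
  have d1 : κ * ‖ν‖ * ‖V‖ ^ 2 ≤ ν.re * ‖V‖ ^ 2 := by gcongr
  have d2 : ‖ν‖ ^ 2 * (κ * ‖ν‖) * Q ^ 2 * ‖v‖ ^ 2 ≤ ‖ν‖ ^ 2 * ν.re * Q ^ 2 * ‖v‖ ^ 2 := by gcongr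
  have d3 : (conj ν * z).re * ‖v‖ ^ 2 ≤ 2 * γ * ‖ν‖ ^ 2 * ‖v‖ ^ 2 := by gcongr
  have hQ1 : γ - M * y ≤ Q₁ := by linarith [(abs_le.1 hQ₁).1]
  have d4 : ‖ν‖ ^ 2 * (2 * (γ - M * y) * ‖v‖ ^ 2) ≤ ‖ν‖ ^ 2 * (2 * Q₁ * ‖v‖ ^ 2) := by gcongr
  have d5 : -(M * (‖w‖ * ‖v‖)) ≤ Q₂ * (w * conj v).re := by
    refine neg_le_of_abs_le ?_
    rw [abs_mul]
    gcongr
  have d5' : ‖ν‖ ^ 2 * -(M * (‖w‖ * ‖v‖)) ≤ ‖ν‖ ^ 2 * (Q₂ * (w * conj v).re) := by gcongr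
  have d6 : -(2 * |P| * |R| * (‖ν‖ * ‖V‖ * ‖v‖)) ≤ 2 * P * R * (conj ν * V * conj v).re := by
    refine neg_le_of_abs_le ?_
    rw [abs_mul, abs_mul, abs_mul, abs_two]
    gcongr
  have d7 : -(2 * |Q| * P ^ 2 * (‖V‖ * ‖v‖)) ≤ 2 * (Q * P ^ 2) * (V * conj v).re := by
    refine neg_le_of_abs_le ?_
    rw [abs_mul, abs_mul, abs_mul, abs_two, abs_of_nonneg (sq_nonneg P), ← mul_assoc 2]
    gcongr
  have d8 : -(2 * |Q| * |P| * |R| * ‖v‖ ^ 2) ≤ 2 * Q * P * R * ‖v‖ ^ 2 := by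
    refine neg_le_of_abs_le (le_of_eq ?_)
    rw [abs_mul, abs_mul, abs_mul, abs_mul, abs_two, abs_of_nonneg (sq_nonneg ‖v‖)]
  have d9 : (γ - M * y) * P ^ 2 * ‖v‖ ^ 2 ≤ Q₁ * P ^ 2 * ‖v‖ ^ 2 := by gcongr
  have f1 : P ^ 2 * (κ * ‖ν‖ * ‖V‖ ^ 2 + ‖ν‖ ^ 2 * (κ * ‖ν‖) * Q ^ 2 * ‖v‖ ^ 2
      - 2 * ‖ν‖ ^ 2 * (M * y) * ‖v‖ ^ 2 - ‖ν‖ ^ 2 * (M * (‖w‖ * ‖v‖)))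
      ≤ P ^ 2 * (ν.re * ‖V‖ ^ 2 + ‖ν‖ ^ 2 * ν.re * Q ^ 2 * ‖v‖ ^ 2 - (conj ν * z).re * ‖v‖ ^ 2
        - -(‖ν‖ ^ 2 * (2 * Q₁ * ‖v‖ ^ 2 + Q₂ * (w * conj v).re))) := by
    refine mul_le_mul_of_nonneg_left ?_ (sq_nonneg P)
    linarith
  have f2 : κ / 4 * ‖ν‖ ^ 2 * ((γ - M * y) * P ^ 2 * ‖v‖ ^ 2 - 2 * |Q| * |P| * |R| * ‖v‖ ^ 2
        - 2 * |Q| * P ^ 2 * (‖V‖ * ‖v‖))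
      ≤ κ / 4 * ‖ν‖ ^ 2 * ((Q₁ * P ^ 2 + Q * (2 * P * R)) * ‖v‖ ^ 2
        + 2 * (Q * P ^ 2) * (V * conj v).re) := by
    gcongr
    linarith
  linarith

variable {Lneg Lpos : ℝ} {q q₁ q₂ : ℝ → ℝ}

namespace IsPotential

/-- If `w` is a low-energy solution, `v = w' + ν q w` solves a second-order equation as well. -/
theorem exists_firstOrder (h : IsPotential Lneg Lpos q q₁ q₂) {γ κ : ℝ} {ν z a : ℂ}
    {w w₁ w₂ : ℝ → ℂ} (hw : IsLowSol Lneg Lpos q γ κ ν z a w w₁ w₂) :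
    ∃ v v' V V' : ℝ → ℂ, (∀ x, v x = w₁ x + ν * q x * w x) ∧ (∀ x, HasDerivAt v (v' x) x) ∧
      (∀ x, HasDerivAt V (V' x) x) ∧ Continuous v' ∧ Continuous V' ∧
      ∀ x ∈ Icc (-Lneg) Lpos, v' x = V x ∧ V' x = (ν ^ 2 * (q x : ℂ) ^ 2 - z) * v x
        - -(2 * ν * (q₁ x : ℂ) * v x + ν * (q₂ x : ℂ) * w x) := by
  have hwc := hw.continuous
  have hw1c := hw.continuous'
  have hw2c := hw.cont
  have hqc := h.continuous
  have hq1c := h.continuous'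
  have hq2c := h.cont
  have hgc := h.continuous_wkb ν
  set v : ℝ → ℂ := fun x => w₁ x + ν * q x * w x with hv
  set v' : ℝ → ℂ := fun x => w₂ x + (ν * q₁ x * w x + ν * q x * w₁ x) with hv'
  -- `V` is `v'` rewritten through the equation. Unlike `v'`, which contains `w₂`, it is visibly
  -- differentiable, and in its derivative the source cancels because `∂ + ν q` annihilates `wkb`.
  set V : ℝ → ℂ := fun x => ν * q x * v x + (ν * q₁ x - z) * w x - a * wkb q ν x with hV
  set V' : ℝ → ℂ := fun x => (ν * q₁ x * v x + ν * q x * v' x)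
    + (ν * q₂ x * w x + (ν * q₁ x - z) * w₁ x) - a * -(ν * q x * wkb q ν x) with hV'
  have hqd : ∀ x, HasDerivAt (fun x => ν * (q x : ℂ)) (ν * q₁ x) x := fun x =>
    (h.hasDerivAt x).ofReal_comp.const_mul ν
  have hqd' : ∀ x, HasDerivAt (fun x => ν * (q₁ x : ℂ)) (ν * q₂ x) x := fun x =>
    (h.hasDerivAt' x).ofReal_comp.const_mul ν
  have hvd : ∀ x, HasDerivAt v (v' x) x := fun x =>
    (hw.hasDerivAt' x).add ((hqd x).mul (hw.hasDerivAt x))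
  have hVd : ∀ x, HasDerivAt V (V' x) x := fun x =>
    (((hqd x).mul (hvd x)).add (((hqd' x).sub_const z).mul (hw.hasDerivAt x))).sub
      ((h.hasDerivAt_wkb ν x).const_mul a)
  have hvc : Continuous v := by fun_prop
  have hv'c : Continuous v' := by fun_prop
  have hVc : Continuous V := by fun_prop
  have hvV : ∀ x ∈ Icc (-Lneg) Lpos, v' x = V x := fun x hx => by
    simp only [hv', hV, hv, hw.eq x hx]
    ring
  refine ⟨v, v', V, V', fun _ => rfl, hvd, hVd, hv'c, by fun_prop, fun x hx => ⟨hvV x hx, ?_⟩⟩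
  simp only [hV', hvV x hx]
  simp only [hV, hv]
  ring

-- `v` need not vanish at the end points, hence the weight `X`. Coercivity bounds `‖ν‖² ∫ X² ‖v‖²`
-- by `‖ν‖² ∫ ‖w‖²` and a commutator `‖ν‖ ∫ X₁² ‖v‖²`; as `|X₁| ≤ K |x|` is dominated by `|q|`,
-- `exists_weighted_energy_le` controls the latter.
set_option maxHeartbeats 1000000 in
theorem exists_firstOrder_weighted_le (h : IsPotential Lneg Lpos q q₁ q₂) {κ : ℝ} (hκ : 0 < κ)
    (hκ1 : κ ≤ 1) {X X₁ : ℝ → ℝ} {K : ℝ} (hX : ∀ x, HasDerivAt X (X₁ x) x)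
    (hX1c : Continuous X₁) (hXl : X (-Lneg) = 0) (hXr : X Lpos = 0) (hK : 1 ≤ K)
    (hXb : ∀ x ∈ Icc (-Lneg) Lpos, |X x| ≤ K ∧ |X₁ x| ≤ K * |x|) :
    ∃ C n₁, 0 < C ∧ ∀ (ν z a : ℂ) (w w₁ w₂ : ℝ → ℂ), n₁ ≤ ‖ν‖ →
      IsLowSol Lneg Lpos q (q₁ 0) κ ν z a w w₁ w₂ →
      ∫ x in (-Lneg)..Lpos, X x ^ 2 * ‖w₁ x + ν * q x * w x‖ ^ 2
        ≤ C * ∫ x in (-Lneg)..Lpos, massFn q ν a w x := by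
  obtain ⟨M, hM1, hM⟩ := h.exists_upper
  obtain ⟨m, hm0, hmγ, hm⟩ := h.exists_lower
  obtain ⟨Cw, hCw, hE2⟩ := h.exists_weighted_energy_le hκ
  have hγ := h.deriv_pos
  set γ := q₁ 0 with hγd
  set c₁ : ℝ := 4 * M ^ 2 * K ^ 2 / (κ * γ) with hc₁
  set c₂ : ℝ := 10 * K ^ 2 / (κ * m ^ 2) with hc₂
  refine ⟨8 / (κ * γ) * (c₁ + c₂ * Cw), 72 * M ^ 2 / (κ ^ 2 * γ * m ^ 2), by positivity, ?_⟩
  intro ν z a w w₁ w₂ hn hw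
  have hE2 := hE2 ν z a w w₁ w₂ hw
  have hmc := h.continuous_massFn ν a hw.continuous
  obtain ⟨v, v', V, V', hv, hvd, hVd, hv'c, hV'c, hvV⟩ := h.exists_firstOrder hw
  have hvc := continuous_of_hasDerivAt hvd
  have hVc := continuous_of_hasDerivAt hVd
  have hwc := hw.continuous
  have hw1c := hw.continuous'
  have hqc := h.continuous
  have hq1c := h.continuous'
  have hXc : Continuous X := continuous_iff_continuousAt.2 fun x => (hX x).continuousAt
  have hn1 := hw.one_le
  have hn0 : 0 < ‖ν‖ := by linarith
  simp only [← hv]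
  set S := ∫ x in (-Lneg)..Lpos, massFn q ν a w x with hS
  set Z := ∫ x in (-Lneg)..Lpos, (q x ^ 2 * ‖w₁ x‖ ^ 2 + ‖ν‖ ^ 2 * q x ^ 4 * ‖w x‖ ^ 2) with hZ
  have hX2 : ∀ x, HasDerivAt (fun x => X x ^ 2) (2 * X x * X₁ x) x := fun x =>
    ((hX x).pow 2).congr_deriv (by push_cast; ring)
  have hd1 : ∀ x, HasDerivAt (fun x => V x * ((X x ^ 2 : ℝ) : ℂ))
      (V' x * ((X x ^ 2 : ℝ) : ℂ) + V x * ((2 * X x * X₁ x : ℝ) : ℂ)) x := fun x =>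
    (hVd x).mul (hX2 x).ofReal_comp
  have hd2 : ∀ x, HasDerivAt (fun x => v x * ((q x * X x ^ 2 : ℝ) : ℂ))
      (v' x * ((q x * X x ^ 2 : ℝ) : ℂ)
        + v x * ((q₁ x * X x ^ 2 + q x * (2 * X x * X₁ x) : ℝ) : ℂ)) x := fun x =>
    (hvd x).mul ((h.hasDerivAt x).mul (hX2 x)).ofReal_comp
  have i1 := integral_re_deriv_mul_conj hd1 hvd (by fun_prop) hv'c
    (a := -Lneg) (b := Lpos) (by rw [hXl]; simp) (by rw [hXr]; simp) (conj ν)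
  have i2 := integral_re_deriv_mul_conj hd2 hvd (by fun_prop) hv'c
    (a := -Lneg) (b := Lpos) (by rw [hXl]; simp) (by rw [hXr]; simp) 1
  have hcv : Continuous fun x => conj (v x) := Complex.continuous_conj.comp hvc
  have hcv' : Continuous fun x => conj (v' x) := Complex.continuous_conj.comp hv'c
  have key : ∫ x in (-Lneg)..Lpos, ‖ν‖ ^ 2 * (κ * γ / 8) * (X x ^ 2 * ‖v x‖ ^ 2)
      ≤ ∫ x in (-Lneg)..Lpos, (‖ν‖ ^ 2 * c₁ * massFn q ν a w x
        + ‖ν‖ ^ 2 * c₂ * (q x ^ 2 * ‖w₁ x‖ ^ 2 + ‖ν‖ ^ 2 * q x ^ 4 * ‖w x‖ ^ 2)) := by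
    refine integral_le_of_le_add h.neg_lt.le
      (F := fun x => (conj ν * ((V' x * ((X x ^ 2 : ℝ) : ℂ)
          + V x * ((2 * X x * X₁ x : ℝ) : ℂ)) * conj (v x)
          + V x * ((X x ^ 2 : ℝ) : ℂ) * conj (v' x))).re
        + κ / 4 * ‖ν‖ ^ 2 * (1 * ((v' x * ((q x * X x ^ 2 : ℝ) : ℂ)
          + v x * ((q₁ x * X x ^ 2 + q x * (2 * X x * X₁ x) : ℝ) : ℂ)) * conj (v x)
          + v x * ((q x * X x ^ 2 : ℝ) : ℂ) * conj (v' x))).re)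
      (by fun_prop) (by fun_prop) (by fun_prop) ?_ fun x hx => ?_
    · rw [intervalIntegral.integral_add (Continuous.intervalIntegrable (by fun_prop) _ _)
        (Continuous.intervalIntegrable (by fun_prop) _ _),
        intervalIntegral.integral_const_mul (κ / 4 * ‖ν‖ ^ 2), i1, i2]
      simp
    · obtain ⟨-, -, hq2, -, hq1, -⟩ := hM x hx
      obtain ⟨hXK, hXK'⟩ := hXb x hx
      have hmx : m * |x| ≤ |q x| := by
        rcases (abs_nonneg x).eq_or_lt with h0 | h0
        · rw [← h0, mul_zero]
          exact abs_nonneg _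
        · have h1 := (hm x hx).trans (le_abs_self _)
          rw [abs_mul, ← sq_abs] at h1
          refine le_of_mul_le_mul_left ?_ h0
          linarith
      have p := coercivity_pointwise hκ hκ1 hγ hm0 (by linarith) hn hn0 hw.re_le hw.z_le
        (abs_nonneg x) hmx hq1 hq2 (X x) (X₁ x) (v x) (V x) (w x)
      rw [← (hvV x hx).2] at p
      simp only [(hvV x hx).1]
      refine p.trans (add_le_add le_rfl ?_)
      have hvn : ‖v x‖ ^ 2 ≤ 2 * (‖w₁ x‖ ^ 2 + ‖ν‖ ^ 2 * q x ^ 2 * ‖w x‖ ^ 2) := by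
        rw [hv]
        exact norm_add_mul_mul_sq_le ν (w₁ x) (w x) (q x)
      have s1 : X x ^ 2 ≤ K ^ 2 := by rw [← sq_abs]; gcongr
      have s2 : X₁ x ^ 2 ≤ K ^ 2 / m ^ 2 * q x ^ 2 := by
        have h1 : |X₁ x| ≤ K / m * |q x| := by
          refine hXK'.trans ?_
          rw [div_mul_eq_mul_div, le_div_iff₀ hm0]
          nlinarith
        calc X₁ x ^ 2 = |X₁ x| ^ 2 := (sq_abs _).symm
          _ ≤ (K / m * |q x|) ^ 2 := by gcongr
          _ = _ := by rw [mul_pow, sq_abs, div_pow]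
      have s3 : ‖w x‖ ^ 2 ≤ massFn q ν a w x := le_add_of_nonneg_right (sq_nonneg _)
      have s4 : ‖ν‖ ^ 2 * (4 * M ^ 2 / (κ * γ)) * (X x ^ 2 * ‖w x‖ ^ 2)
          ≤ ‖ν‖ ^ 2 * c₁ * massFn q ν a w x := by
        calc _ ≤ ‖ν‖ ^ 2 * (4 * M ^ 2 / (κ * γ)) * (K ^ 2 * massFn q ν a w x) := by gcongr
          _ = _ := by rw [hc₁]; ring
      have s5 : ‖ν‖ * (5 / κ) * (X₁ x ^ 2 * ‖v x‖ ^ 2) ≤ ‖ν‖ ^ 2 * c₂ *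
          (q x ^ 2 * ‖w₁ x‖ ^ 2 + ‖ν‖ ^ 2 * q x ^ 4 * ‖w x‖ ^ 2) := by
        have h1 : ‖ν‖ ≤ ‖ν‖ ^ 2 := by nlinarith
        calc _ ≤ ‖ν‖ ^ 2 * (5 / κ) * (K ^ 2 / m ^ 2 * q x ^ 2 *
              (2 * (‖w₁ x‖ ^ 2 + ‖ν‖ ^ 2 * q x ^ 2 * ‖w x‖ ^ 2))) := by gcongr
          _ = _ := by rw [hc₂]; field_simp; ring
      exact add_le_add s4 s5
  rw [intervalIntegral.integral_const_mul, intervalIntegral.integral_add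
    (Continuous.intervalIntegrable (by fun_prop) _ _)
    (Continuous.intervalIntegrable (by fun_prop) _ _),
    intervalIntegral.integral_const_mul, intervalIntegral.integral_const_mul (‖ν‖ ^ 2 * c₂),
    ← hS, ← hZ] at key
  have h2 : ‖ν‖ ^ 2 * c₂ * Z ≤ ‖ν‖ ^ 2 * c₂ * (Cw * S) := by gcongr
  refine le_of_mul_le_mul_left (a := ‖ν‖ ^ 2 * (κ * γ / 8)) ?_ (by positivity)
  calc _ ≤ _ := key
    _ ≤ ‖ν‖ ^ 2 * c₁ * S + ‖ν‖ ^ 2 * c₂ * (Cw * S) := by gcongr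
    _ = _ := by field_simp

/-- The reduction `v = w' + ν q w` of a low-energy solution is bounded in `L²`. -/
theorem exists_firstOrder_le (h : IsPotential Lneg Lpos q q₁ q₂) {κ : ℝ} (hκ : 0 < κ)
    (hκ1 : κ ≤ 1) :
    ∃ C n₁, 0 < C ∧ ∀ (ν z a : ℂ) (w w₁ w₂ : ℝ → ℂ), n₁ ≤ ‖ν‖ →
      IsLowSol Lneg Lpos q (q₁ 0) κ ν z a w w₁ w₂ →
      ∫ x in (-Lneg)..Lpos, ‖w₁ x + ν * q x * w x‖ ^ 2
        ≤ C * ∫ x in (-Lneg)..Lpos, massFn q ν a w x := by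
  obtain ⟨X, X₁, X₂, K, hX, hX', hX2c, hXl, hXr, hK, hXb⟩ :=
    exists_cutoff h.Lneg_pos h.Lpos_pos
  have hXc : Continuous X := continuous_iff_continuousAt.2 fun x => (hX x).continuousAt
  have hX1c : Continuous X₁ := continuous_iff_continuousAt.2 fun x => (hX' x).continuousAt
  have hqc := h.continuous
  obtain ⟨C₁, n₁, hC₁, H1⟩ := h.exists_firstOrder_weighted_le hκ hκ1 hX hX1c hXl hXr hK
    fun x hx => ⟨(hXb x hx).1, (hXb x hx).2.1⟩
  obtain ⟨C₂, hC₂, H2⟩ := h.exists_weighted_energy_le hκ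
  -- `X 0 = 1` and `q` vanishes only at `0`, so `X² + q²` is bounded below: the cut-off estimate
  -- covers a neighbourhood of `0`, the weighted energy the rest.
  obtain ⟨x₀, hx₀, hmin⟩ := isCompact_Icc.exists_isMinOn ⟨0, h.zero_mem⟩
    (f := fun x => X x ^ 2 + q x ^ 2) (s := Icc (-Lneg) Lpos) (by fun_prop)
  set c := X x₀ ^ 2 + q x₀ ^ 2 with hc
  have hc0 : 0 < c := by
    by_cases h0 : x₀ = 0
    · have h1 := (hXb x₀ hx₀).2.2.2
      rw [h0] at h1
      have h2 : X 0 = 1 := by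
        have : |X 0 - 1| ≤ 0 := by simpa using h1
        linarith [abs_nonpos_iff.1 this]
      rw [hc, h0, h2]
      positivity
    · have := h.ne_zero x₀ hx₀ h0
      positivity
  refine ⟨(C₁ + 2 * C₂) / c, n₁, by positivity, fun ν z a w w₁ w₂ hn hw => ?_⟩
  have h1 := H1 ν z a w w₁ w₂ hn hw
  have h2 := H2 ν z a w w₁ w₂ hw
  have hwc := hw.continuous
  have hw1c := hw.continuous'
  have h3 : ∫ x in (-Lneg)..Lpos, c * ‖w₁ x + ν * q x * w x‖ ^ 2
      ≤ ∫ x in (-Lneg)..Lpos, (X x ^ 2 * ‖w₁ x + ν * q x * w x‖ ^ 2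
        + 2 * (q x ^ 2 * ‖w₁ x‖ ^ 2 + ‖ν‖ ^ 2 * q x ^ 4 * ‖w x‖ ^ 2)) := by
    refine intervalIntegral.integral_mono_on h.neg_lt.le
      (Continuous.intervalIntegrable (by fun_prop) _ _)
      (Continuous.intervalIntegrable (by fun_prop) _ _) fun x hx => ?_
    have e1 : c ≤ X x ^ 2 + q x ^ 2 := hmin hx
    have e2 := norm_add_mul_mul_sq_le ν (w₁ x) (w x) (q x)
    calc c * ‖w₁ x + ν * q x * w x‖ ^ 2
        ≤ (X x ^ 2 + q x ^ 2) * ‖w₁ x + ν * q x * w x‖ ^ 2 := by gcongr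
      _ = X x ^ 2 * ‖w₁ x + ν * q x * w x‖ ^ 2 + q x ^ 2 * ‖w₁ x + ν * q x * w x‖ ^ 2 := by ring
      _ ≤ X x ^ 2 * ‖w₁ x + ν * q x * w x‖ ^ 2
          + q x ^ 2 * (2 * (‖w₁ x‖ ^ 2 + ‖ν‖ ^ 2 * q x ^ 2 * ‖w x‖ ^ 2)) := by gcongr
      _ = _ := by ring
  rw [intervalIntegral.integral_const_mul, intervalIntegral.integral_add
    (Continuous.intervalIntegrable (by fun_prop) _ _)
    (Continuous.intervalIntegrable (by fun_prop) _ _),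
    intervalIntegral.integral_const_mul 2] at h3
  rw [div_mul_eq_mul_div, le_div_iff₀ hc0]
  linarith

end IsPotential

end FirstOrder

/-! ### Low-energy solutions are close to multiples of the WKB state -/

section Reduction

open scoped ComplexConjugate

theorem hasDerivAt_norm_sq {r r' : ℝ → ℂ} {x : ℝ} (h : HasDerivAt r (r' x) x) :
    HasDerivAt (fun x => ‖r x‖ ^ 2) (2 * (r' x * conj (r x)).re) x := by
  have h1 : HasDerivAt (fun x => conj (r x)) (conj (r' x)) x := h.star
  have h2 := Complex.reCLM.hasFDerivAt.comp_hasDerivAt x (h.mul h1)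
  have e : (fun x => ‖r x‖ ^ 2) = fun x => (r x * conj (r x)).re := by
    ext x
    rw [Complex.mul_conj, Complex.ofReal_re, Complex.normSq_eq_norm_sq]
  rw [e]
  refine h2.congr_deriv ?_
  simp only [Complex.reCLM_apply, Complex.add_re, Complex.mul_re, Complex.conj_re, Complex.conj_im]
  ring

/-- A quantitative form of the injectivity of `r ↦ r' + ν Q r` on functions vanishing at `0`. -/
theorem integral_sq_le_of_firstOrder {κ m b : ℝ} (hκ : 0 < κ) (hm : 0 < m) (hb : 0 ≤ b) {ν : ℂ}
    (hn0 : 0 < ‖ν‖) (hre : κ * ‖ν‖ ≤ ν.re) {Q : ℝ → ℝ} {r r' v : ℝ → ℂ} (hQc : Continuous Q)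
    (hvc : Continuous v) (hr : ∀ x, HasDerivAt r (r' x) x)
    (hrv : ∀ x, r' x = v x - ν * Q x * r x) (hr0 : r 0 = 0)
    (hQ : ∀ x ∈ Icc 0 b, m * x ≤ Q x) :
    ∫ x in (0 : ℝ)..b, ‖r x‖ ^ 2 ≤
      16 / (min (Real.exp (-1)) (2 * κ * m)) ^ 2 / ‖ν‖ * ∫ x in (0 : ℝ)..b, ‖v x‖ ^ 2 := by
  set c := min (Real.exp (-1)) (2 * κ * m) with hc
  have hc0 : 0 < c := lt_min (Real.exp_pos _) (by positivity)
  set p := √‖ν‖ with hp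
  have hp0 : 0 < p := Real.sqrt_pos.2 hn0
  have hp2 : p ^ 2 = ‖ν‖ := Real.sq_sqrt hn0.le
  have hrc := continuous_of_hasDerivAt hr
  have hr'c : Continuous r' := by
    rw [funext hrv]
    fun_prop
  have hcr : Continuous fun x => conj (r x) := Complex.continuous_conj.comp hrc
  -- The multiplier `1 + e^{-px}` with `p = ‖ν‖^{1/2}`: its derivative gives damping of order `p`
  -- for `x ≤ 1/p`, where the damping `Re ν Q` degenerates, while for `x ≥ 1/p` the latter is at
  -- least of order `p`.
  have hd : ∀ x, HasDerivAt (fun x => (1 + Real.exp (-(p * x))) * ‖r x‖ ^ 2)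
      (-(p * Real.exp (-(p * x))) * ‖r x‖ ^ 2
        + (1 + Real.exp (-(p * x))) * (2 * (r' x * conj (r x)).re)) x := fun x => by
    have h1 : HasDerivAt (fun x => 1 + Real.exp (-(p * x))) (-(p * Real.exp (-(p * x)))) x :=
      (((hasDerivAt_id x).const_mul p).neg.exp.const_add 1).congr_deriv (by simp; ring)
    exact h1.mul (hasDerivAt_norm_sq (hr x))
  have i1 := intervalIntegral.integral_eq_sub_of_hasDerivAt (a := 0) (b := b) (fun x _ => hd x)
    (Continuous.intervalIntegrable (by fun_prop) _ _)
  simp only [hr0, norm_zero, zero_pow two_ne_zero, mul_zero, sub_zero] at i1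
  have i2 : 0 ≤ (1 + Real.exp (-(p * b))) * ‖r b‖ ^ 2 := by positivity
  rw [← i1] at i2
  set J := ∫ x in (0 : ℝ)..b, (-(p * Real.exp (-(p * x))) * ‖r x‖ ^ 2
    + (1 + Real.exp (-(p * x))) * (2 * (r' x * conj (r x)).re)) with hJ
  have key : ∫ x in (0 : ℝ)..b, (-(p * Real.exp (-(p * x))) * ‖r x‖ ^ 2
        + (1 + Real.exp (-(p * x))) * (2 * (r' x * conj (r x)).re))
      ≤ ∫ x in (0 : ℝ)..b, (-(c * p / 2) * ‖r x‖ ^ 2 + 8 / (c * p) * ‖v x‖ ^ 2) := by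
    refine intervalIntegral.integral_mono_on hb (Continuous.intervalIntegrable (by fun_prop) _ _)
      (Continuous.intervalIntegrable (by fun_prop) _ _) fun x hx => ?_
    have hx0 := hx.1
    have e1 : (r' x * conj (r x)).re = (v x * conj (r x)).re - ν.re * (Q x * ‖r x‖ ^ 2) := by
      rw [hrv, sub_mul, Complex.sub_re, mul_assoc (ν * (Q x : ℂ)), Complex.mul_conj,
        Complex.normSq_eq_norm_sq, mul_assoc ν, ← Complex.ofReal_mul, Complex.re_mul_ofReal]
    have e2 : (v x * conj (r x)).re ≤ ‖v x‖ * ‖r x‖ := by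
      refine (Complex.re_le_norm _).trans_eq ?_
      simp
    have e3 : κ * ‖ν‖ * (m * x * ‖r x‖ ^ 2) ≤ ν.re * (Q x * ‖r x‖ ^ 2) := by
      have := hQ x hx
      have h0 : 0 ≤ ν.re := le_trans (by positivity) hre
      gcongr
    set E := Real.exp (-(p * x)) with hE
    have hE0 : 0 ≤ E := (Real.exp_pos _).le
    have hE1 : E ≤ 1 := Real.exp_le_one_iff.2 (by simp only [Left.neg_nonpos_iff]; positivity)
    have e4 : c ≤ E + 2 * κ * m * (p * x) := by
      rcases le_total (p * x) 1 with h | h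
      · have : Real.exp (-1) ≤ E := Real.exp_le_exp.2 (by linarith)
        have h3 : 0 ≤ 2 * κ * m * (p * x) := by positivity
        linarith [min_le_left (Real.exp (-1)) (2 * κ * m)]
      · have h3 : 2 * κ * m * 1 ≤ 2 * κ * m * (p * x) := by gcongr
        linarith [min_le_right (Real.exp (-1)) (2 * κ * m)]
    have e5 : 0 ≤ ‖v x‖ * ‖r x‖ := by positivity
    have e6 : (1 + E) * (2 * (v x * conj (r x)).re) ≤ 4 * (‖v x‖ * ‖r x‖) := by
      calc _ ≤ (1 + E) * (2 * (‖v x‖ * ‖r x‖)) := by gcongr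
        _ ≤ (1 + 1) * (2 * (‖v x‖ * ‖r x‖)) := by gcongr
        _ = _ := by ring
    have e7 : 4 * (‖v x‖ * ‖r x‖) ≤ c * p / 2 * ‖r x‖ ^ 2 + 8 / (c * p) * ‖v x‖ ^ 2 := by
      have h1 : 0 ≤ c * p / 2 * (‖r x‖ - 4 / (c * p) * ‖v x‖) ^ 2 := by positivity
      have h2 : c * p / 2 * (‖r x‖ - 4 / (c * p) * ‖v x‖) ^ 2
          = c * p / 2 * ‖r x‖ ^ 2 - 4 * (‖v x‖ * ‖r x‖) + 8 / (c * p) * ‖v x‖ ^ 2 := by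
        field_simp
        ring
      linarith
    have e8 : p * c * ‖r x‖ ^ 2 ≤ p * (E + 2 * κ * m * (p * x)) * ‖r x‖ ^ 2 := by gcongr
    have e9 : 0 ≤ E * (κ * ‖ν‖ * (m * x * ‖r x‖ ^ 2)) := by positivity
    have e10 : E * (κ * ‖ν‖ * (m * x * ‖r x‖ ^ 2)) ≤ E * (ν.re * (Q x * ‖r x‖ ^ 2)) := by gcongr
    rw [e1]
    have e11 : p * (2 * κ * m * (p * x)) * ‖r x‖ ^ 2 = 2 * (κ * ‖ν‖ * (m * x * ‖r x‖ ^ 2)) := by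
      rw [← hp2]
      ring
    linarith
  rw [← hJ, intervalIntegral.integral_add (Continuous.intervalIntegrable (by fun_prop) _ _)
    (Continuous.intervalIntegrable (by fun_prop) _ _),
    intervalIntegral.integral_const_mul, intervalIntegral.integral_const_mul (8 / _)] at key
  have h1 : c * p / 2 * (∫ x in (0 : ℝ)..b, ‖r x‖ ^ 2)
      ≤ 8 / (c * p) * ∫ x in (0 : ℝ)..b, ‖v x‖ ^ 2 := by linarith
  refine le_of_mul_le_mul_left (a := c * p / 2) ?_ (by positivity)
  refine h1.trans_eq ?_
  rw [← hp2]
  field_simp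
  ring

variable {Lneg Lpos : ℝ} {q q₁ q₂ : ℝ → ℝ}

namespace IsPotential

theorem lower_pos {m : ℝ} (hm : ∀ x ∈ Icc (-Lneg) Lpos, m * x ^ 2 ≤ x * q x)
    {x : ℝ} (hx : x ∈ Icc (-Lneg) Lpos) (h0 : 0 < x) : m * x ≤ q x := by
  have := hm x hx
  refine le_of_mul_le_mul_left ?_ h0
  linarith

/-- `w` and `w - w(0) e^{-νδ}` have the same image `v` under `∂ + ν q`, and the second vanishes at
`0`. The first-order estimate applies on each side of `0`, on the left after the reflection `x ↦
-x`, and gains `‖ν‖^{-1/2}` in norm. -/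
theorem exists_approx (h : IsPotential Lneg Lpos q q₁ q₂) {κ : ℝ} (hκ : 0 < κ) (hκ1 : κ ≤ 1) :
    ∃ C n₁, 0 < C ∧ ∀ (ν z a : ℂ) (w w₁ w₂ : ℝ → ℂ), n₁ ≤ ‖ν‖ →
      IsLowSol Lneg Lpos q (q₁ 0) κ ν z a w w₁ w₂ →
      ∫ x in (-Lneg)..Lpos, ‖w x - w 0 * wkb q ν x‖ ^ 2
        ≤ C / ‖ν‖ * ∫ x in (-Lneg)..Lpos, massFn q ν a w x := by
  obtain ⟨C, n₁, hC, H⟩ := h.exists_firstOrder_le hκ hκ1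
  obtain ⟨m, hm0, hmγ, hm⟩ := h.exists_lower
  set c := min (Real.exp (-1)) (2 * κ * m) with hc
  have hc0 : 0 < c := lt_min (Real.exp_pos _) (by positivity)
  refine ⟨16 / c ^ 2 * C, n₁, by positivity, fun ν z a w w₁ w₂ hn hw => ?_⟩
  have H := H ν z a w w₁ w₂ hn hw
  have hwc := hw.continuous
  have hw1c := hw.continuous'
  have hqc := h.continuous
  have hgc := h.continuous_wkb ν
  have hn0 : 0 < ‖ν‖ := by linarith [hw.one_le]
  set r : ℝ → ℂ := fun x => w x - w 0 * wkb q ν x with hr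
  have hrd : ∀ x, HasDerivAt r (w₁ x - w 0 * -(ν * q x * wkb q ν x)) x := fun x =>
    (hw.hasDerivAt x).sub ((h.hasDerivAt_wkb ν x).const_mul (w 0))
  have hr0 : r 0 = 0 := by simp [hr, wkb, agmon]
  set v : ℝ → ℂ := fun x => w₁ x + ν * q x * w x with hv
  have hvc : Continuous v := by fun_prop
  have hrc : Continuous r := continuous_of_hasDerivAt hrd
  have p1 := integral_sq_le_of_firstOrder hκ hm0 h.Lpos_pos.le hn0 hw.re_le hqc hvc hrd
    (fun x => by simp only [hv, hr]; ring) hr0 fun x hx => by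
      rcases hx.1.eq_or_lt with h0 | h0
      · rw [← h0, h.zero, mul_zero]
      · exact lower_pos hm ⟨by linarith [h.Lneg_pos], hx.2⟩ h0
  have p2 := integral_sq_le_of_firstOrder hκ hm0 h.Lneg_pos.le hn0 hw.re_le
    (Q := fun x => -q (-x)) (v := fun x => -v (-x)) (r := fun x => r (-x))
    (r' := fun x => -(w₁ (-x) - w 0 * -(ν * q (-x) * wkb q ν (-x)))) (by fun_prop) (by fun_prop)
    (fun x => ((hrd (-x)).scomp x (hasDerivAt_neg x)).congr_deriv
      (by rw [neg_one_smul]))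
    (fun x => by simp only [hv, hr]; push_cast; ring) (by simpa using hr0) fun x hx => by
      rcases hx.1.eq_or_lt with h0 | h0
      · rw [← h0, neg_zero, h.zero, mul_zero, neg_zero]
      · have := hm (-x) ⟨by linarith [hx.2], by linarith [h.Lpos_pos]⟩
        refine le_of_mul_le_mul_left ?_ h0
        linarith
  simp only [norm_neg] at p2
  rw [intervalIntegral.integral_comp_neg (fun x => ‖r x‖ ^ 2),
    intervalIntegral.integral_comp_neg (fun x => ‖v x‖ ^ 2), neg_zero] at p2
  have s1 := intervalIntegral.integral_add_adjacent_intervals (μ := volume) (a := -Lneg) (b := 0)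
    (c := Lpos) (f := fun x => ‖r x‖ ^ 2) (Continuous.intervalIntegrable (by fun_prop) _ _)
    (Continuous.intervalIntegrable (by fun_prop) _ _)
  have s2 := intervalIntegral.integral_add_adjacent_intervals (μ := volume) (a := -Lneg) (b := 0)
    (c := Lpos) (f := fun x => ‖v x‖ ^ 2) (Continuous.intervalIntegrable (by fun_prop) _ _)
    (Continuous.intervalIntegrable (by fun_prop) _ _)
  rw [← s1]
  calc _ ≤ 16 / c ^ 2 / ‖ν‖ * ∫ x in (-Lneg)..Lpos, ‖v x‖ ^ 2 := by
        rw [← s2, mul_add]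
        exact add_le_add p2 p1
    _ ≤ 16 / c ^ 2 / ‖ν‖ * (C * ∫ x in (-Lneg)..Lpos, massFn q ν a w x) := by gcongr
    _ = _ := by field_simp

/-- The WKB state `e^{-νδ}` as an element of `L²(I)`. -/
def wkbL (h : IsPotential Lneg Lpos q q₁ q₂) (ν : ℂ) : L2I Lneg Lpos :=
  ofCont Lneg Lpos (wkb q ν) (h.continuous_wkb ν)

/-- Solutions of `(P_ν - z) u = a e^{-νδ}` for `z` in the low-energy disk are close to multiples of
`e^{-νδ}`. -/
theorem exists_norm_sub_wkbL_le (h : IsPotential Lneg Lpos q q₁ q₂) {κ : ℝ} (hκ : 0 < κ)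
    (hκ1 : κ ≤ 1) :
    ∃ C n₁, 0 < C ∧ 1 ≤ n₁ ∧ ∀ (ν z a : ℂ) (u : L2I Lneg Lpos), n₁ ≤ ‖ν‖ → κ * ‖ν‖ ≤ ν.re →
      ‖z - (q₁ 0 : ℂ) * ν‖ ≤ q₁ 0 * ‖ν‖ →
      (u, z • u + a • h.wkbL ν) ∈ schrodingerGraph Lneg Lpos q ν →
      ∃ c : ℂ, ‖u - c • h.wkbL ν‖ ≤ C / √‖ν‖ * (‖u‖ + ‖a‖ * ‖h.wkbL ν‖ / ‖ν‖) := by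
  obtain ⟨C, n₁, hC, H⟩ := h.exists_approx hκ hκ1
  refine ⟨√C, max n₁ 1, Real.sqrt_pos.2 hC, le_max_right _ _, fun ν z a u hn hre hz hu => ?_⟩
  have hn1 : 1 ≤ ‖ν‖ := (le_max_right _ _).trans hn
  have hgc := h.continuous_wkb ν
  have hfc : Continuous fun x => -a * wkb q ν x := by fun_prop
  have e1 : z • u + a • h.wkbL ν = z • u - ofCont Lneg Lpos (fun x => -a * wkb q ν x) hfc := by
    have : ofCont Lneg Lpos (fun x => -a * wkb q ν x) hfc = (-a) • h.wkbL ν := by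
      rw [wkbL, ← ofCont_smul]
    rw [this, neg_smul, sub_neg_eq_add]
  rw [e1] at hu
  obtain ⟨U, U₁, U₂, hU, huU, heq⟩ := exists_classical h.neg_lt h.continuous hfc hu
  have hUc := hU.continuous
  have hw : IsLowSol Lneg Lpos q (q₁ 0) κ ν z a U U₁ U₂ :=
    { hU with
      one_le := hn1
      re_le := hre
      z_le := hz
      eq := fun x hx => by rw [heq x hx]; ring }
  have H := H ν z a U U₁ U₂ ((le_max_left _ _).trans hn) hw
  have e2 : u - U 0 • h.wkbL ν
      = ofCont Lneg Lpos (fun x => U x - U 0 * wkb q ν x) (by fun_prop) := by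
    rw [huU, wkbL, ← ofCont_smul, sub_eq_iff_eq_add, ← ofCont_add]
    exact ofCont_congr fun x _ => by ring
  refine ⟨U 0, ?_⟩
  have e3 : ∫ x in (-Lneg)..Lpos, massFn q ν a U x
      = ‖u‖ ^ 2 + (‖a‖ * ‖h.wkbL ν‖ / ‖ν‖) ^ 2 := by
    unfold massFn
    rw [intervalIntegral.integral_add (Continuous.intervalIntegrable (by fun_prop) _ _)
      (Continuous.intervalIntegrable (by fun_prop) _ _), huU, norm_sq_ofCont, wkbL,
      div_pow, mul_pow, norm_sq_ofCont, setIntegral_Ioo_eq_intervalIntegral h.neg_lt.le,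
      setIntegral_Ioo_eq_intervalIntegral h.neg_lt.le]
    congr 1
    rw [← intervalIntegral.integral_const_mul, ← intervalIntegral.integral_div]
    refine intervalIntegral.integral_congr fun x _ => ?_
    simp only [norm_mul]
    ring
  refine abs_le_of_sq_le_sq' ?_ (by positivity) |>.2
  rw [e2, norm_sq_ofCont, setIntegral_Ioo_eq_intervalIntegral h.neg_lt.le]
  refine H.trans ?_
  rw [e3, mul_pow, div_pow √C, Real.sq_sqrt hC.le, Real.sq_sqrt (by positivity)]
  gcongr
  have h1 : 0 ≤ ‖a‖ * ‖h.wkbL ν‖ / ‖ν‖ := by positivity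
  nlinarith [norm_nonneg u]

end IsPotential

end Reduction

/-! ### The WKB state -/

section WKB

open scoped ComplexConjugate

theorem norm_ofCont_mono {Lneg Lpos : ℝ} {f g : ℝ → ℂ} (hf : Continuous f) (hg : Continuous g)
    (h : ∀ x ∈ Ioo (-Lneg) Lpos, ‖f x‖ ≤ ‖g x‖) :
    ‖ofCont Lneg Lpos f hf‖ ≤ ‖ofCont Lneg Lpos g hg‖ := by
  refine Lp.norm_le_norm_of_ae_le ?_
  filter_upwards [coeFn_ofCont hf, coeFn_ofCont hg,
    (ae_restrict_iff' measurableSet_Ioo).2 (Filter.Eventually.of_forall h)] with x h1 h2 h3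
  rwa [h1, h2]

theorem norm_cexp_sub_cexp_le {A B : ℂ} {R : ℝ} (hA : A.re ≤ R) (hB : B.re ≤ R) :
    ‖Complex.exp A - Complex.exp B‖ ≤ Real.exp R * ‖A - B‖ := by
  have hc : Convex ℝ {z : ℂ | z.re ≤ R} := convex_halfSpace_re_le R
  refine hc.norm_image_sub_le_of_norm_hasDerivWithin_le (f' := Complex.exp)
    (fun z _ => (Complex.hasDerivAt_exp z).hasDerivWithinAt) (fun z hz => ?_) hB hA
  rw [Complex.norm_exp]
  exact Real.exp_le_exp.2 hz

theorem abs_pow_three_mul_exp_le {s : ℝ} (hs : 0 < s) (x : ℝ) :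
    |x| ^ 3 * Real.exp (-(s ^ 2) * x ^ 2) ≤ 4 / s ^ 3 * Real.exp (-(s ^ 2 / 2) * x ^ 2) := by
  set t := s * |x| with ht
  have ht0 : 0 ≤ t := by positivity
  have h1 := Real.quadratic_le_exp_of_nonneg (x := t ^ 2 / 2) (by positivity)
  have h2 : t ^ 3 ≤ 4 * Real.exp (t ^ 2 / 2) := by
    have h3 : 0 ≤ t ^ 2 * (t - 1) ^ 2 := by positivity
    nlinarith [sq_nonneg t]
  have e1 : t ^ 2 = s ^ 2 * x ^ 2 := by rw [ht, mul_pow, sq_abs]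
  have e2 : Real.exp (-(s ^ 2 / 2) * x ^ 2)
      = Real.exp (t ^ 2 / 2) * Real.exp (-(s ^ 2) * x ^ 2) := by
    rw [← Real.exp_add, e1]
    congr 1
    ring
  rw [e2, div_mul_eq_mul_div, le_div_iff₀ (by positivity)]
  have e3 : t ^ 3 = |x| ^ 3 * s ^ 3 := by rw [ht]; ring
  rw [e3] at h2
  have := Real.exp_pos (-(s ^ 2) * x ^ 2)
  nlinarith

theorem norm_integral_gaussian_complex {b : ℂ} (hb : 0 < b.re) :
    ‖∫ x : ℝ, Complex.exp (-b * (x : ℂ) ^ 2)‖ = √Real.pi / √‖b‖ := by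
  rw [integral_gaussian_complex hb]
  have h := Complex.norm_cpow_real ((Real.pi : ℂ) / b) (1 / 2)
  push_cast at h
  rw [h, norm_div, Complex.norm_real, Real.norm_of_nonneg Real.pi_pos.le, ← Real.sqrt_eq_rpow,
    Real.sqrt_div' _ (norm_nonneg _)]

variable {Lneg Lpos : ℝ} {q q₁ q₂ : ℝ → ℝ}

theorem norm_wkb (q : ℝ → ℝ) (ν : ℂ) (x : ℝ) :
    ‖wkb q ν x‖ = Real.exp (-(ν.re * agmon q x)) := by
  rw [wkb, Complex.norm_exp, Complex.neg_re, Complex.re_mul_ofReal]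

namespace IsPotential

/-- Integrate the derivative of `x ‖g‖²`: the boundary terms have a favourable sign, and `x q ≥ m
x²`. -/
theorem exists_norm_coord_wkb_le (h : IsPotential Lneg Lpos q q₁ q₂) {κ : ℝ} (hκ : 0 < κ) :
    ∃ C, 0 < C ∧ ∀ ν : ℂ, 0 < ‖ν‖ → κ * ‖ν‖ ≤ ν.re →
      ‖ofCont Lneg Lpos (fun x => x * wkb q ν x)
        (by have := h.continuous_wkb ν; fun_prop)‖ ≤ C / √‖ν‖ * ‖h.wkbL ν‖ := by
  obtain ⟨m, hm0, hmγ, hm⟩ := h.exists_lower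
  refine ⟨1 / √(2 * κ * m), by positivity, fun ν hn0 hre => ?_⟩
  have hgc := h.continuous_wkb ν
  have hqc := h.continuous
  have hcg : Continuous fun x => conj (wkb q ν x) := Complex.continuous_conj.comp hgc
  have hd : ∀ x, HasDerivAt (fun x => x * ‖wkb q ν x‖ ^ 2)
      (‖wkb q ν x‖ ^ 2 - 2 * ν.re * (x * q x * ‖wkb q ν x‖ ^ 2)) x := fun x => by
    have h1 := (hasDerivAt_id x).mul (hasDerivAt_norm_sq (r := wkb q ν)
      (r' := fun x => -(ν * q x * wkb q ν x)) (h.hasDerivAt_wkb ν x))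
    refine h1.congr_deriv ?_
    simp only [id]
    rw [neg_mul, mul_assoc (ν * (q x : ℂ)), Complex.mul_conj, Complex.normSq_eq_norm_sq,
      mul_assoc ν, ← Complex.ofReal_mul, Complex.neg_re, Complex.re_mul_ofReal]
    ring
  have i1 := intervalIntegral.integral_eq_sub_of_hasDerivAt (a := -Lneg) (b := Lpos)
    (fun x _ => hd x) (Continuous.intervalIntegrable (by fun_prop) _ _)
  have i2 : 0 ≤ Lpos * ‖wkb q ν Lpos‖ ^ 2 - -Lneg * ‖wkb q ν (-Lneg)‖ ^ 2 := by
    have := h.Lneg_pos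
    have := h.Lpos_pos
    rw [neg_mul, sub_neg_eq_add]
    positivity
  rw [← i1, intervalIntegral.integral_sub (Continuous.intervalIntegrable (by fun_prop) _ _)
    (Continuous.intervalIntegrable (by fun_prop) _ _)] at i2
  have i3 : ∫ x in (-Lneg)..Lpos, 2 * (κ * ‖ν‖) * m * ‖x * wkb q ν x‖ ^ 2
      ≤ ∫ x in (-Lneg)..Lpos, 2 * ν.re * (x * q x * ‖wkb q ν x‖ ^ 2) := by
    refine intervalIntegral.integral_mono_on h.neg_lt.le
      (Continuous.intervalIntegrable (by fun_prop) _ _)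
      (Continuous.intervalIntegrable (by fun_prop) _ _) fun x hx => ?_
    rw [norm_mul, mul_pow, Complex.norm_real, Real.norm_eq_abs, sq_abs]
    have h1 := hm x hx
    have h2 : 0 ≤ ν.re := le_trans (by positivity) hre
    have h3 : 0 ≤ x * q x := le_trans (by positivity) h1
    calc 2 * (κ * ‖ν‖) * m * (x ^ 2 * ‖wkb q ν x‖ ^ 2)
        = 2 * (κ * ‖ν‖) * (m * x ^ 2 * ‖wkb q ν x‖ ^ 2) := by ring
      _ ≤ _ := by gcongr
  rw [intervalIntegral.integral_const_mul, ← setIntegral_Ioo_eq_intervalIntegral h.neg_lt.le,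
    ← norm_sq_ofCont (Lneg := Lneg) (Lpos := Lpos) (f := fun x => x * wkb q ν x)
      (by fun_prop)] at i3
  rw [← setIntegral_Ioo_eq_intervalIntegral h.neg_lt.le, ← norm_sq_ofCont hgc] at i2
  refine abs_le_of_sq_le_sq' ?_ (by positivity) |>.2
  rw [mul_pow, div_pow (1 / _), div_pow, Real.sq_sqrt (by positivity), Real.sq_sqrt (by positivity),
    div_div, one_pow, one_div, inv_mul_eq_div, le_div_iff₀ (by positivity), wkbL]
  linarith

theorem norm_wkb_sq_le (h : IsPotential Lneg Lpos q q₁ q₂) {κ m : ℝ} (hκ : 0 < κ) (hm0 : 0 < m)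
    (hm : ∀ x ∈ Icc (-Lneg) Lpos, m * x ^ 2 ≤ x * q x) {ν : ℂ} (hre : κ * ‖ν‖ ≤ ν.re) {x : ℝ}
    (hx : x ∈ Icc (-Lneg) Lpos) :
    ‖wkb q ν x‖ ^ 2 ≤ Real.exp (-(κ * m * ‖ν‖) * x ^ 2) := by
  rw [norm_wkb, ← Real.exp_nat_mul]
  refine Real.exp_le_exp.2 ?_
  have h1 := h.agmon_lower hm hx
  have h2 : κ * ‖ν‖ * (m * x ^ 2 / 2) ≤ ν.re * agmon q x := by
    have := norm_nonneg ν
    have h2 : 0 ≤ ν.re := le_trans (by positivity) hre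
    gcongr
  push_cast
  linarith

theorem exists_norm_sq_wkbL_le (h : IsPotential Lneg Lpos q q₁ q₂) {κ : ℝ} (hκ : 0 < κ) :
    ∃ C, 0 < C ∧ ∀ ν : ℂ, 0 < ‖ν‖ → κ * ‖ν‖ ≤ ν.re → ‖h.wkbL ν‖ ^ 2 ≤ C / √‖ν‖ := by
  obtain ⟨m, hm0, hmγ, hm⟩ := h.exists_lower
  refine ⟨√(Real.pi / (κ * m)), Real.sqrt_pos.2 (by positivity), fun ν hn0 hre => ?_⟩
  have hgc := h.continuous_wkb ν
  have hint := integrable_exp_neg_mul_sq (b := κ * m * ‖ν‖) (by positivity)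
  rw [wkbL, norm_sq_ofCont, ← Real.sqrt_div' _ hn0.le, div_div, ← integral_gaussian (κ * m * ‖ν‖)]
  refine le_trans ?_ (setIntegral_le_integral (s := Ioo (-Lneg) Lpos) hint
    (Filter.Eventually.of_forall fun x => (Real.exp_pos _).le))
  refine setIntegral_mono_on ?_ hint.integrableOn measurableSet_Ioo fun x hx =>
    h.norm_wkb_sq_le hκ hm0 hm hre (Ioo_subset_Icc_self hx)
  exact (hgc.norm.pow 2).integrableOn_Icc.mono_set Ioo_subset_Icc_self

/-- Both exponents have real part at most `-κ m ‖ν‖ x²` on the interval, and they differ by `O(‖ν‖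
|x|³)`. Outside the interval only the Gaussian tail is left, and `‖ν‖ |x|³` is bounded below, so the
same bound serves. -/
theorem exists_norm_sub_gaussian_le (h : IsPotential Lneg Lpos q q₁ q₂) {κ m : ℝ} (hκ : 0 < κ)
    (hm0 : 0 < m) (hmγ : m ≤ q₁ 0) (hm : ∀ x ∈ Icc (-Lneg) Lpos, m * x ^ 2 ≤ x * q x) :
    ∃ K, 0 < K ∧ ∀ ν : ℂ, 1 ≤ ‖ν‖ → κ * ‖ν‖ ≤ ν.re → ∀ x : ℝ,
      ‖(Ioo (-Lneg) Lpos).indicator (fun x => wkb q ν x * wkb q ν x) x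
        - Complex.exp (-(ν * (q₁ 0 : ℂ)) * (x : ℂ) ^ 2)‖
      ≤ K * ‖ν‖ * (|x| ^ 3 * Real.exp (-(κ * m * ‖ν‖) * x ^ 2)) := by
  obtain ⟨M, hM1, hM⟩ := h.exists_upper
  set L := min Lneg Lpos with hL
  have hL0 : 0 < L := lt_min h.Lneg_pos h.Lpos_pos
  refine ⟨2 * M + 1 / L ^ 3, by positivity, fun ν hn1 hre x => ?_⟩
  have hn0 : 0 < ‖ν‖ := by linarith
  have hre0 : 0 ≤ ν.re := le_trans (by positivity) hre
  have hB : (-(ν * (q₁ 0 : ℂ)) * (x : ℂ) ^ 2).re ≤ -(κ * m * ‖ν‖) * x ^ 2 := by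
    have : (-(ν * (q₁ 0 : ℂ)) * (x : ℂ) ^ 2).re = -(ν.re * q₁ 0 * x ^ 2) := by
      rw [show -(ν * (q₁ 0 : ℂ)) * (x : ℂ) ^ 2 = -(ν * ((q₁ 0 * x ^ 2 : ℝ) : ℂ)) by push_cast; ring,
        Complex.neg_re, Complex.re_mul_ofReal]
      ring
    rw [this]
    have h1 : κ * ‖ν‖ * m * x ^ 2 ≤ ν.re * q₁ 0 * x ^ 2 := by gcongr
    linarith
  set E := Real.exp (-(κ * m * ‖ν‖) * x ^ 2) with hE
  by_cases hx : x ∈ Ioo (-Lneg) Lpos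
  · have hx' := Ioo_subset_Icc_self hx
    obtain ⟨-, -, -, -, -, hδ, -⟩ := hM x hx'
    rw [indicator_of_mem hx, wkb, ← Complex.exp_add]
    have hA : (-(ν * (agmon q x : ℂ)) + -(ν * (agmon q x : ℂ))).re ≤ -(κ * m * ‖ν‖) * x ^ 2 := by
      rw [Complex.add_re, Complex.neg_re, Complex.re_mul_ofReal]
      have h2 : κ * ‖ν‖ * (m * x ^ 2 / 2) ≤ ν.re * agmon q x := by
        have := h.agmon_lower hm hx'
        gcongr
      linarith
    refine (norm_cexp_sub_cexp_le hA hB).trans ?_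
    have e : -(ν * (agmon q x : ℂ)) + -(ν * (agmon q x : ℂ)) - -(ν * (q₁ 0 : ℂ)) * (x : ℂ) ^ 2
        = -(2 * ν * ((agmon q x - q₁ 0 * x ^ 2 / 2 : ℝ) : ℂ)) := by
      push_cast
      ring
    rw [e, norm_neg, norm_mul, norm_mul, Complex.norm_real, Real.norm_eq_abs, Complex.norm_two]
    calc E * (2 * ‖ν‖ * |agmon q x - q₁ 0 * x ^ 2 / 2|) ≤ E * (2 * ‖ν‖ * (M * |x| ^ 3)) := by gcongr
      _ = 2 * M * ‖ν‖ * (|x| ^ 3 * E) := by ring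
      _ ≤ _ := by
        gcongr
        have : 0 ≤ 1 / L ^ 3 := by positivity
        linarith
  · rw [indicator_of_notMem hx, zero_sub, norm_neg, Complex.norm_exp]
    have hxL : L ≤ |x| := by
      rw [mem_Ioo, not_and_or, not_lt, not_lt] at hx
      rcases hx with hx | hx
      · have := min_le_left Lneg Lpos
        linarith [neg_le_abs x]
      · have := min_le_right Lneg Lpos
        linarith [le_abs_self x]
    have h1 : Real.exp (-(ν * (q₁ 0 : ℂ)) * (x : ℂ) ^ 2).re ≤ E := Real.exp_le_exp.2 hB
    have h2 : 1 ≤ 1 / L ^ 3 * ‖ν‖ * |x| ^ 3 := by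
      have : L ^ 3 * 1 ≤ |x| ^ 3 * ‖ν‖ := by gcongr
      rw [one_div, inv_mul_eq_div, div_mul_eq_mul_div, le_div_iff₀ (by positivity)]
      linarith
    have h3 : 0 ≤ 2 * M * ‖ν‖ * |x| ^ 3 := by positivity
    have h4 : 1 * E ≤ ((2 * M + 1 / L ^ 3) * ‖ν‖ * |x| ^ 3) * E := by
      gcongr
      linarith
    linarith

/-- The complex Gaussian integral has modulus `(π / (q'(0) ‖ν‖))^{1/2}`, with no loss from
oscillation, and replacing `e^{-2νδ}` by the Gaussian costs only `O(1/‖ν‖)`. Since `‖e^{-νδ}‖²` is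
at most of order `‖ν‖^{-1/2}`, the ratio stays away from `0`. -/
theorem exists_le_norm_bil_wkbL (h : IsPotential Lneg Lpos q q₁ q₂) {κ : ℝ} (hκ : 0 < κ) :
    ∃ c n₁, 0 < c ∧ 1 ≤ n₁ ∧ ∀ ν : ℂ, n₁ ≤ ‖ν‖ → κ * ‖ν‖ ≤ ν.re →
      c * ‖h.wkbL ν‖ ^ 2 ≤ ‖bil Lneg Lpos (h.wkbL ν) (h.wkbL ν)‖ := by
  obtain ⟨m, hm0, hmγ, hm⟩ := h.exists_lower
  obtain ⟨A, hA0, hA⟩ := h.exists_norm_sq_wkbL_le hκ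
  obtain ⟨K, hK0, hK⟩ := h.exists_norm_sub_gaussian_le hκ hm0 hmγ hm
  have hγ := h.deriv_pos
  set T := √Real.pi / √(q₁ 0) with hT
  have hT0 : 0 < T := div_pos (Real.sqrt_pos.2 Real.pi_pos) (Real.sqrt_pos.2 hγ)
  set C' := 4 * K * √(2 * Real.pi) / (κ * m) ^ 2 with hC'
  have hC'0 : 0 ≤ C' := by positivity
  refine ⟨T / (2 * A), max 1 ((2 * C' / T) ^ 2), by positivity, le_max_left _ _,
    fun ν hn hre => ?_⟩
  have hn1 : 1 ≤ ‖ν‖ := (le_max_left _ _).trans hn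
  have hn0 : 0 < ‖ν‖ := by linarith
  have hgc := h.continuous_wkb ν
  set D : ℝ → ℂ := fun x => (Ioo (-Lneg) Lpos).indicator (fun x => wkb q ν x * wkb q ν x) x
        - Complex.exp (-(ν * (q₁ 0 : ℂ)) * (x : ℂ) ^ 2) with hD
  have hb0 : 0 < (ν * (q₁ 0 : ℂ)).re := by
    rw [Complex.re_mul_ofReal]
    have : 0 < ν.re := lt_of_lt_of_le (by positivity) hre
    positivity
  have e1 : ∫ x, D x = bil Lneg Lpos (h.wkbL ν) (h.wkbL ν)
      - ∫ x : ℝ, Complex.exp (-(ν * (q₁ 0 : ℂ)) * (x : ℂ) ^ 2) := by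
    rw [wkbL, bil_ofCont, ← integral_indicator measurableSet_Ioo]
    refine integral_sub ?_ (integrable_cexp_neg_mul_sq hb0)
    rw [integrable_indicator_iff measurableSet_Ioo]
    exact (hgc.mul hgc).integrableOn_Icc.mono_set Ioo_subset_Icc_self
  set s := √(κ * m * ‖ν‖) with hs
  have hs0 : 0 < s := Real.sqrt_pos.2 (by positivity)
  have hs2 : s ^ 2 = κ * m * ‖ν‖ := Real.sq_sqrt (by positivity)
  have e2 : ‖∫ x, D x‖ ≤ C' / ‖ν‖ := by
    have hi := (integrable_exp_neg_mul_sq (b := s ^ 2 / 2) (by positivity)).const_mul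
      (K * ‖ν‖ * (4 / s ^ 3))
    refine (norm_integral_le_of_norm_le hi (Filter.Eventually.of_forall fun x => ?_)).trans_eq ?_
    · refine (hK ν hn1 hre x).trans ?_
      rw [← hs2, mul_assoc (K * ‖ν‖)]
      exact mul_le_mul_of_nonneg_left (abs_pow_three_mul_exp_le hs0 x) (by positivity)
    · rw [integral_const_mul, integral_gaussian, div_div_eq_mul_div, mul_comm Real.pi,
        Real.sqrt_div' _ (by positivity), Real.sqrt_sq hs0.le]
      have h4 : s ^ 4 = (κ * m * ‖ν‖) ^ 2 := by rw [← hs2]; ring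
      rw [hC']
      have : K * ‖ν‖ * (4 / s ^ 3) * (√(2 * Real.pi) / s)
          = 4 * K * √(2 * Real.pi) * ‖ν‖ / s ^ 4 := by field_simp
      rw [this, h4]
      field_simp
  have e3 := norm_integral_gaussian_complex hb0
  rw [norm_mul, Complex.norm_real, Real.norm_of_nonneg hγ.le, Real.sqrt_mul (norm_nonneg _),
    mul_comm √‖ν‖, ← div_div, ← hT] at e3
  set I := ∫ x : ℝ, Complex.exp (-(ν * (q₁ 0 : ℂ)) * (x : ℂ) ^ 2) with hI
  set p := √‖ν‖ with hp
  have hp0 : 0 < p := Real.sqrt_pos.2 hn0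
  have hp2 : p ^ 2 = ‖ν‖ := Real.sq_sqrt hn0.le
  clear_value C'
  have e4 : C' / ‖ν‖ ≤ T / p / 2 := by
    have h1 : 2 * C' / T ≤ p := Real.le_sqrt_of_sq_le ((le_max_right _ _).trans hn)
    rw [div_le_iff₀ hT0] at h1
    rw [← hp2, div_div, div_le_div_iff₀ (by positivity) (by positivity)]
    nlinarith
  have e5 : ‖I‖ ≤ ‖bil Lneg Lpos (h.wkbL ν) (h.wkbL ν)‖ + ‖∫ x, D x‖ := by
    have := norm_sub_le (bil Lneg Lpos (h.wkbL ν) (h.wkbL ν)) (∫ x, D x)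
    rwa [e1, sub_sub_cancel, ← e1] at this
  have e6 : T / (2 * A) * ‖h.wkbL ν‖ ^ 2 ≤ T / (2 * A) * (A / p) := by
    gcongr
    exact hA ν hn0 hre
  have e7 : T / (2 * A) * (A / p) = T / p / 2 := by field_simp
  linarith

end IsPotential

end WKB

/-! ### A quasimode -/

section Quasimode

variable {Lneg Lpos : ℝ} {q q₁ q₂ : ℝ → ℝ}

namespace IsPotential

theorem wkbL_ne_zero (h : IsPotential Lneg Lpos q q₁ q₂) (ν : ℂ) : h.wkbL ν ≠ 0 := by
  have hgc := h.continuous_wkb ν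
  have h1 : 0 < ‖h.wkbL ν‖ ^ 2 := by
    rw [wkbL, norm_sq_ofCont, setIntegral_Ioo_eq_intervalIntegral h.neg_lt.le]
    refine intervalIntegral.intervalIntegral_pos_of_pos
      (Continuous.intervalIntegrable (by fun_prop) _ _) (fun x => ?_) h.neg_lt
    have : 0 < ‖wkb q ν x‖ := norm_pos_iff.2 (Complex.exp_ne_zero _)
    positivity
  intro h0
  rw [h0, norm_zero] at h1
  norm_num at h1

theorem isDirichletC2_mul_wkb (h : IsPotential Lneg Lpos q q₁ q₂) {X X₁ X₂ : ℝ → ℝ}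
    (hX : ∀ x, HasDerivAt X (X₁ x) x) (hX' : ∀ x, HasDerivAt X₁ (X₂ x) x) (hX2c : Continuous X₂)
    (hXl : X (-Lneg) = 0) (hXr : X Lpos = 0) (ν : ℂ) :
    IsDirichletC2 Lneg Lpos (fun x => X x * wkb q ν x)
      (fun x => X₁ x * wkb q ν x + X x * -(ν * q x * wkb q ν x))
      (fun x => (X₂ x * wkb q ν x + X₁ x * -(ν * q x * wkb q ν x))
        + (X₁ x * -(ν * q x * wkb q ν x)
          + X x * -(ν * q₁ x * wkb q ν x + ν * q x * -(ν * q x * wkb q ν x)))) where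
  hasDerivAt x := (hX x).ofReal_comp.mul (h.hasDerivAt_wkb ν x)
  hasDerivAt' x := by
    have hqd : HasDerivAt (fun x => ν * (q x : ℂ)) (ν * q₁ x) x :=
      (h.hasDerivAt x).ofReal_comp.const_mul ν
    exact ((hX' x).ofReal_comp.mul (h.hasDerivAt_wkb ν x)).add
      ((hX x).ofReal_comp.mul (hqd.mul (h.hasDerivAt_wkb ν x)).neg)
  cont := by
    have := h.continuous_wkb ν
    have := h.continuous
    have := h.continuous'
    have hXc : Continuous X := continuous_iff_continuousAt.2 fun x => (hX x).continuousAt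
    have hX1c : Continuous X₁ := continuous_iff_continuousAt.2 fun x => (hX' x).continuousAt
    fun_prop
  left := by simp [hXl]
  right := by simp [hXr]

/-- `χ = X e^{-νδ}` with the cut-off `X`. In the error `E`, each term with a factor `ν` also carries
a factor vanishing at `0` (`q X₁` or `q₁ - q₁ 0`), worth `‖ν‖^{-1/2}` against `e^{-νδ}`; hence `E =
O(‖ν‖^{1/2})`. As `X - 1` is also small at `0`, pairing with `χ` is close to pairing with `e^{-νδ}`.
-/
theorem exists_quasimode (h : IsPotential Lneg Lpos q q₁ q₂) {κ : ℝ} (hκ : 0 < κ) :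
    ∃ C c n₁, 0 < C ∧ 0 < c ∧ 1 ≤ n₁ ∧ ∀ ν : ℂ, n₁ ≤ ‖ν‖ → κ * ‖ν‖ ≤ ν.re →
      ∃ χ E : L2I Lneg Lpos, (χ, ((q₁ 0 : ℂ) * ν) • χ + E) ∈ schrodingerGraph Lneg Lpos q ν ∧
        ‖χ‖ ≤ C * ‖h.wkbL ν‖ ∧ ‖E‖ ≤ C * √‖ν‖ * ‖h.wkbL ν‖ ∧
        c * ‖h.wkbL ν‖ ^ 2 ≤ ‖bil Lneg Lpos (h.wkbL ν) χ‖ := by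
  obtain ⟨X, X₁, X₂, K, hX, hX', hX2c, hXl, hXr, hK, hXb⟩ :=
    exists_cutoff h.Lneg_pos h.Lpos_pos
  have hXc : Continuous X := continuous_iff_continuousAt.2 fun x => (hX x).continuousAt
  have hX1c : Continuous X₁ := continuous_iff_continuousAt.2 fun x => (hX' x).continuousAt
  have hqc := h.continuous
  have hq1c := h.continuous'
  obtain ⟨M, hM1, hM⟩ := h.exists_upper
  obtain ⟨C₁, hC₁, H1⟩ := h.exists_norm_coord_wkb_le hκ
  obtain ⟨c, n₁, hc, hn₁, H2⟩ := h.exists_le_norm_bil_wkbL hκ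
  set D := 2 * M ^ 2 * K + M * K with hD
  have hD0 : 0 ≤ D := by positivity
  have hgc : ∀ ν, Continuous (wkb q ν) := h.continuous_wkb
  refine ⟨K + D * C₁, c / 2, max n₁ ((2 * (K * M * C₁) / c) ^ 2), by positivity, by positivity,
    hn₁.trans (le_max_left _ _), fun ν hn hre => ?_⟩
  have hn1 : 1 ≤ ‖ν‖ := hn₁.trans ((le_max_left _ _).trans hn)
  have hn0 : 0 < ‖ν‖ := by linarith
  have hgc := h.continuous_wkb ν
  set G := ‖h.wkbL ν‖ with hG
  have hG0 : 0 ≤ G := norm_nonneg _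
  set p := √‖ν‖ with hp
  have hp1 : 1 ≤ p := Real.one_le_sqrt.2 hn1
  have hp0 : 0 < p := by linarith
  have hp2 : p ^ 2 = ‖ν‖ := Real.sq_sqrt hn0.le
  have H1 := H1 ν hn0 hre
  have H2 := H2 ν ((le_max_left _ _).trans hn) hre
  have hU := h.isDirichletC2_mul_wkb hX hX' hX2c hXl hXr ν
  have hxg : Continuous fun x : ℝ => (x : ℂ) * wkb q ν x := by fun_prop
  have he₁ : Continuous fun x => -(X₂ x * wkb q ν x) := by fun_prop
  have he₂ : Continuous fun x =>
    (2 * ν * q x * X₁ x + ν * (q₁ x - q₁ 0) * X x) * wkb q ν x := by fun_prop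
  have b1 : ‖ofCont Lneg Lpos _ he₁‖ ≤ K * G := by
    have h1 := norm_ofCont_mono (Lneg := Lneg) (Lpos := Lpos) he₁ (hgc.const_mul (K : ℂ))
      fun x hx => by
        obtain ⟨-, -, h2, -⟩ := hXb x (Ioo_subset_Icc_self hx)
        rw [norm_neg, norm_mul, norm_mul, Complex.norm_real, Complex.norm_real,
          Real.norm_of_nonneg (by linarith : (0 : ℝ) ≤ K), Real.norm_eq_abs]
        gcongr
    rwa [ofCont_smul, norm_smul, Complex.norm_real, Real.norm_of_nonneg (by linarith)] at h1
  have b2 : ‖ofCont Lneg Lpos _ he₂‖ ≤ ‖ν‖ * D * (C₁ / p * G) := by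
    have h1 := norm_ofCont_mono (Lneg := Lneg) (Lpos := Lpos) he₂
      (hxg.const_mul ((‖ν‖ * D : ℝ) : ℂ)) fun x hx => by
        have hx' := Ioo_subset_Icc_self hx
        obtain ⟨h0, h1, -, -⟩ := hXb x hx'
        obtain ⟨g1, -, -, g2, g3, -⟩ := hM x hx'
        rw [norm_mul, norm_mul, norm_mul (x : ℂ), Complex.norm_real, Complex.norm_real,
          Real.norm_of_nonneg (by positivity), Real.norm_eq_abs, ← mul_assoc]
        gcongr
        refine (norm_add_le _ _).trans ?_
        rw [← Complex.ofReal_sub]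
        simp only [norm_mul, Complex.norm_real, Real.norm_eq_abs, Complex.norm_two]
        calc _ ≤ 2 * ‖ν‖ * (M * |x|) * (K * M) + ‖ν‖ * (M * |x|) * K := by
              gcongr
              exact h1.trans (by gcongr)
          _ = _ := by rw [hD]; ring
    rw [ofCont_smul _ hxg, norm_smul, Complex.norm_real, Real.norm_of_nonneg (by positivity)] at h1
    refine h1.trans ?_
    gcongr
  refine ⟨ofCont Lneg Lpos _ hU.continuous, ofCont Lneg Lpos _ he₁ + ofCont Lneg Lpos _ he₂,
    ?_, ?_, ?_, ?_⟩
  · have h1 := hU.mem_graph h.neg_lt hqc ν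
    convert h1 using 2
    rw [← ofCont_smul, ← ofCont_add, ← ofCont_add]
    exact ofCont_congr fun x _ => by ring
  · have h1 := norm_ofCont_mono (Lneg := Lneg) (Lpos := Lpos) hU.continuous
      (hgc.const_mul (K : ℂ)) fun x hx => by
        obtain ⟨h0, -⟩ := hXb x (Ioo_subset_Icc_self hx)
        rw [norm_mul, norm_mul, Complex.norm_real, Complex.norm_real,
          Real.norm_of_nonneg (by linarith : (0 : ℝ) ≤ K), Real.norm_eq_abs]
        gcongr
    rw [ofCont_smul, norm_smul, Complex.norm_real, Real.norm_of_nonneg (by linarith)] at h1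
    refine h1.trans ?_
    have : 0 ≤ D * C₁ := by positivity
    change K * G ≤ _
    gcongr
    linarith
  · refine (norm_add_le _ _).trans ((add_le_add b1 b2).trans ?_)
    have e : ‖ν‖ * D * (C₁ / p * G) = D * C₁ * p * G := by
      rw [← hp2]
      field_simp
    rw [e]
    have : K * G * 1 ≤ K * G * p := by gcongr
    linarith
  · have hd : Continuous fun x => ((X x : ℂ) - 1) * wkb q ν x := by fun_prop
    have e1 : ofCont Lneg Lpos _ hU.continuous = h.wkbL ν + ofCont Lneg Lpos _ hd := by
      rw [wkbL, ← ofCont_add]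
      exact ofCont_congr fun x _ => by ring
    have b3 : ‖ofCont Lneg Lpos _ hd‖ ≤ K * M * (C₁ / p * G) := by
      have h1 := norm_ofCont_mono (Lneg := Lneg) (Lpos := Lpos) hd
        (hxg.const_mul ((K * M : ℝ) : ℂ)) fun x hx => by
          have hx' := Ioo_subset_Icc_self hx
          obtain ⟨-, -, -, h1⟩ := hXb x hx'
          obtain ⟨g1, -⟩ := hM x hx'
          rw [norm_mul, norm_mul, norm_mul (x : ℂ), Complex.norm_real, Complex.norm_real,
            Real.norm_of_nonneg (by positivity), Real.norm_eq_abs, ← mul_assoc]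
          gcongr
          rw [← Complex.ofReal_one, ← Complex.ofReal_sub, Complex.norm_real, Real.norm_eq_abs]
          refine h1.trans ?_
          rw [← sq_abs, pow_two, ← mul_assoc]
          gcongr
      rw [ofCont_smul _ hxg, norm_smul, Complex.norm_real, Real.norm_of_nonneg (by positivity)] at h1
      refine h1.trans ?_
      gcongr
    have b4 : ‖bil Lneg Lpos (h.wkbL ν) (ofCont Lneg Lpos _ hd)‖ ≤ c / 2 * G ^ 2 := by
      refine (norm_bil_le _ _).trans ?_
      have h1 : 2 * (K * M * C₁) / c ≤ p := Real.le_sqrt_of_sq_le ((le_max_right _ _).trans hn)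
      rw [div_le_iff₀ hc] at h1
      calc G * ‖ofCont Lneg Lpos _ hd‖ ≤ G * (K * M * (C₁ / p * G)) := by gcongr
        _ = (K * M * C₁) / p * G ^ 2 := by field_simp
        _ ≤ c / 2 * G ^ 2 := by
          refine mul_le_mul_of_nonneg_right ?_ (sq_nonneg G)
          rw [div_le_iff₀ hp0]
          linarith
    have e2 : bil Lneg Lpos (h.wkbL ν) (h.wkbL ν)
        = bil Lneg Lpos (h.wkbL ν) (ofCont Lneg Lpos _ hU.continuous)
          - bil Lneg Lpos (h.wkbL ν) (ofCont Lneg Lpos _ hd) := by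
      rw [e1, map_add, add_sub_cancel_right]
    rw [e2] at H2
    have := norm_sub_le (bil Lneg Lpos (h.wkbL ν) (ofCont Lneg Lpos _ hU.continuous))
      (bil Lneg Lpos (h.wkbL ν) (ofCont Lneg Lpos _ hd))
    linarith

end IsPotential

end Quasimode

/-! ### Low-energy eigenfunctions for large `|ν|` -/

section LargeParameter

variable {Lneg Lpos : ℝ} {q q₁ q₂ : ℝ → ℝ}

/-- Non-isotropy is stable under small relative perturbation. The constant is `c/4 - c/20 - 3c/40 =
c/8`. -/
theorem le_norm_bil_of_approx {G u₁ u₂ : L2I Lneg Lpos} {c₁ c₂ : ℂ} {c η : ℝ} (hc : 0 < c)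
    (hη : η ≤ 1 / 2) (hη' : η ≤ c / 20) (hG : c * ‖G‖ ^ 2 ≤ ‖bil Lneg Lpos G G‖)
    (h1 : ‖u₁ - c₁ • G‖ ≤ η * ‖u₁‖) (h2 : ‖u₂ - c₂ • G‖ ≤ η * ‖u₂‖) :
    c / 8 * (‖u₁‖ * ‖u₂‖) ≤ ‖bil Lneg Lpos u₁ u₂‖ := by
  have a1 : ‖u₁‖ / 2 ≤ ‖c₁ • G‖ := by
    have := norm_sub_norm_le u₁ (c₁ • G)
    have : η * ‖u₁‖ ≤ 1 / 2 * ‖u₁‖ := by gcongr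
    linarith
  have a1' : ‖c₁ • G‖ ≤ 3 / 2 * ‖u₁‖ := by
    have := norm_sub_norm_le (c₁ • G) u₁
    rw [norm_sub_rev] at this
    have : η * ‖u₁‖ ≤ 1 / 2 * ‖u₁‖ := by gcongr
    linarith
  have a2 : ‖u₂‖ / 2 ≤ ‖c₂ • G‖ := by
    have := norm_sub_norm_le u₂ (c₂ • G)
    have : η * ‖u₂‖ ≤ 1 / 2 * ‖u₂‖ := by gcongr
    linarith
  have e : bil Lneg Lpos (c₁ • G) (c₂ • G) = bil Lneg Lpos u₁ u₂
      - (bil Lneg Lpos (u₁ - c₁ • G) u₂ + bil Lneg Lpos (c₁ • G) (u₂ - c₂ • G)) := by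
    simp only [map_sub, sub_apply]
    ring
  have b1 : ‖bil Lneg Lpos (u₁ - c₁ • G) u₂‖ ≤ c / 20 * ‖u₁‖ * ‖u₂‖ := by
    refine (norm_bil_le _ _).trans ?_
    gcongr
    exact h1.trans (by gcongr)
  have b2 : ‖bil Lneg Lpos (c₁ • G) (u₂ - c₂ • G)‖ ≤ 3 / 2 * ‖u₁‖ * (c / 20 * ‖u₂‖) := by
    refine (norm_bil_le _ _).trans ?_
    gcongr
    exact h2.trans (by gcongr)
  have b3 : c * (‖u₁‖ / 2 * (‖u₂‖ / 2)) ≤ ‖bil Lneg Lpos (c₁ • G) (c₂ • G)‖ := by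
    calc c * (‖u₁‖ / 2 * (‖u₂‖ / 2)) ≤ c * (‖c₁ • G‖ * ‖c₂ • G‖) := by gcongr
      _ = ‖c₁‖ * ‖c₂‖ * (c * ‖G‖ ^ 2) := by rw [norm_smul, norm_smul]; ring
      _ ≤ ‖c₁‖ * ‖c₂‖ * ‖bil Lneg Lpos G G‖ := by gcongr
      _ = _ := by
        rw [map_smul, map_smul, smul_apply, norm_smul, norm_smul]
        ring
  rw [e] at b3
  have b4 := (norm_sub_le (bil Lneg Lpos u₁ u₂) (bil Lneg Lpos (u₁ - c₁ • G) u₂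
    + bil Lneg Lpos (c₁ • G) (u₂ - c₂ • G)))
  have b5 := norm_add_le (bil Lneg Lpos (u₁ - c₁ • G) u₂) (bil Lneg Lpos (c₁ • G) (u₂ - c₂ • G))
  linarith

namespace IsPotential

/-- Low-energy eigenfunctions are uniformly far from being orthogonal for the bilinear pairing. -/
theorem exists_le_norm_bil (h : IsPotential Lneg Lpos q q₁ q₂) {κ : ℝ} (hκ : 0 < κ)
    (hκ1 : κ ≤ 1) :
    ∃ c n₁, 0 < c ∧ 1 ≤ n₁ ∧ ∀ ν : ℂ, n₁ ≤ ‖ν‖ → κ * ‖ν‖ ≤ ν.re →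
      ∀ (z₁ z₂ : ℂ) (u₁ u₂ : L2I Lneg Lpos), ‖z₁ - (q₁ 0 : ℂ) * ν‖ ≤ q₁ 0 * ‖ν‖ →
      ‖z₂ - (q₁ 0 : ℂ) * ν‖ ≤ q₁ 0 * ‖ν‖ →
      (u₁, z₁ • u₁) ∈ schrodingerGraph Lneg Lpos q ν →
      (u₂, z₂ • u₂) ∈ schrodingerGraph Lneg Lpos q ν →
      c * (‖u₁‖ * ‖u₂‖) ≤ ‖bil Lneg Lpos u₁ u₂‖ := by
  obtain ⟨C, n₁, hC, hn₁, H1⟩ := h.exists_norm_sub_wkbL_le hκ hκ1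
  obtain ⟨c, n₂, hc, hn₂, H2⟩ := h.exists_le_norm_bil_wkbL hκ
  refine ⟨c / 8, max (max n₁ n₂) (max ((2 * C) ^ 2) ((20 * C / c) ^ 2)), by positivity,
    hn₁.trans ((le_max_left _ _).trans (le_max_left _ _)), ?_⟩
  intro ν hn hre z₁ z₂ u₁ u₂ hz₁ hz₂ hu₁ hu₂
  have m1 := ((le_max_left _ _).trans (le_max_left _ _)).trans hn
  have m2 := ((le_max_right _ _).trans (le_max_left _ _)).trans hn
  have m3 := ((le_max_left _ _).trans (le_max_right _ _)).trans hn
  have m4 := ((le_max_right _ _).trans (le_max_right _ _)).trans hn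
  have hn0 : 0 < ‖ν‖ := by linarith
  have hp0 : 0 < √‖ν‖ := Real.sqrt_pos.2 hn0
  obtain ⟨c₁, h1⟩ := H1 ν z₁ 0 u₁ m1 hre hz₁ (by simpa using hu₁)
  obtain ⟨c₂, h2⟩ := H1 ν z₂ 0 u₂ m1 hre hz₂ (by simpa using hu₂)
  rw [norm_zero, zero_mul, zero_div, add_zero] at h1 h2
  refine le_norm_bil_of_approx hc ?_ ?_ (H2 ν m2 hre) h1 h2
  · have := Real.le_sqrt_of_sq_le m3
    rw [div_le_iff₀ hp0]
    linarith
  · have := Real.le_sqrt_of_sq_le m4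
    rw [div_le_iff₀ hc] at this
    rw [div_le_iff₀ hp0]
    linarith

end IsPotential

/-- Bookkeeping for the size of the resolvent applied to the WKB state. -/
theorem resolvent_bound_aux {γ C c p G W a β : ℝ} (hγ : 0 < γ) (hC : 0 < C) (hc : 0 < c)
    (hp : 1 ≤ p) (hG : 0 < G) (hW : 0 ≤ W)
    (hp1 : 2 * (C + γ * C ^ 2 + γ * c * C) / (γ * c) ≤ p)
    (hβ : c * G ^ 2 ≤ β) (hβ' : β ≤ C * G ^ 2)
    (h1 : W ≤ a * G + C / p * (W + G / p ^ 2))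
    (h2 : γ * p ^ 2 * (a * β)
      ≤ β + W * (C * p * G) + γ * p ^ 2 * (C / p * (W + G / p ^ 2) * (C * G))) (ha : 0 ≤ a) :
    W * p ^ 2 ≤ 2 * (C + γ * C ^ 2 + γ * c * C) / (γ * c) * G := by
  have hp0 : 0 < p := by linarith
  have hGp : G / p ≤ G := div_le_self hG.le hp
  have e1 : γ * p ^ 2 * (C / p * (W + G / p ^ 2) * (C * G))
      = γ * C ^ 2 * G * (p * W + G / p) := by field_simp
  have h3 : γ * p ^ 2 * (a * (c * G ^ 2)) ≤ γ * p ^ 2 * (a * β) := by gcongr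
  have h4 : G * (γ * c * p ^ 2 * (a * G)) ≤ G * ((C + γ * C ^ 2) * (G + p * W)) := by
    have h5 : γ * C ^ 2 * G * (p * W + G / p) ≤ γ * C ^ 2 * G * (p * W + G) := by gcongr
    have h6 : 0 ≤ G * (γ * C ^ 2) * 0 := by positivity
    nlinarith
  have h5 := le_of_mul_le_mul_left h4 hG
  have h6 : γ * c * p ^ 2 * W ≤ γ * c * p ^ 2 * (a * G) + γ * c * C * (p * W + G) := by
    have h7 : γ * c * p ^ 2 * W ≤ γ * c * p ^ 2 * (a * G + C / p * (W + G / p ^ 2)) := by gcongr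
    have e2 : γ * c * p ^ 2 * (C / p * (W + G / p ^ 2)) = γ * c * C * (p * W + G / p) := by
      field_simp
    have h8 : γ * c * C * (p * W + G / p) ≤ γ * c * C * (p * W + G) := by gcongr
    linarith
  rw [div_le_iff₀ (by positivity)] at hp1
  have h9 : 2 * (C + γ * C ^ 2 + γ * c * C) * (p * W) ≤ p * (γ * c) * (p * W) := by gcongr
  rw [div_mul_eq_mul_div, le_div_iff₀ (by positivity)]
  linarith

namespace IsPotential

/-- For large `|ν|` there is a low-energy eigenvalue. -/
theorem exists_dirDet_eq_zero (h : IsPotential Lneg Lpos q q₁ q₂) {κ : ℝ} (hκ : 0 < κ)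
    (hκ1 : κ ≤ 1) :
    ∃ n₁, 1 ≤ n₁ ∧ ∀ ν : ℂ, n₁ ≤ ‖ν‖ → κ * ‖ν‖ ≤ ν.re →
      ∃ z, ‖z - (q₁ 0 : ℂ) * ν‖ ≤ q₁ 0 * ‖ν‖ ∧ dirDet Lneg Lpos q h.continuous (ν, z) = 0 := by
  obtain ⟨C₁, n₁, hC₁, hn₁, H1⟩ := h.exists_norm_sub_wkbL_le hκ hκ1
  obtain ⟨C₂, c, n₂, hC₂, hc, hn₂, H2⟩ := h.exists_quasimode hκ
  have hγ := h.deriv_pos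
  set γ := q₁ 0 with hγd
  set C := max C₁ C₂ with hC
  have hC0 : 0 < C := lt_max_of_lt_left hC₁
  set T := 2 * (C + γ * C ^ 2 + γ * c * C) / (γ * c) with hT
  have hT0 : 0 < T := by positivity
  refine ⟨max (max n₁ n₂) (max (T ^ 2) ((2 * (T * C) / c) ^ 2)),
    hn₁.trans ((le_max_left _ _).trans (le_max_left _ _)), fun ν hn hre => ?_⟩
  have m1 := ((le_max_left _ _).trans (le_max_left _ _)).trans hn
  have m2 := ((le_max_right _ _).trans (le_max_left _ _)).trans hn
  have m3 := ((le_max_left _ _).trans (le_max_right _ _)).trans hn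
  have m4 := ((le_max_right _ _).trans (le_max_right _ _)).trans hn
  have hn1 : 1 ≤ ‖ν‖ := by linarith
  have hn0 : 0 < ‖ν‖ := by linarith
  obtain ⟨χ, E, hχ, hχC, hEC, hcβ⟩ := H2 ν m2 hre
  set g := h.wkbL ν with hg
  set G := ‖g‖ with hG
  have hG0 : 0 < G := norm_pos_iff.2 (h.wkbL_ne_zero ν)
  set p := √‖ν‖ with hp
  have hp1 : 1 ≤ p := Real.one_le_sqrt.2 hn1
  have hp0 : 0 < p := by linarith
  have hp2 : p ^ 2 = ‖ν‖ := Real.sq_sqrt hn0.le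
  have hpT : T ≤ p := Real.le_sqrt_of_sq_le m3
  have hpc : 2 * (T * C) / c ≤ p := Real.le_sqrt_of_sq_le m4
  have hχC : ‖χ‖ ≤ C * G := hχC.trans (by gcongr; exact le_max_right _ _)
  have hEC : ‖E‖ ≤ C * p * G := hEC.trans (by gcongr; exact le_max_right _ _)
  -- Without zeros of `dirDet` the closed disk lies in the resolvent set, so `z ↦ bil (R(z) g) E` is
  -- holomorphic there. It will be small on the circle but not at the centre.
  by_contra! hcon
  set A := schrodinger Lneg Lpos q ν with hA
  have hres : ∀ z, ‖z - (γ : ℂ) * ν‖ ≤ γ * ‖ν‖ → z ∈ resolventSet A := fun z hz =>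
    mem_resolventSet_of_dirDet_ne_zero h.neg_lt h.continuous (hcon z hz)
  have hgraph : ∀ z, ‖z - (γ : ℂ) * ν‖ ≤ γ * ‖ν‖ →
      (resolventAt A z g, z • resolventAt A z g - g) ∈ schrodingerGraph Lneg Lpos q ν := by
    intro z hz
    obtain ⟨hd, e⟩ := (isResolventAt_resolventAt (hres z hz)).1 g
    refine apply_eq_iff_mem_graph.1 ⟨hd, ?_⟩
    exact eq_sub_of_add_eq' (sub_eq_iff_eq_add.1 e).symm
  have hid : ∀ z, ‖z - (γ : ℂ) * ν‖ ≤ γ * ‖ν‖ →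
      (z - (γ : ℂ) * ν) * bil Lneg Lpos (resolventAt A z g) χ
        = bil Lneg Lpos g χ + bil Lneg Lpos (resolventAt A z g) E := by
    intro z hz
    have e := bil_symm_of_mem_graph h.neg_lt h.continuous (hgraph z hz) hχ
    simp only [map_sub, map_add, map_smul, sub_apply, smul_apply,
      smul_eq_mul] at e
    linear_combination e
  -- On the circle `R(z) g` is close to some `a g`, and pairing with `χ` bounds `a` because `|z -
  -- γν| = γ ‖ν‖` is large. This gives `‖R(z) g‖ ≤ T G / ‖ν‖`, which beats the size `‖ν‖^{1/2} G` of
  -- `E`.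
  have hcirc : ∀ z, ‖z - (γ : ℂ) * ν‖ = γ * ‖ν‖ →
      ‖bil Lneg Lpos (resolventAt A z g) E‖ ≤ c / 2 * G ^ 2 := by
    intro z hz
    set w := resolventAt A z g with hw
    obtain ⟨a, ha⟩ := H1 ν z (-1) w m1 hre hz.le (by
      rw [neg_one_smul, ← sub_eq_add_neg]
      exact hgraph z hz.le)
    rw [norm_neg, norm_one, one_mul, ← hG] at ha
    have ha : ‖w - a • g‖ ≤ C / p * (‖w‖ + G / p ^ 2) := by
      rw [hp2]
      refine ha.trans ?_
      gcongr
      exact le_max_left _ _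
    have hβ' : ‖bil Lneg Lpos g χ‖ ≤ C * G ^ 2 := by
      refine (norm_bil_le _ _).trans ?_
      calc G * ‖χ‖ ≤ G * (C * G) := by gcongr
        _ = _ := by ring
    have h1 : ‖w‖ ≤ ‖a‖ * G + C / p * (‖w‖ + G / p ^ 2) := by
      have := norm_sub_norm_le w (a • g)
      rw [norm_smul] at this
      linarith
    have h2 : γ * p ^ 2 * (‖a‖ * ‖bil Lneg Lpos g χ‖)
        ≤ ‖bil Lneg Lpos g χ‖ + ‖w‖ * (C * p * G)
          + γ * p ^ 2 * (C / p * (‖w‖ + G / p ^ 2) * (C * G)) := by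
      have e : (z - (γ : ℂ) * ν) * (a * bil Lneg Lpos g χ) = bil Lneg Lpos g χ
          + bil Lneg Lpos w E - (z - (γ : ℂ) * ν) * bil Lneg Lpos (w - a • g) χ := by
        rw [← hid z hz.le, map_sub, sub_apply, map_smul, smul_apply, smul_eq_mul]
        ring
      have e' := congrArg norm e
      rw [norm_mul, norm_mul, hz, ← hp2] at e'
      rw [e']
      refine (norm_sub_le _ _).trans (add_le_add ((norm_add_le _ _).trans (add_le_add le_rfl ?_)) ?_)
      · refine (norm_bil_le _ _).trans ?_
        gcongr
      · rw [norm_mul, hz, ← hp2]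
        gcongr
        refine (norm_bil_le _ _).trans ?_
        gcongr
    have h3 := resolvent_bound_aux hγ hC0 hc hp1 hG0 (norm_nonneg w) hpT hcβ hβ' h1 h2
      (norm_nonneg a)
    rw [← hT] at h3
    refine (norm_bil_le _ _).trans ?_
    refine le_of_mul_le_mul_left (a := p) ?_ hp0
    rw [div_le_iff₀ hc] at hpc
    calc p * (‖w‖ * ‖E‖) ≤ p * (‖w‖ * (C * p * G)) := by gcongr
      _ = ‖w‖ * p ^ 2 * (C * G) := by ring
      _ ≤ T * G * (C * G) := by gcongr
      _ = T * C * G ^ 2 := by ring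
      _ ≤ (p * c / 2) * G ^ 2 := by gcongr; linarith
      _ = _ := by ring
  have hball : Metric.closedBall ((γ : ℂ) * ν) (γ * ‖ν‖) ⊆ resolventSet A := fun z hz =>
    hres z (by simpa [dist_eq_norm] using hz)
  have hr0 : γ * ‖ν‖ ≠ 0 := by positivity
  have hdiff : DiffContOnCl ℂ (fun z => bil Lneg Lpos (resolventAt A z g) E)
      (Metric.ball ((γ : ℂ) * ν) (γ * ‖ν‖)) := by
    refine DifferentiableOn.diffContOnCl ?_
    rw [closure_ball _ hr0]
    have h1 : DifferentiableOn ℂ (resolventAt A) (Metric.closedBall ((γ : ℂ) * ν) (γ * ‖ν‖)) :=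
      (differentiableOn_resolventAt A).mono hball
    have h2 : Differentiable ℂ fun R : L2I Lneg Lpos →L[ℂ] L2I Lneg Lpos =>
      bil Lneg Lpos (R g) E := by fun_prop
    exact h2.comp_differentiableOn h1
  have hmax := Complex.norm_le_of_forall_mem_frontier_norm_le Metric.isBounded_ball hdiff
    (C := c / 2 * G ^ 2) (fun z hz => hcirc z (by
      rw [frontier_ball _ hr0] at hz
      simpa [dist_eq_norm] using hz)) (z := (γ : ℂ) * ν)
    (subset_closure (Metric.mem_ball_self (by positivity)))
  -- At the centre the left side of `hid` vanishes, so the matrix element equals `-bil g χ`, of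
  -- modulus at least `c G²`; the maximum principle allows only `c G² / 2`.
  have h0 := hid ((γ : ℂ) * ν) (by rw [sub_self, norm_zero]; positivity)
  rw [sub_self, zero_mul] at h0
  have h1 : ‖bil Lneg Lpos g χ‖ = ‖bil Lneg Lpos (resolventAt A ((γ : ℂ) * ν) g) E‖ := by
    rw [eq_neg_of_add_eq_zero_left h0.symm, norm_neg]
  rw [← h1] at hmax
  have : 0 < c * G ^ 2 := by positivity
  linarith

end IsPotential

end LargeParameter

/-! ### The low-energy eigenvalue and its spectral projection -/

section Threshold

variable {Lneg Lpos : ℝ} {q q₁ q₂ : ℝ → ℝ}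

theorem norm_gaussFun_sq (q : ℝ → ℝ) {ν : ℂ} (hν : 0 < ‖ν‖) (x : ℝ) :
    ‖gaussFun q ν x‖ ^ 2 = √‖ν‖ * Real.exp (-(deriv q 0 * ν.re) * x ^ 2) := by
  have h1 : ‖ν ^ (1 / 4 : ℂ)‖ ^ 2 = √‖ν‖ := by
    have := Complex.norm_cpow_real ν (1 / 4)
    push_cast at this
    rw [this, ← Real.rpow_natCast, ← Real.rpow_mul hν.le, Real.sqrt_eq_rpow]
    norm_num
  have h2 : (-(((deriv q 0 : ℝ) : ℂ) * ν * (x : ℂ) ^ 2 / 2)).re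
      = -(deriv q 0 * ν.re) * x ^ 2 / 2 := by
    rw [show -(((deriv q 0 : ℝ) : ℂ) * ν * (x : ℂ) ^ 2 / 2)
      = ν * ((-(deriv q 0 * x ^ 2 / 2) : ℝ) : ℂ) by push_cast; ring, Complex.re_mul_ofReal]
    ring
  rw [gaussFun, norm_mul, mul_pow, h1, Complex.norm_exp, ← Real.exp_nat_mul, h2]
  congr 2
  push_cast
  ring

/-- The factor `ν^{1/4}` compensates the Gaussian integral, which is of order `‖ν‖^{-1/2}`. -/
theorem exists_norm_gauss_le (hq : 0 < deriv q 0) {κ : ℝ} (hκ : 0 < κ) :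
    ∃ C, 0 < C ∧ ∀ ν : ℂ, 0 < ‖ν‖ → κ * ‖ν‖ ≤ ν.re → ‖gauss Lneg Lpos q ν‖ ≤ C := by
  refine ⟨√√(Real.pi / (deriv q 0 * κ)), Real.sqrt_pos.2 (Real.sqrt_pos.2
    (div_pos Real.pi_pos (by positivity))), fun ν hn hre => Real.le_sqrt_of_sq_le ?_⟩
  have hint := (integrable_exp_neg_mul_sq (b := deriv q 0 * (κ * ‖ν‖)) (by positivity)).const_mul
    √‖ν‖
  have hgc : Continuous (gaussFun q ν) := by
    unfold gaussFun
    fun_prop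
  rw [gauss, norm_sq_toLp]
  calc ∫ x in Ioo (-Lneg) Lpos, ‖gaussFun q ν x‖ ^ 2
      ≤ ∫ x in Ioo (-Lneg) Lpos, √‖ν‖ * Real.exp (-(deriv q 0 * (κ * ‖ν‖)) * x ^ 2) := by
        refine setIntegral_mono_on ((hgc.norm.pow 2).integrableOn_Icc.mono_set
          Ioo_subset_Icc_self) hint.integrableOn measurableSet_Ioo fun x _ => ?_
        rw [norm_gaussFun_sq q hn]
        have h1 : deriv q 0 * (κ * ‖ν‖) * x ^ 2 ≤ deriv q 0 * ν.re * x ^ 2 := by gcongr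
        refine mul_le_mul_of_nonneg_left (Real.exp_le_exp.2 ?_) (Real.sqrt_nonneg _)
        linarith
    _ ≤ ∫ x, √‖ν‖ * Real.exp (-(deriv q 0 * (κ * ‖ν‖)) * x ^ 2) :=
        setIntegral_le_integral hint (Filter.Eventually.of_forall fun x =>
          mul_nonneg (Real.sqrt_nonneg _) (Real.exp_pos _).le)
    _ = √(Real.pi / (deriv q 0 * κ)) := by
        rw [integral_const_mul, integral_gaussian, ← Real.sqrt_mul hn.le]
        congr 1
        field_simp

/-- The sector becomes a closed condition, with `cos θ₀` as the ellipticity constant `κ` of the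
energy estimates. -/
theorem mem_sector_iff {θ₀ : ℝ} (hθ₀ : θ₀ ∈ Ico 0 (Real.pi / 2)) {ν : ℂ} :
    ν ∈ sector θ₀ ↔ 1 ≤ ‖ν‖ ∧ Real.cos θ₀ * ‖ν‖ ≤ ν.re := by
  have hpi := Real.pi_pos
  refine and_congr_right fun hn => ?_
  have hn0 : 0 < ‖ν‖ := by linarith
  have h1 : ν.re = Real.cos |Complex.arg ν| * ‖ν‖ := by
    rw [Real.cos_abs, mul_comm, Complex.norm_mul_cos_arg]
  rw [h1, mul_le_mul_iff_left₀ hn0]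
  exact (Real.strictAntiOn_cos.le_iff_ge ⟨hθ₀.1, by linarith [hθ₀.2]⟩
    ⟨abs_nonneg _, Complex.abs_arg_le_pi ν⟩).symm

namespace IsPotential

theorem isLowEigenvalue_iff (h : IsPotential Lneg Lpos q q₁ q₂) {ν z : ℂ} :
    IsLowEigenvalue Lneg Lpos q ν z ↔ dirDet Lneg Lpos q h.continuous (ν, z) = 0 ∧
      ‖z - (q₁ 0 : ℂ) * ν‖ ≤ q₁ 0 * ‖ν‖ := by
  rw [IsLowEigenvalue, isEigenvalue_iff h.neg_lt h.continuous, (h.hasDerivAt 0).deriv]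

/-- The lower bound for `bil` gives simplicity when applied twice to the same eigenfunction. It
gives uniqueness because eigenfunctions for distinct eigenvalues are orthogonal for `bil`. -/
theorem exists_isThreshold (h : IsPotential Lneg Lpos q q₁ q₂) {θ₀ : ℝ}
    (hθ₀ : θ₀ ∈ Ico 0 (Real.pi / 2)) : ∃ ν₀, IsThreshold Lneg Lpos q θ₀ ν₀ := by
  have hκ : 0 < Real.cos θ₀ := Real.cos_pos_of_mem_Ioo
    ⟨by linarith [hθ₀.1, Real.pi_pos], hθ₀.2⟩
  obtain ⟨c, n₁, hc, hn₁, H1⟩ := h.exists_le_norm_bil hκ (Real.cos_le_one _)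
  obtain ⟨n₂, hn₂, H2⟩ := h.exists_dirDet_eq_zero hκ (Real.cos_le_one _)
  refine ⟨max n₁ n₂, by positivity, fun ν hν hn => ?_⟩
  rw [mem_sector_iff hθ₀] at hν
  obtain ⟨z, hz, hD⟩ := H2 ν ((le_max_right _ _).trans hn) hν.2
  have H1 := H1 ν ((le_max_left _ _).trans hn) hν.2
  have hy := norm_pos_iff.2 (dirSol_ne_zero h.neg_lt h.continuous (ν, z))
  refine ⟨z, h.isLowEigenvalue_iff.2 ⟨hD, hz⟩,
    (isAlgSimple_iff h.neg_lt h.continuous hD).2 fun h0 => ?_, fun z' hz' => ?_⟩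
  · have := H1 z z _ _ hz hz (dirSol_mem_graph h.neg_lt h.continuous hD)
      (dirSol_mem_graph h.neg_lt h.continuous hD)
    rw [h0, norm_zero] at this
    have : 0 < c * (‖dirSol Lneg Lpos q h.continuous (ν, z)‖ *
      ‖dirSol Lneg Lpos q h.continuous (ν, z)‖) := by positivity
    linarith
  · obtain ⟨hD', hz'⟩ := h.isLowEigenvalue_iff.1 hz'
    have hy' := norm_pos_iff.2 (dirSol_ne_zero h.neg_lt h.continuous (ν, z'))
    have g := dirSol_mem_graph h.neg_lt h.continuous hD
    have g' := dirSol_mem_graph h.neg_lt h.continuous hD'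
    have h1 := H1 z' z _ _ hz' hz g' g
    have h2 := bil_symm_of_mem_graph h.neg_lt h.continuous g' g
    simp only [map_smul, smul_apply, smul_eq_mul] at h2
    by_contra hne
    have h3 := mul_right_cancel₀ (b := bil Lneg Lpos (dirSol Lneg Lpos q h.continuous (ν, z'))
      (dirSol Lneg Lpos q h.continuous (ν, z))) (fun h0 => by
        rw [h0, norm_zero] at h1
        have : 0 < c * (‖dirSol Lneg Lpos q h.continuous (ν, z')‖ *
          ‖dirSol Lneg Lpos q h.continuous (ν, z)‖) := by positivity
        linarith) h2
    exact hne h3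

/-- Above a threshold the bilinear square of the low-energy eigenfunction is uniformly bounded from
below. -/
theorem exists_le_norm_bil_dirSol (h : IsPotential Lneg Lpos q q₁ q₂) {θ₀ ν₀ : ℝ}
    (hθ₀ : θ₀ ∈ Ico 0 (Real.pi / 2)) (hν₀ : IsThreshold Lneg Lpos q θ₀ ν₀) :
    ∃ c, 0 < c ∧ ∀ ν ∈ sector θ₀, ν₀ ≤ ‖ν‖ → ∀ z, IsLowEigenvalue Lneg Lpos q ν z →
      c * ‖dirSol Lneg Lpos q h.continuous (ν, z)‖ ^ 2
        ≤ ‖bil Lneg Lpos (dirSol Lneg Lpos q h.continuous (ν, z))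
          (dirSol Lneg Lpos q h.continuous (ν, z))‖ := by
  have hκ : 0 < Real.cos θ₀ := Real.cos_pos_of_mem_Ioo
    ⟨by linarith [hθ₀.1, Real.pi_pos], hθ₀.2⟩
  obtain ⟨c, n₁, hc, hn₁, H1⟩ := h.exists_le_norm_bil hκ (Real.cos_le_one _)
  set y := dirSol Lneg Lpos q h.continuous with hy
  have hyc : Continuous y := continuous_dirSol h.continuous
  have hDc := continuous_dirDet (Lneg := Lneg) (Lpos := Lpos) h.continuous
  have hy0 : ∀ p, 0 < ‖y p‖ := fun p =>
    norm_pos_iff.2 (dirSol_ne_zero h.neg_lt h.continuous p)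
  -- The parameters below the large-`‖ν‖` regime form a compact set, since `dirDet` is continuous.
  -- On it the threshold hypothesis gives simplicity, hence `bil y y ≠ 0`, and continuity of `y`
  -- makes this uniform.
  set K : Set (ℂ × ℂ) := {p | 1 ≤ ‖p.1‖ ∧ Real.cos θ₀ * ‖p.1‖ ≤ p.1.re ∧ ν₀ ≤ ‖p.1‖ ∧
    ‖p.1‖ ≤ n₁ ∧ ‖p.2 - (q₁ 0 : ℂ) * p.1‖ ≤ q₁ 0 * ‖p.1‖ ∧
    dirDet Lneg Lpos q h.continuous p = 0} with hK
  have hKc : IsClosed K := by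
    have hre : Continuous fun p : ℂ × ℂ => p.1.re := Complex.continuous_re.comp continuous_fst
    simp only [hK, ofPred_and]
    exact (isClosed_le continuous_const (by fun_prop)).inter
      ((isClosed_le (by fun_prop) hre).inter
        ((isClosed_le continuous_const (by fun_prop)).inter
          ((isClosed_le (by fun_prop) continuous_const).inter
            ((isClosed_le (f := fun p : ℂ × ℂ => ‖p.2 - (q₁ 0 : ℂ) * p.1‖) (by fun_prop)
              (by fun_prop)).inter (isClosed_eq hDc continuous_const)))))
  have hKb : Bornology.IsBounded K := by
    refine isBounded_iff_forall_norm_le.2 ⟨max n₁ (2 * q₁ 0 * n₁), fun p hp => ?_⟩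
    obtain ⟨-, -, -, h4, h5, -⟩ := hp
    refine max_le_max h4 ?_
    have h6 := norm_add_le (p.2 - (q₁ 0 : ℂ) * p.1) ((q₁ 0 : ℂ) * p.1)
    rw [sub_add_cancel, norm_mul (q₁ 0 : ℂ), Complex.norm_real,
      Real.norm_of_nonneg h.deriv_pos.le] at h6
    have h7 : q₁ 0 * ‖p.1‖ ≤ q₁ 0 * n₁ := by
      have := h.deriv_pos
      gcongr
    linarith
  have hKK : IsCompact K := Metric.isCompact_of_isClosed_isBounded hKc hKb
  have hpos : ∀ p ∈ K, 0 < ‖bil Lneg Lpos (y p) (y p)‖ / ‖y p‖ ^ 2 := by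
    rintro ⟨ν, z⟩ ⟨h1, h2, h3, h4, h5, h6⟩
    obtain ⟨lam, -, hs, hu⟩ := hν₀.2 ν ((mem_sector_iff hθ₀).2 ⟨h1, h2⟩) h3
    have e := hu z (h.isLowEigenvalue_iff.2 ⟨h6, h5⟩)
    subst e
    have := norm_pos_iff.2 ((isAlgSimple_iff h.neg_lt h.continuous h6).1 hs)
    have := hy0 (ν, z)
    positivity
  obtain ⟨c', hc', hmin⟩ : ∃ c', 0 < c' ∧ ∀ p ∈ K,
      c' ≤ ‖bil Lneg Lpos (y p) (y p)‖ / ‖y p‖ ^ 2 := by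
    rcases K.eq_empty_or_nonempty with h0 | h0
    · exact ⟨1, one_pos, by simp [h0]⟩
    · have hfc : Continuous fun p => ‖bil Lneg Lpos (y p) (y p)‖ / ‖y p‖ ^ 2 := by
        refine Continuous.div (by fun_prop) (by fun_prop) fun p => ?_
        have := hy0 p
        positivity
      obtain ⟨p, hp, hm⟩ := hKK.exists_isMinOn h0 hfc.continuousOn
      exact ⟨_, hpos p hp, fun p' hp' => hm hp'⟩
  refine ⟨min c c', lt_min hc hc', fun ν hν hn z hz => ?_⟩
  have hz' := h.isLowEigenvalue_iff.1 hz
  have hν' := (mem_sector_iff hθ₀).1 hν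
  have hyp := hy0 (ν, z)
  rcases le_total n₁ ‖ν‖ with hle | hle
  · have := H1 ν hle hν'.2 z z _ _ hz'.2 hz'.2 (dirSol_mem_graph h.neg_lt h.continuous hz'.1)
      (dirSol_mem_graph h.neg_lt h.continuous hz'.1)
    refine le_trans ?_ this
    rw [pow_two]
    gcongr
    exact min_le_left _ _
  · have := hmin (ν, z) ⟨hν'.1, hν'.2, hn, hle, hz'.2, hz'.1⟩
    rw [le_div_iff₀ (by positivity)] at this
    refine le_trans ?_ this
    gcongr
    exact min_le_right _ _

/-- Above a threshold, `φ_ν` is a bounded family of low-energy eigenfunctions. -/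
theorem exists_norm_phi_le (h : IsPotential Lneg Lpos q q₁ q₂) {θ₀ ν₀ : ℝ}
    (hθ₀ : θ₀ ∈ Ico 0 (Real.pi / 2)) (hν₀ : IsThreshold Lneg Lpos q θ₀ ν₀) :
    ∃ C, 0 < C ∧ ∀ ν ∈ sector θ₀, ν₀ ≤ ‖ν‖ → ‖phi Lneg Lpos q ν‖ ≤ C ∧
      ∃ z, ‖z - (q₁ 0 : ℂ) * ν‖ ≤ q₁ 0 * ‖ν‖ ∧
        (phi Lneg Lpos q ν, z • phi Lneg Lpos q ν) ∈ schrodingerGraph Lneg Lpos q ν := by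
  have hκ : 0 < Real.cos θ₀ := Real.cos_pos_of_mem_Ioo
    ⟨by linarith [hθ₀.1, Real.pi_pos], hθ₀.2⟩
  obtain ⟨c, hc, H⟩ := h.exists_le_norm_bil_dirSol hθ₀ hν₀
  obtain ⟨C, hC, HC⟩ := exists_norm_gauss_le (Lneg := Lneg) (Lpos := Lpos)
    ((h.hasDerivAt 0).deriv.symm ▸ h.deriv_pos) hκ
  refine ⟨C / c, by positivity, fun ν hν hn => ?_⟩
  have hex : ∃ lam, IsLowEigenvalue Lneg Lpos q ν lam := (hν₀.2 ν hν hn).imp fun _ h => h.1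
  have hz : IsLowEigenvalue Lneg Lpos q ν (lowEigenvalue Lneg Lpos q ν) := by
    rw [lowEigenvalue, dif_pos hex]
    exact hex.choose_spec
  have H := H ν hν hn _ hz
  obtain ⟨hD, hz⟩ := h.isLowEigenvalue_iff.1 hz
  have hν' := (mem_sector_iff hθ₀).1 hν
  have HC := HC ν (by linarith) hν'.2
  set z := lowEigenvalue Lneg Lpos q ν with hzd
  have hy := norm_pos_iff.2 (dirSol_ne_zero h.neg_lt h.continuous (ν, z))
  set y := dirSol Lneg Lpos q h.continuous (ν, z) with hyd
  have hB : 0 < ‖bil Lneg Lpos y y‖ := lt_of_lt_of_le (by positivity) H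
  -- With this formula, `‖φ_ν‖ ≤ ‖y‖² ‖gauss‖ / |bil y y| ≤ C / c`.
  have e : phi Lneg Lpos q ν = ((bil Lneg Lpos y y)⁻¹ • bil Lneg Lpos y)
      (gauss Lneg Lpos q ν) • y :=
    spectralProjection_eq h.neg_lt h.continuous hD (norm_pos_iff.1 hB) _
  refine ⟨?_, z, hz, ?_⟩
  · rw [e, smul_apply, norm_smul, norm_smul, norm_inv, div_eq_mul_inv]
    have h1 : ‖bil Lneg Lpos y (gauss Lneg Lpos q ν)‖ ≤ ‖y‖ * C :=
      (norm_bil_le _ _).trans (by gcongr)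
    have h2 : ‖bil Lneg Lpos y y‖⁻¹ ≤ (c * ‖y‖ ^ 2)⁻¹ := by gcongr
    calc _ ≤ (c * ‖y‖ ^ 2)⁻¹ * (‖y‖ * C) * ‖y‖ := by gcongr
      _ = _ := by field_simp
  · rw [e, smul_comm z]
    exact Submodule.smul_mem _ _ (dirSol_mem_graph h.neg_lt h.continuous hD)

end IsPotential

end Threshold

/-! ### Agmon estimates -/

section Agmon

open scoped ComplexConjugate

/-- After conjugation by the complex weight `e^{νθδ}`, the cross terms carry the real factor `θ ‖ν‖²
Q` and are purely imaginary. The potential is only reduced by the factor `1 - θ²`. -/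
theorem agmon_identity (ν z W W' : ℂ) (Q θ : ℝ) :
    (conj ν * ((θ * ν * Q * (W' - θ * ν * Q * W) + (ν ^ 2 * (Q : ℂ) ^ 2 - z) * W) * conj W
      + (W' - θ * ν * Q * W) * conj W')).re
      = ν.re * ‖W'‖ ^ 2 + ‖ν‖ ^ 2 * ν.re * (1 - θ ^ 2) * Q ^ 2 * ‖W‖ ^ 2
        - (conj ν * z).re * ‖W‖ ^ 2 := by
  simp only [Complex.sq_norm, Complex.normSq_apply]
  simp only [Complex.mul_re, Complex.mul_im, Complex.add_re,
    Complex.add_im, Complex.sub_re, Complex.sub_im, Complex.conj_re, Complex.conj_im,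
    Complex.ofReal_re, Complex.ofReal_im, pow_two]
  ring

variable {Lneg Lpos : ℝ} {q q₁ q₂ : ℝ → ℝ}

namespace IsPotential

/-- Agmon's method for `W = U e^{νθδ}`: the energy identity bounds `κ ∫ ‖W'‖²` and `‖ν‖² ∫ x² ‖W‖²`
by `‖ν‖ ∫ ‖W‖²`, up to constants. The region `‖ν‖ x² ≥ 4γ/e` is thereby absorbed, and on the rest
the weight is bounded uniformly in `ν`. -/
theorem exists_agmon_le (h : IsPotential Lneg Lpos q q₁ q₂) {κ θ : ℝ} (hκ : 0 < κ)
    (hθ0 : 0 ≤ θ) (hθ1 : θ < 1) :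
    ∃ C, 0 < C ∧ ∀ (ν z : ℂ) (U U₁ U₂ : ℝ → ℂ), IsLowSol Lneg Lpos q (q₁ 0) κ ν z 0 U U₁ U₂ →
      (∫ x in (-Lneg)..Lpos, ‖U x * Complex.exp (ν * θ * (agmon q x : ℂ))‖ ^ 2
        ≤ C * ∫ x in (-Lneg)..Lpos, ‖U x‖ ^ 2) ∧
      ∀ x ∈ Icc (-Lneg) Lpos, ‖U x * Complex.exp (ν * θ * (agmon q x : ℂ))‖ ^ 2
        ≤ C * ‖ν‖ * ∫ x in (-Lneg)..Lpos, ‖U x‖ ^ 2 := by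
  obtain ⟨M, hM1, hM⟩ := h.exists_upper
  obtain ⟨m, hm0, hmγ, hm⟩ := h.exists_lower
  have hγ := h.deriv_pos
  set γ := q₁ 0 with hγd
  have hθ2 : 0 < 1 - θ ^ 2 := by nlinarith
  set e := κ * (1 - θ ^ 2) * m ^ 2 with he
  have he0 : 0 < e := by positivity
  set T := 2 * Real.exp (2 * (M * (4 * γ / e))) with hT
  have hT0 : 0 < T := by positivity
  refine ⟨(1 + 2 * γ / κ) * T, by positivity, fun ν z U U₁ U₂ hU => ?_⟩
  have hn1 := hU.one_le
  have hn0 : 0 < ‖ν‖ := by linarith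
  have hre := hU.re_le
  have hUc := hU.continuous
  have hU1c := hU.continuous'
  have hU2c := hU.cont
  have hqc := h.continuous
  have hδc := h.continuous_agmon
  set f : ℝ → ℂ := fun x => Complex.exp (ν * θ * (agmon q x : ℂ)) with hf
  have hfd : ∀ x, HasDerivAt f (θ * ν * q x * f x) x := fun x => by
    have h1 := (((h.hasDerivAt_agmon x).ofReal_comp).const_mul (ν * θ)).cexp
    exact h1.congr_deriv (by
      change Complex.exp (ν * θ * (agmon q x : ℂ)) * (ν * θ * (q x : ℂ)) = _
      simp only [hf]
      ring)
  have hfc : Continuous f := continuous_of_hasDerivAt hfd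
  set W : ℝ → ℂ := fun x => U x * f x with hW
  set W' : ℝ → ℂ := fun x => U₁ x * f x + U x * (θ * ν * q x * f x) with hW'
  have hWd : ∀ x, HasDerivAt W (W' x) x := fun x => (hU.hasDerivAt x).mul (hfd x)
  have hWc : Continuous W := continuous_of_hasDerivAt hWd
  have hW'c : Continuous W' := by fun_prop
  have hYd : ∀ x, HasDerivAt (fun x => U₁ x * f x) (U₂ x * f x + U₁ x * (θ * ν * q x * f x)) x :=
    fun x => (hU.hasDerivAt' x).mul (hfd x)
  have hWl : W (-Lneg) = 0 := by simp only [hW, hU.left, zero_mul]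
  have hWr : W Lpos = 0 := by simp only [hW, hU.right, zero_mul]
  have h0 := integral_re_deriv_mul_conj hYd hWd (by fun_prop) hW'c (a := -Lneg) (b := Lpos)
    (by rw [hWl]; simp) (by rw [hWr]; simp) (conj ν)
  have hcW : Continuous fun x => conj (W x) := Complex.continuous_conj.comp hWc
  have hcW' : Continuous fun x => conj (W' x) := Complex.continuous_conj.comp hW'c
  set S := ∫ x in (-Lneg)..Lpos, ‖W x‖ ^ 2 with hS
  set S' := ∫ x in (-Lneg)..Lpos, ‖W' x‖ ^ 2 with hS'
  set V := ∫ x in (-Lneg)..Lpos, ‖U x‖ ^ 2 with hV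
  have hS0 : 0 ≤ S := intervalIntegral.integral_nonneg h.neg_lt.le fun x _ => sq_nonneg _
  have key : κ * S' + ‖ν‖ ^ 2 * e * (∫ x in (-Lneg)..Lpos, x ^ 2 * ‖W x‖ ^ 2)
      ≤ 2 * γ * ‖ν‖ * S := by
    have h1 : ∫ x in (-Lneg)..Lpos, ‖ν‖ * (κ * ‖W' x‖ ^ 2 + ‖ν‖ ^ 2 * e * (x ^ 2 * ‖W x‖ ^ 2))
        ≤ ∫ x in (-Lneg)..Lpos, ‖ν‖ * (2 * γ * ‖ν‖ * ‖W x‖ ^ 2) := by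
      refine integral_le_of_le_add h.neg_lt.le (by fun_prop) (by fun_prop) (by fun_prop) h0
        fun x hx => ?_
      have e1 : U₁ x * f x = W' x - θ * ν * q x * W x := by
        simp only [hW', hW]
        ring
      have e2 : U₂ x * f x + U₁ x * (θ * ν * q x * f x)
          = θ * ν * q x * (W' x - θ * ν * q x * W x) + (ν ^ 2 * (q x : ℂ) ^ 2 - z) * W x := by
        rw [← e1, hU.eq x hx]
        simp only [hW]
        ring
      rw [e2, e1, agmon_identity]
      have b2 := re_conj_mul_le_of_mem_disk hγ.le hU.z_le
      have c1 : κ * ‖ν‖ * ‖W' x‖ ^ 2 ≤ ν.re * ‖W' x‖ ^ 2 := by gcongr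
      have c2 : (conj ν * z).re * ‖W x‖ ^ 2 ≤ 2 * γ * ‖ν‖ ^ 2 * ‖W x‖ ^ 2 := by gcongr
      have c3 : (m * x ^ 2) ^ 2 ≤ (x * q x) ^ 2 := by
        have := hm x hx
        gcongr
      have c4 : m ^ 2 * x ^ 2 ≤ q x ^ 2 := by
        by_cases hx0 : x = 0
        · rw [hx0]
          simp [sq_nonneg]
        · refine le_of_mul_le_mul_left (a := x ^ 2) ?_ (by positivity)
          nlinarith
      have hre0 : 0 ≤ ν.re := le_trans (by positivity) hre
      have c5 : ‖ν‖ ^ 2 * (κ * ‖ν‖) * (1 - θ ^ 2) * (m ^ 2 * x ^ 2) * ‖W x‖ ^ 2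
          ≤ ‖ν‖ ^ 2 * ν.re * (1 - θ ^ 2) * q x ^ 2 * ‖W x‖ ^ 2 := by gcongr
      rw [he]
      linarith
    rw [intervalIntegral.integral_const_mul, intervalIntegral.integral_const_mul ‖ν‖,
      intervalIntegral.integral_const_mul (2 * γ * ‖ν‖),
      intervalIntegral.integral_add (Continuous.intervalIntegrable (by fun_prop) _ _)
      (Continuous.intervalIntegrable (by fun_prop) _ _), intervalIntegral.integral_const_mul,
      intervalIntegral.integral_const_mul (‖ν‖ ^ 2 * e)] at h1
    exact le_of_mul_le_mul_left h1 hn0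
  have hS'0 : 0 ≤ S' := intervalIntegral.integral_nonneg h.neg_lt.le fun x _ => sq_nonneg _
  have hSV : S ≤ T * V := by
    have h1 : ∫ x in (-Lneg)..Lpos, (4 * γ * ‖ν‖ * ‖W x‖ ^ 2 - ‖ν‖ ^ 2 * e * (x ^ 2 * ‖W x‖ ^ 2))
        ≤ ∫ x in (-Lneg)..Lpos, 2 * γ * ‖ν‖ * T * ‖U x‖ ^ 2 := by
      refine intervalIntegral.integral_mono_on h.neg_lt.le
        (Continuous.intervalIntegrable (by fun_prop) _ _)
        (Continuous.intervalIntegrable (by fun_prop) _ _) fun x hx => ?_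
      -- In the outer region the left side is nonpositive; in the inner one `‖ν‖ δ ≤ M ‖ν‖ x²`
      -- bounds the weight.
      rcases le_total (4 * γ / e) (‖ν‖ * x ^ 2) with hle | hle
      · rw [div_le_iff₀ he0] at hle
        have h2 : 4 * γ * (‖ν‖ * ‖W x‖ ^ 2) ≤ ‖ν‖ * x ^ 2 * e * (‖ν‖ * ‖W x‖ ^ 2) := by gcongr
        have h3 : 0 ≤ 2 * γ * ‖ν‖ * T * ‖U x‖ ^ 2 := by positivity
        linarith
      · have h2 : ‖f x‖ ^ 2 ≤ Real.exp (2 * (M * (4 * γ / e))) := by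
          rw [hf, Complex.norm_exp, ← Real.exp_nat_mul, mul_assoc, ← Complex.ofReal_mul,
            Complex.re_mul_ofReal]
          refine Real.exp_le_exp.2 ?_
          obtain ⟨-, -, -, -, -, -, hδ⟩ := hM x hx
          have h3 : ν.re * (θ * agmon q x) ≤ ‖ν‖ * (1 * (M * x ^ 2)) := by
            have h4 := Complex.re_le_norm ν
            have h5 : 0 ≤ agmon q x := le_trans (by positivity) (h.agmon_lower hm hx)
            have h6 := (le_abs_self _).trans hδ
            gcongr
          have h4 : M * (‖ν‖ * x ^ 2) ≤ M * (4 * γ / e) := by gcongr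
          push_cast
          linarith
        have h3 : ‖W x‖ ^ 2 ≤ T / 2 * ‖U x‖ ^ 2 := by
          simp only [hW]
          rw [norm_mul, mul_pow, hT, mul_comm]
          gcongr
          linarith
        have h4 : 4 * γ * ‖ν‖ * ‖W x‖ ^ 2 ≤ 4 * γ * ‖ν‖ * (T / 2 * ‖U x‖ ^ 2) := by gcongr
        have h5 : 0 ≤ ‖ν‖ ^ 2 * e * (x ^ 2 * ‖W x‖ ^ 2) := by positivity
        linarith
    rw [intervalIntegral.integral_sub (Continuous.intervalIntegrable (by fun_prop) _ _)
      (Continuous.intervalIntegrable (by fun_prop) _ _), intervalIntegral.integral_const_mul,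
      intervalIntegral.integral_const_mul (‖ν‖ ^ 2 * e),
      intervalIntegral.integral_const_mul (2 * γ * ‖ν‖ * T)] at h1
    have h2 : 0 ≤ κ * S' := by positivity
    refine le_of_mul_le_mul_left (a := 2 * γ * ‖ν‖) ?_ (by positivity)
    linarith
  have hV0 : 0 ≤ V := intervalIntegral.integral_nonneg h.neg_lt.le fun x _ => sq_nonneg _
  refine ⟨hSV.trans ?_, fun x hx => ?_⟩
  · gcongr
    have : 0 ≤ 2 * γ / κ * T := by positivity
    linarith
  -- One-dimensional Sobolev inequality, starting from `W = 0` at the left end point; the energy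
  -- bound then gives `S' = O(‖ν‖ S)`.
  · have h1 : ‖W x‖ ^ 2 ≤ S + S' := by
      have i1 := intervalIntegral.integral_eq_sub_of_hasDerivAt (a := -Lneg) (b := x)
        (fun x _ => hasDerivAt_norm_sq (hWd x)) (Continuous.intervalIntegrable (by fun_prop) _ _)
      rw [hWl, norm_zero, zero_pow two_ne_zero, sub_zero] at i1
      have i2 : ∫ t in (-Lneg)..x, 2 * (W' t * conj (W t)).re
          ≤ ∫ t in (-Lneg)..x, (‖W t‖ ^ 2 + ‖W' t‖ ^ 2) := by
        refine intervalIntegral.integral_mono_on hx.1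
          (Continuous.intervalIntegrable (by fun_prop) _ _)
          (Continuous.intervalIntegrable (by fun_prop) _ _) fun t _ => ?_
        have := (le_abs_self _).trans (abs_re_mul_conj_le (W' t) (W t))
        nlinarith [sq_nonneg (‖W' t‖ - ‖W t‖)]
      have i3 : ∫ t in (-Lneg)..x, (‖W t‖ ^ 2 + ‖W' t‖ ^ 2)
          ≤ ∫ t in (-Lneg)..Lpos, (‖W t‖ ^ 2 + ‖W' t‖ ^ 2) :=
        intervalIntegral.integral_mono_interval le_rfl hx.1 hx.2
          (Filter.Eventually.of_forall fun t => by simp only [Pi.zero_apply]; positivity)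
          (Continuous.intervalIntegrable (by fun_prop) _ _)
      rw [intervalIntegral.integral_add (Continuous.intervalIntegrable (by fun_prop) _ _)
        (Continuous.intervalIntegrable (by fun_prop) _ _) (a := -Lneg) (b := Lpos)] at i3
      rw [← i1]
      exact i2.trans i3
    have h2 : S' ≤ 2 * γ / κ * ‖ν‖ * S := by
      have : 0 ≤ ∫ x in (-Lneg)..Lpos, x ^ 2 * ‖W x‖ ^ 2 :=
        intervalIntegral.integral_nonneg h.neg_lt.le fun x _ => by positivity
      have h3 : 0 ≤ ‖ν‖ ^ 2 * e * (∫ x in (-Lneg)..Lpos, x ^ 2 * ‖W x‖ ^ 2) := by positivity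
      rw [div_mul_eq_mul_div, div_mul_eq_mul_div, le_div_iff₀ hκ]
      linarith
    have h3 : S ≤ ‖ν‖ * S := by nlinarith
    calc ‖W x‖ ^ 2 ≤ (1 + 2 * γ / κ) * ‖ν‖ * S := by linarith
      _ ≤ (1 + 2 * γ / κ) * ‖ν‖ * (T * V) := by gcongr
      _ = _ := by ring

/-- Exponential decay of `φ_ν` above a threshold. -/
theorem exists_weightedPhi_le (h : IsPotential Lneg Lpos q q₁ q₂) {θ₀ ν₀ : ℝ}
    (hθ₀ : θ₀ ∈ Ico 0 (Real.pi / 2)) (hν₀ : IsThreshold Lneg Lpos q θ₀ ν₀) {ε : ℝ}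
    (hε : ε ∈ Ioo (0 : ℝ) 1) :
    ∃ C, 0 < C ∧ ∀ ν ∈ sector θ₀, ν₀ ≤ ‖ν‖ →
      (∫⁻ x in Ioo (-Lneg) Lpos, ‖weightedPhi Lneg Lpos q ε ν x‖ₑ ^ 2
        ≤ ENNReal.ofReal (C * ‖ν‖)) ∧
      eLpNorm (weightedPhi Lneg Lpos q ε ν) ⊤ (volume.restrict (Ioo (-Lneg) Lpos))
        ≤ ENNReal.ofReal (C * ‖ν‖) := by
  have hκ : 0 < Real.cos θ₀ := Real.cos_pos_of_mem_Ioo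
    ⟨by linarith [hθ₀.1, Real.pi_pos], hθ₀.2⟩
  obtain ⟨C₁, hC₁, H1⟩ := h.exists_norm_phi_le hθ₀ hν₀
  obtain ⟨C₂, hC₂, H2⟩ := h.exists_agmon_le hκ (θ := 1 - ε) (by linarith [hε.2])
    (by linarith [hε.1])
  refine ⟨C₂ * C₁ ^ 2 + 1, by positivity, fun ν hν hn => ?_⟩
  have hν' := (mem_sector_iff hθ₀).1 hν
  obtain ⟨hφ, z, hz, hg⟩ := H1 ν hν hn
  have hf0 : Continuous fun _ : ℝ => (0 : ℂ) := continuous_const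
  have e0 : ofCont Lneg Lpos (fun _ => 0) hf0 = 0 := by
    symm
    rw [ofCont_eq_iff]
    exact Lp.coeFn_zero _ _ _
  obtain ⟨U, U₁, U₂, hU, hφU, heq⟩ := exists_classical h.neg_lt h.continuous (ν := ν) (z := z)
    (u := phi Lneg Lpos q ν) hf0 (by rw [e0, sub_zero]; exact hg)
  have hUc := hU.continuous
  have hδc := h.continuous_agmon
  have hlow : IsLowSol Lneg Lpos q (q₁ 0) (Real.cos θ₀) ν z 0 U U₁ U₂ :=
    { hU with
      one_le := hν'.1
      re_le := hν'.2
      z_le := hz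
      eq := fun x hx => by rw [heq x hx]; ring }
  obtain ⟨hA, hB⟩ := H2 ν z U U₁ U₂ hlow
  have hV : ∫ x in (-Lneg)..Lpos, ‖U x‖ ^ 2 ≤ C₁ ^ 2 := by
    rw [← setIntegral_Ioo_eq_intervalIntegral h.neg_lt.le, ← norm_sq_ofCont hUc, ← hφU]
    gcongr
  have hae : weightedPhi Lneg Lpos q ε ν =ᵐ[volI Lneg Lpos]
      fun x => U x * Complex.exp (ν * ((1 - ε : ℝ) : ℂ) * (agmon q x : ℂ)) := by
    filter_upwards [ofCont_eq_iff.1 hφU] with x hx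
    rw [weightedPhi, hx]
    push_cast
    rfl
  set W : ℝ → ℂ := fun x => U x * Complex.exp (ν * ((1 - ε : ℝ) : ℂ) * (agmon q x : ℂ)) with hW
  have hWc : Continuous W := by fun_prop
  constructor
  · have e1 : ∫⁻ x in Ioo (-Lneg) Lpos, ‖weightedPhi Lneg Lpos q ε ν x‖ₑ ^ 2
        = ∫⁻ x in Ioo (-Lneg) Lpos, ENNReal.ofReal (‖W x‖ ^ 2) := by
      refine lintegral_congr_ae ?_
      filter_upwards [hae] with x hx
      rw [hx, ENNReal.ofReal_pow (norm_nonneg _), ofReal_norm]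
    have hWi : IntegrableOn (fun x => ‖W x‖ ^ 2) (Ioo (-Lneg) Lpos) :=
      (hWc.norm.pow 2).integrableOn_Icc.mono_set Ioo_subset_Icc_self
    rw [e1, ← ofReal_integral_eq_lintegral_ofReal hWi
      (Filter.Eventually.of_forall fun x => sq_nonneg _),
      setIntegral_Ioo_eq_intervalIntegral h.neg_lt.le]
    refine ENNReal.ofReal_le_ofReal (hA.trans ?_)
    have h1 : C₂ * (∫ x in (-Lneg)..Lpos, ‖U x‖ ^ 2) ≤ C₂ * C₁ ^ 2 := by gcongr
    have h2 : 0 ≤ C₂ * C₁ ^ 2 := by positivity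
    nlinarith [hν'.1]
  · rw [eLpNorm_exponent_top]
    refine eLpNormEssSup_le_of_ae_bound ?_
    filter_upwards [hae, ae_restrict_mem measurableSet_Ioo] with x hx hxI
    rw [hx]
    -- The supremum is in fact `O(‖ν‖^{1/2})`. The bound is weakened using `1 ≤ ‖ν‖`, and the `+ 1`
    -- in the constant dominates `C₂ C₁²` by the square of the constant.
    refine abs_le_of_sq_le_sq' ?_ (by positivity) |>.2
    refine (hB x (Ioo_subset_Icc_self hxI)).trans ?_
    calc C₂ * ‖ν‖ * (∫ x in (-Lneg)..Lpos, ‖U x‖ ^ 2) ≤ C₂ * ‖ν‖ * C₁ ^ 2 := by gcongr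
      _ = (C₂ * C₁ ^ 2) * ‖ν‖ := by ring
      _ ≤ (C₂ * C₁ ^ 2 + 1) ^ 2 * ‖ν‖ ^ 2 := by
        have h2 : 0 ≤ C₂ * C₁ ^ 2 := by positivity
        have h3 : ‖ν‖ ≤ ‖ν‖ ^ 2 := by nlinarith [hν'.1]
        gcongr
        nlinarith
      _ = _ := by ring

end IsPotential

/-! ### Changing the potential outside the interval -/

theorem isThreshold_congr {Q : ℝ → ℝ} (hQ : ∀ x ∈ Ioo (-Lneg) Lpos, q x = Q x)
    (hd : deriv q 0 = deriv Q 0) (θ₀ ν₀ : ℝ) :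
    IsThreshold Lneg Lpos q θ₀ ν₀ ↔ IsThreshold Lneg Lpos Q θ₀ ν₀ := by
  simp only [IsThreshold, IsLowEigenvalue, schrodinger_congr hQ, hd]

theorem weightedPhi_congr {Q : ℝ → ℝ} (hQ : ∀ x ∈ Ioo (-Lneg) Lpos, q x = Q x)
    (hd : deriv q 0 = deriv Q 0) (h0 : (0 : ℝ) ∈ Ioo (-Lneg) Lpos) (ε : ℝ) (ν : ℂ) {x : ℝ}
    (hx : x ∈ Ioo (-Lneg) Lpos) :
    weightedPhi Lneg Lpos q ε ν x = weightedPhi Lneg Lpos Q ε ν x := by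
  have h1 : agmon q x = agmon Q x := intervalIntegral.integral_congr fun t ht =>
    hQ t (ordConnected_Ioo.uIcc_subset h0 hx ht)
  have h2 : gaussFun q ν = gaussFun Q ν := by
    ext x
    rw [gaussFun, gaussFun, hd]
  have h3 : gauss Lneg Lpos q ν = gauss Lneg Lpos Q ν := by
    simp only [gauss, h2]
  have h4 : lowEigenvalue Lneg Lpos q ν = lowEigenvalue Lneg Lpos Q ν := by
    have : IsLowEigenvalue Lneg Lpos q ν = IsLowEigenvalue Lneg Lpos Q ν := by
      ext lam
      rw [IsLowEigenvalue, IsLowEigenvalue, schrodinger_congr hQ, hd]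
    unfold lowEigenvalue
    rw [this]
  rw [weightedPhi, weightedPhi, phi, phi, schrodinger_congr hQ, h1, h3, h4]

end Agmon

end Grushin

end

/-! ### Reduction of the theorem to a potential of class `C²` on the whole line. -/

theorem corollary4p5
    (Lneg Lpos : ℝ) (hLneg : 0 < Lneg) (hLpos : 0 < Lpos)
    (q : ℝ → ℝ) (hq : ContDiffOn ℝ 2 q (Set.Icc (-Lneg) Lpos))
    (hq0 : q 0 = 0) (hq0' : 0 < deriv q 0)
    (hqne : ∀ x ∈ Set.Icc (-Lneg) Lpos, x ≠ 0 → q x ≠ 0)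
    (θ₀ : ℝ) (hθ₀ : θ₀ ∈ Set.Ico 0 (Real.pi / 2)) :
    (∃ ν₀ : ℝ, Grushin.IsThreshold Lneg Lpos q θ₀ ν₀) ∧
    ∀ ν₀ : ℝ, Grushin.IsThreshold Lneg Lpos q θ₀ ν₀ →
      ∀ ε ∈ Set.Ioo (0 : ℝ) 1, ∃ C : ℝ, 0 < C ∧
        ∀ ν ∈ Grushin.sector θ₀, ν₀ ≤ ‖ν‖ →
          (∫⁻ x in Set.Ioo (-Lneg) Lpos, ‖Grushin.weightedPhi Lneg Lpos q ε ν x‖ₑ ^ 2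
              ≤ ENNReal.ofReal (C * ‖ν‖)) ∧
          MeasureTheory.eLpNorm (Grushin.weightedPhi Lneg Lpos q ε ν) ⊤
              (MeasureTheory.volume.restrict (Set.Ioo (-Lneg) Lpos))
            ≤ ENNReal.ofReal (C * ‖ν‖) := by
  -- The operator, `q'(0)`, the Gaussian and the Agmon distance depend only on `q` inside the
  -- interval, so `q` may be replaced by a global `C²` extension. The functions need to agree only
  -- almost everywhere on the interval.
  obtain ⟨Q, Q₁, Q₂, hQ, hQ', hQ₂, hQq⟩ := Grushin.exists_C2_extension
    (by linarith : -Lneg < Lpos) hq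
  have h0 : (0 : ℝ) ∈ Set.Ioo (-Lneg) Lpos := ⟨by linarith, hLpos⟩
  have hqQ : ∀ x ∈ Set.Ioo (-Lneg) Lpos, q x = Q x := fun x hx =>
    (hQq x (Set.Ioo_subset_Icc_self hx)).symm
  have hd : deriv q 0 = deriv Q 0 := by
    refine Filter.EventuallyEq.deriv_eq ?_
    filter_upwards [isOpen_Ioo.mem_nhds h0] with x hx using hqQ x hx
  have h : Grushin.IsPotential Lneg Lpos Q Q₁ Q₂ :=
    { Lneg_pos := hLneg
      Lpos_pos := hLpos
      hasDerivAt := hQ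
      hasDerivAt' := hQ'
      cont := hQ₂
      zero := by rw [← hqQ 0 h0, hq0]
      deriv_pos := by rwa [← (hQ 0).deriv, ← hd]
      ne_zero := fun x hx hx0 => by
        rw [hQq x hx]
        exact hqne x hx hx0 }
  refine ⟨(h.exists_isThreshold hθ₀).imp fun ν₀ hν₀ =>
    (Grushin.isThreshold_congr hqQ hd θ₀ ν₀).2 hν₀, fun ν₀ hν₀ ε hε => ?_⟩
  obtain ⟨C, hC, H⟩ := h.exists_weightedPhi_le hθ₀
    ((Grushin.isThreshold_congr hqQ hd θ₀ ν₀).1 hν₀) hε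
  refine ⟨C, hC, fun ν hν hn => ?_⟩
  have hae : Grushin.weightedPhi Lneg Lpos q ε ν
      =ᵐ[MeasureTheory.volume.restrict (Set.Ioo (-Lneg) Lpos)]
        Grushin.weightedPhi Lneg Lpos Q ε ν := by
    filter_upwards [MeasureTheory.ae_restrict_mem measurableSet_Ioo] with x hx using
      Grushin.weightedPhi_congr hqQ hd h0 ε ν hx
  rw [MeasureTheory.eLpNorm_congr_ae hae, MeasureTheory.lintegral_congr_ae
    (g := fun x => ‖Grushin.weightedPhi Lneg Lpos Q ε ν x‖ₑ ^ 2)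
    (hae.mono fun x hx => by simp only [hx])]
  exact H ν hν hn
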